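/- Let $g\ge 0$ and $n\ge 1$ be integers, write $[n]=\{1,\dots,n\}$, and let $X=\Sigma_{g,1}$ be the once-punctured Riemann surface of genus $g$, with basis $x^{(1)},\dots,x^{(g)},y^{(1)},\dots,y^{(g)}$ of $H^1(X;\mathbb Q)$. **The $E_2$ page.** Let $E_2(X,n)$ be the graded-commutative $\mathbb Q$-algebra generated by elements $g_{ij}=g_{ji}$ (one for each unordered pair of distinct $i,j\in[n]$) and $x^{(a)}_i,y^{(a)}_i$ ($1\le a\le g$, $i\in[n]$), all of odd total degree $1$, modulo the relations $$g_{ij}g_{jk}+g_{jk}g_{ki}+g_{ki}g_{ij}=0\ (i,j,k\text{ distinct}),\qquad g_{ij}\alpha_i=g_{ij}\alpha_j\ (i\neq j),\qquad \alpha_i\beta_i=0\qquad(\alpha,\beta\in H^1(X)),$$ where $\alpha_i$ depends linearly on $\alpha$. It is graded by $(p,q,w_1,w_2)$, with $g_{ij}$, $x^{(a)}_i$, $y^{(a)}_i$ in degrees $(0,1,1,1)$, $(1,0,1,0)$, $(1,0,0,1)$ respectively. Its differential $d$ is the graded derivation with $d\alpha_i=0$ and $dg_{ij}=-\sum_{a=1}^g\bigl(x^{(a)}_iy^{(a)}_j+x^{(a)}_jy^{(a)}_i\bigr)$.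 The symmetric group $S_n$ acts by permuting lower indices, commuting with $d$; put $e_n=\frac1{n!}\sum_{\sigma\in S_n}\sigma$. **The combinatorial complex.** Let $\Gamma_g$ be the set of tuples $\mathbf t=(\rho,S,T,\vec u,\vec v)$ with $\rho\in\{0,1\}$, $S,T\subseteq\{1,\dots,g\}$, $\vec u,\vec v\in\mathbb Z_{\ge0}^g$; let $\ell(\mathbf t)=2\rho+|S|+|T|+2|\vec u|+2|\vec v|$, where $|\vec u|=\sum_a u_a$ and $|\vec v|=\sum_a v_a$, and let $\mathbf t$ have degree $$(p,q,w_1,w_2)=\bigl(|S|+|T|+|\vec u|+|\vec v|,\ \rho+|\vec u|+|\vec v|,\ \rho+|S|+2|\vec u|+|\vec v|,\ \rho+|T|+|\vec u|+2|\vec v|\bigr).$$ Let $\mathbb Q\Gamma_{g,n}$ be the graded vector space with basis the symbols $f_{\mathbf t}$, $\mathbf t\in\Gamma_g$, $\ell(\mathbf t)\le n$, with differential $d f_{(0,S,T,\vec u,\vec v)}=0$ and $$d f_{(1,S,T,\vec u,\vec v)}=-2\sum_{a\notin S\cup T}(-1)^{|S|+|S_{<a}|+|T_{<a}|}f_{(0,S\sqcup\{a\},T\sqcup\{a\},\vec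 u,\vec v)},$$ where $S_{<a}=\{b\in S:b<a\}$ and $T_{<a}=\{b\in T:b<a\}$. **Claim.** There is an isomorphism of complexes $(\mathbb Q\Gamma_{g,n},d)\simeq(E_2(X,n)^{S_n},d)$ that preserves the quadruple grading $(p,q,w_1,w_2)$. It sends each basis vector $f_{\mathbf t}$ to the distinguished generator $$e_n\Bigl(g_{\bullet\bullet}^{\rho}\prod_{a\in S}x^{(a)}_\bullet\prod_{a\in T}y^{(a)}_\bullet\prod_{a=1}^g\bigl(x^{(a)}_{\bullet\bullet}\bigr)^{u_a}\prod_{a=1}^g\bigl(y^{(a)}_{\bullet\bullet}\bigr)^{v_a}\Bigr),$$ where the factors are in ascending order of $a$, $\alpha_{ij}:=g_{ij}\alpha_i$, a power $(\alpha_{\bullet\bullet})^{u}$ means a product of $u$ factors with different indices, and the $\ell(\mathbf t)$ bullets are any pairwise distinct elements of $[n]$. In particular, these elements do not depend on the choice of indices, are linearly independent, and form a basis of $E_2(X,n)^{S_n}$. -/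

import Mathlib

noncomputable section

namespace TotaroSS

/-- The first rational cohomology `H¹(X)` of the once-punctured genus `g` surface, in coordinates
with respect to its basis `x⁽¹⁾, …, x⁽ᵍ⁾, y⁽¹⁾, …, y⁽ᵍ⁾`:
`Sum.inl a` is the index of `x⁽ᵃ⁾` and `Sum.inr a` is the index of `y⁽ᵃ⁾`. -/
abbrev H1 (g : ℕ) : Type := Fin g ⊕ Fin g → ℚ

/-- Indices of the algebra generators: `G e` is the index of `g_{ij}`, where `e = {i, j}` is an
unordered pair of distinct points; `C (Sum.inl a) i` is the index of `x⁽ᵃ⁾_i` and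
`C (Sum.inr a) i` is the index of `y⁽ᵃ⁾_i`. -/
inductive Gen (g n : ℕ) : Type
  | G (e : {e : Sym2 (Fin n) // ¬ e.IsDiag}) : Gen g n
  | C (c : Fin g ⊕ Fin g) (i : Fin n) : Gen g n

/-- The free graded-commutative `ℚ`-algebra on the generators. All of them have odd total degree
`1`, so this is the exterior algebra of the vector space with basis the generators. -/
abbrev Free (g n : ℕ) : Type := ExteriorAlgebra ℚ (Gen g n →₀ ℚ)

/-- A generator, as an element of the free graded-commutative algebra. -/
def fgen {g n : ℕ} (s : Gen g n) : Free g n := ExteriorAlgebra.ι ℚ (Finsupp.single s 1)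

/-- The generator `g_{ij}` of the free algebra (for `i ≠ j`; by convention `0` if `i = j`). -/
def fG {g n : ℕ} (i j : Fin n) : Free g n :=
  if h : i = j then 0 else fgen (Gen.G ⟨s(i, j), fun h' => h (Sym2.mk_isDiag_iff.1 h')⟩)

/-- The element `α_i` of the free algebra, for `α ∈ H¹(X)`. -/
def fcls {g n : ℕ} (α : H1 g) (i : Fin n) : Free g n := ∑ c, α c • fgen (Gen.C c i)

/-- The defining relations of the `E₂` page. -/
inductive Rel (g n : ℕ) : Free g n → Free g n → Prop
  | arnold (i j k : Fin n) (hij : i ≠ j) (hjk : j ≠ k) (hki : k ≠ i) :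
      Rel g n (fG i j * fG j k + fG j k * fG k i + fG k i * fG i j) 0
  | diag (i j : Fin n) (hij : i ≠ j) (α : H1 g) : Rel g n (fG i j * fcls α i) (fG i j * fcls α j)
  | cup (i : Fin n) (α β : H1 g) : Rel g n (fcls α i * fcls β i) 0

/-- The `E₂` page of the Totaro spectral sequence for `n` points on the once-punctured surface
of genus `g`: the free graded-commutative algebra modulo the ideal generated by the relations. -/
abbrev E2 (g n : ℕ) : Type := RingQuot (Rel g n)

/-- The projection of the free algebra to the `E₂` page. -/
def proj (g n : ℕ) : Free g n →ₐ[ℚ] E2 g n := RingQuot.mkAlgHom ℚ (Rel g n)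

/-- A generator, as an element of the `E₂` page. -/
def gen {g n : ℕ} (s : Gen g n) : E2 g n := proj g n (fgen s)

/-- The element `g_{ij}` of the `E₂` page (for `i ≠ j`; by convention `0` if `i = j`). -/
def gg {g n : ℕ} (i j : Fin n) : E2 g n := proj g n (fG i j)

/-- The element `x⁽ᵃ⁾_i` of the `E₂` page. -/
def xx {g n : ℕ} (a : Fin g) (i : Fin n) : E2 g n := gen (Gen.C (Sum.inl a) i)

/-- The element `y⁽ᵃ⁾_i` of the `E₂` page. -/
def yy {g n : ℕ} (a : Fin g) (i : Fin n) : E2 g n := gen (Gen.C (Sum.inr a) i)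

/-- The element `α_i` of the `E₂` page, for `α ∈ H¹(X)`. -/
def cls {g n : ℕ} (α : H1 g) (i : Fin n) : E2 g n := proj g n (fcls α i)

theorem proj_rel {g n : ℕ} {a b : Free g n} (h : Rel g n a b) : proj g n a = proj g n b :=
  RingQuot.mkAlgHom_rel ℚ h

theorem gg_of_ne {g n : ℕ} {i j : Fin n} (h : i ≠ j) :
    (gg i j : E2 g n) = gen (Gen.G ⟨s(i, j), fun h' => h (Sym2.mk_isDiag_iff.1 h')⟩) := by
  simp [gg, fG, h, gen]

theorem cls_eq {g n : ℕ} (α : H1 g) (i : Fin n) :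
    (cls α i : E2 g n) = ∑ c, α c • gen (Gen.C c i) := by
  simp [cls, fcls, gen]

theorem arnold {g n : ℕ} {i j k : Fin n} (hij : i ≠ j) (hjk : j ≠ k) (hki : k ≠ i) :
    (gg i j * gg j k + gg j k * gg k i + gg k i * gg i j : E2 g n) = 0 := by
  simpa [gg] using proj_rel (Rel.arnold (g := g) i j k hij hjk hki)

theorem gen_cls {g n : ℕ} (c : Fin g ⊕ Fin g) (i : Fin n) :
    (gen (Gen.C c i) : E2 g n) = cls (Pi.single c 1) i := by
  simp [cls_eq, Pi.single_apply]

theorem gg_mul_cls {g n : ℕ} {i j : Fin n} (hij : i ≠ j) (α : H1 g) :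
    (gg i j * cls α i : E2 g n) = gg i j * cls α j := by
  simpa [gg, cls] using proj_rel (Rel.diag (g := g) i j hij α)

theorem gg_mul_gen {g n : ℕ} {i j : Fin n} (hij : i ≠ j) (c : Fin g ⊕ Fin g) :
    (gg i j * gen (Gen.C c i) : E2 g n) = gg i j * gen (Gen.C c j) := by
  simp [gen_cls, gg_mul_cls hij]

theorem cls_mul_cls {g n : ℕ} (i : Fin n) (α β : H1 g) : (cls α i * cls β i : E2 g n) = 0 := by
  simpa [cls] using proj_rel (Rel.cup (g := g) i α β)

theorem gen_mul_cls {g n : ℕ} (i : Fin n) (c : Fin g ⊕ Fin g) (β : H1 g) :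
    (gen (Gen.C c i) * cls β i : E2 g n) = 0 := by
  rw [gen_cls, cls_mul_cls]

theorem proj_anticomm {g n : ℕ} (v w : Gen g n →₀ ℚ) :
    proj g n (ExteriorAlgebra.ι ℚ v) * proj g n (ExteriorAlgebra.ι ℚ w) =
      -(proj g n (ExteriorAlgebra.ι ℚ w) * proj g n (ExteriorAlgebra.ι ℚ v)) := by
  rw [← map_mul (proj g n), ← map_mul (proj g n), ← map_neg (proj g n)]
  congr 1
  exact eq_neg_of_add_eq_zero_left (ExteriorAlgebra.ι_add_mul_swap v w)

theorem gen_anticomm {g n : ℕ} (s t : Gen g n) : (gen s * gen t : E2 g n) = -(gen t * gen s) :=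
  proj_anticomm _ _

/-- An algebra homomorphism out of the `E₂` page is determined by its values on generators. -/
theorem hom_ext {g n : ℕ} {A : Type*} [Ring A] [Algebra ℚ A] {φ ψ : E2 g n →ₐ[ℚ] A}
    (h : ∀ s, φ (gen s) = ψ (gen s)) : φ = ψ := by
  apply RingQuot.ringQuot_ext'
  apply ExteriorAlgebra.hom_ext
  apply Finsupp.lhom_ext'
  intro s
  apply LinearMap.ext_ring
  exact h s

/-! ### The action of the symmetric group -/

/-- A permutation of the points acts on the generators by permuting the lower indices. -/
def Gen.perm {g n : ℕ} (σ : Equiv.Perm (Fin n)) : Gen g n → Gen g n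
  | .G e => .G ⟨e.1.map σ, fun h => e.2 ((Sym2.isDiag_map σ.injective).1 h)⟩
  | .C c i => .C c (σ i)

/-- The action of a permutation on the free graded-commutative algebra. -/
def fperm {g n : ℕ} (σ : Equiv.Perm (Fin n)) : Free g n →ₐ[ℚ] Free g n :=
  ExteriorAlgebra.map (Finsupp.lmapDomain ℚ ℚ (Gen.perm σ))

theorem fperm_fgen {g n : ℕ} (σ : Equiv.Perm (Fin n)) (s : Gen g n) :
    fperm σ (fgen s) = fgen (Gen.perm σ s) := by
  simp [fperm, fgen, Finsupp.mapDomain_single]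

theorem fperm_fG {g n : ℕ} (σ : Equiv.Perm (Fin n)) (i j : Fin n) :
    fperm σ (fG i j : Free g n) = fG (σ i) (σ j) := by
  unfold fG
  by_cases h : i = j
  · simp [h]
  · simp [h, fperm_fgen, Gen.perm]

theorem fperm_fcls {g n : ℕ} (σ : Equiv.Perm (Fin n)) (α : H1 g) (i : Fin n) :
    fperm σ (fcls α i : Free g n) = fcls α (σ i) := by
  simp [fcls, fperm_fgen, Gen.perm]

/-- The action of a permutation on the `E₂` page, by algebra endomorphisms. -/
def perm {g n : ℕ} (σ : Equiv.Perm (Fin n)) : E2 g n →ₐ[ℚ] E2 g n :=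
  RingQuot.liftAlgHom ℚ ⟨(proj g n).comp (fperm σ), by
    intro a b h
    simp only [AlgHom.comp_apply]
    cases h with
    | arnold i j k hij hjk hki =>
      simpa [fperm_fG] using proj_rel (Rel.arnold (g := g) (σ i) (σ j) (σ k)
        (σ.injective.ne hij) (σ.injective.ne hjk) (σ.injective.ne hki))
    | diag i j hij α =>
      simpa [fperm_fG, fperm_fcls] using
        proj_rel (Rel.diag (g := g) (σ i) (σ j) (σ.injective.ne hij) α)
    | cup i α β =>
      simpa [fperm_fcls] using proj_rel (Rel.cup (g := g) (σ i) α β)⟩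

theorem perm_gen {g n : ℕ} (σ : Equiv.Perm (Fin n)) (s : Gen g n) :
    perm σ (gen s : E2 g n) = gen (Gen.perm σ s) := by
  have h : perm σ (proj g n (fgen s)) = proj g n (fperm σ (fgen s)) :=
    RingQuot.liftAlgHom_mkAlgHom_apply ℚ _ _ _
  rw [gen, h, fperm_fgen, gen]

theorem Gen.perm_one {g n : ℕ} (s : Gen g n) : Gen.perm 1 s = s := by
  cases s with
  | G e => simp [Gen.perm]
  | C c i => simp [Gen.perm]

theorem Gen.perm_mul {g n : ℕ} (σ τ : Equiv.Perm (Fin n)) (s : Gen g n) :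
    Gen.perm (σ * τ) s = Gen.perm σ (Gen.perm τ s) := by
  cases s with
  | G e => simp [Gen.perm, Sym2.map_map]
  | C c i => simp [Gen.perm]

/-- The representation of the symmetric group `S_n` on the `E₂` page. -/
def rep (g n : ℕ) : Representation ℚ (Equiv.Perm (Fin n)) (E2 g n) where
  toFun σ := (perm σ).toLinearMap
  map_one' := by
    have h : (perm 1 : E2 g n →ₐ[ℚ] E2 g n) = AlgHom.id ℚ _ :=
      hom_ext fun s => by simp [perm_gen, Gen.perm_one]
    rw [h]; rfl
  map_mul' σ τ := by
    have h : (perm (σ * τ) : E2 g n →ₐ[ℚ] E2 g n) = (perm σ).comp (perm τ) :=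
      hom_ext fun s => by simp [perm_gen, Gen.perm_mul]
    rw [h]; rfl

/-- The `S_n`-invariant part of the `E₂` page. -/
abbrev E2Inv (g n : ℕ) : Submodule ℚ (E2 g n) := (rep g n).invariants

/-- The symmetrization operator `e_n = (1 / n!) ∑_{σ ∈ S_n} σ`. -/
def symm (g n : ℕ) : E2 g n →ₗ[ℚ] E2 g n :=
  (1 / (n.factorial : ℚ)) • ∑ σ : Equiv.Perm (Fin n), rep g n σ

/-! ### The differential -/

/-- The diagonal class `-∑ₐ (x⁽ᵃ⁾_i y⁽ᵃ⁾_j + x⁽ᵃ⁾_j y⁽ᵃ⁾_i)` placed at the points `i`, `j`. -/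
def diagClass {g n : ℕ} (i j : Fin n) : E2 g n :=
  -∑ a : Fin g, (xx a i * yy a j + xx a j * yy a i)

theorem diagClass_comm {g n : ℕ} (i j : Fin n) : (diagClass i j : E2 g n) = diagClass j i := by
  simp [diagClass, add_comm]

/-- The differential on generators: `d g_{ij}` is the diagonal class and `d α_i = 0`. -/
def dGen {g n : ℕ} : Gen g n → E2 g n
  | .G e => Sym2.lift ⟨diagClass, diagClass_comm⟩ e.1
  | .C _ _ => 0

theorem diagClass_commute {g n : ℕ} (i j : Fin n) (v : Gen g n →₀ ℚ) :
    Commute (diagClass i j : E2 g n) (proj g n (ExteriorAlgebra.ι ℚ v)) := by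
  have key : ∀ s t : Gen g n,
      Commute (gen s * gen t : E2 g n) (proj g n (ExteriorAlgebra.ι ℚ v)) := by
    intro s t
    have h1 := proj_anticomm (Finsupp.single s (1 : ℚ)) v
    have h2 := proj_anticomm (Finsupp.single t (1 : ℚ)) v
    simp only [Commute, SemiconjBy, gen, fgen]
    rw [mul_assoc, h2, mul_neg, ← mul_assoc, h1, neg_mul, neg_neg, mul_assoc]
  exact (Commute.sum_left _ _ _ fun a _ => (key _ _).add_left (key _ _)).neg_left

theorem dGen_commute {g n : ℕ} (s : Gen g n) (v : Gen g n →₀ ℚ) :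
    Commute (dGen s : E2 g n) (proj g n (ExteriorAlgebra.ι ℚ v)) := by
  rcases s with ⟨⟨i, j⟩, h⟩ | ⟨c, i⟩
  · exact diagClass_commute i j v
  · exact Commute.zero_left _

/-- The linear extension of `dGen`. -/
def dLin (g n : ℕ) : (Gen g n →₀ ℚ) →ₗ[ℚ] E2 g n := Finsupp.linearCombination ℚ dGen

theorem dLin_commute {g n : ℕ} (v w : Gen g n →₀ ℚ) :
    Commute (dLin g n v) (proj g n (ExteriorAlgebra.ι ℚ w)) := by
  rw [dLin, Finsupp.linearCombination_apply]
  exact Commute.sum_left _ _ _ fun s _ => (dGen_commute s w).smul_left _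

/-- The matrix `(-v, d v; 0, v)` attached to a linear combination `v` of generators. -/
def thetaLin (g n : ℕ) : (Gen g n →₀ ℚ) →ₗ[ℚ] Matrix (Fin 2) (Fin 2) (E2 g n) where
  toFun v := !![-proj g n (ExteriorAlgebra.ι ℚ v), dLin g n v;
    0, proj g n (ExteriorAlgebra.ι ℚ v)]
  map_add' v w := by
    ext i j; fin_cases i <;> fin_cases j <;> simp [add_comm]
  map_smul' r v := by
    ext i j; fin_cases i <;> fin_cases j <;> simp

theorem thetaLin_sq {g n : ℕ} (v : Gen g n →₀ ℚ) : thetaLin g n v * thetaLin g n v = 0 := by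
  have h : proj g n (ExteriorAlgebra.ι ℚ v) * proj g n (ExteriorAlgebra.ι ℚ v) = 0 := by
    rw [← map_mul, ExteriorAlgebra.ι_sq_zero, map_zero]
  have h' := (dLin_commute v v).eq
  simp only [thetaLin, LinearMap.coe_mk, AddHom.coe_mk, Matrix.mul_fin_two]
  ext i j; fin_cases i <;> fin_cases j <;> simp [h, h']

/-- The extension of `thetaLin` to an algebra homomorphism. -/
def fTheta (g n : ℕ) : Free g n →ₐ[ℚ] Matrix (Fin 2) (Fin 2) (E2 g n) :=
  ExteriorAlgebra.lift ℚ ⟨thetaLin g n, thetaLin_sq⟩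

theorem fTheta_fgen {g n : ℕ} (s : Gen g n) :
    fTheta g n (fgen s) = !![-gen s, dGen s; 0, gen s] := by
  rw [fTheta, fgen, ExteriorAlgebra.lift_ι_apply]
  simp [thetaLin, dLin, gen, fgen]

theorem fTheta_fG {g n : ℕ} {i j : Fin n} (h : i ≠ j) :
    fTheta g n (fG i j) = !![-gg i j, diagClass i j; 0, gg i j] := by
  rw [gg_of_ne h, fG, dif_neg h, fTheta_fgen]
  rfl

theorem fTheta_fcls {g n : ℕ} (α : H1 g) (i : Fin n) :
    fTheta g n (fcls α i) = !![-cls α i, 0; 0, cls α i] := by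
  rw [fcls, map_sum, cls_eq]
  ext k l
  fin_cases k <;> fin_cases l <;> simp [Matrix.sum_apply, fTheta_fgen, dGen]

theorem diagClass_mul_cls {g n : ℕ} (i j : Fin n) (α : H1 g) :
    (diagClass i j * cls α i : E2 g n) = 0 := by
  rw [diagClass, neg_mul, Finset.sum_mul, Finset.sum_eq_zero, neg_zero]
  intro a _
  rw [add_mul, xx, xx, yy, yy, gen_anticomm (Gen.C (Sum.inl a) i) (Gen.C (Sum.inr a) j), neg_mul,
    mul_assoc, mul_assoc, gen_mul_cls, gen_mul_cls]
  simp

/-- The diagonal class at `{i, j}` and the one at `{i, k}` agree after multiplication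
with `g_{jk}`. -/
theorem gg_mul_diagClass {g n : ℕ} {i j k : Fin n} (hjk : j ≠ k) :
    (gg j k * diagClass i j : E2 g n) = gg j k * diagClass i k := by
  rw [diagClass, diagClass, mul_neg, mul_neg, Finset.mul_sum, Finset.mul_sum]
  congr 1
  refine Finset.sum_congr rfl fun a _ => ?_
  simp only [xx, yy]
  rw [gen_anticomm (Gen.C (Sum.inl a) i) (Gen.C (Sum.inr a) j),
    gen_anticomm (Gen.C (Sum.inl a) i) (Gen.C (Sum.inr a) k)]
  simp only [mul_add, mul_neg, ← mul_assoc, gg_mul_gen hjk]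

theorem gg_comm {g n : ℕ} (i j : Fin n) : (gg i j : E2 g n) = gg j i := by
  by_cases h : i = j
  · rw [h]
  · rw [gg_of_ne h, gg_of_ne (Ne.symm h)]
    simp only [Sym2.eq_swap]

theorem diagClass_commute_gg {g n : ℕ} (i j k l : Fin n) :
    (diagClass i j * gg k l : E2 g n) = gg k l * diagClass i j := by
  by_cases h : k = l
  · simp [gg, fG, h]
  · rw [gg_of_ne h]; exact (diagClass_commute i j _).eq

theorem fTheta_rel {g n : ℕ} {a b : Free g n} (h : Rel g n a b) :
    fTheta g n a = fTheta g n b := by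
  cases h with
  | arnold i j k hij hjk hki =>
    have hA := arnold (g := g) hij hjk hki
    have h1 := gg_mul_diagClass (g := g) (i := i) hjk
    have h2 := gg_mul_diagClass (g := g) (i := j) hki
    have h3 := gg_mul_diagClass (g := g) (i := k) hij
    rw [diagClass_comm i k] at h1
    rw [diagClass_comm j i] at h2
    rw [diagClass_comm k j] at h3
    simp only [map_add, map_mul, map_zero, fTheta_fG hij, fTheta_fG hjk, fTheta_fG hki,
      Matrix.mul_fin_two]
    ext p q
    fin_cases p <;> fin_cases q
    · simpa using hA
    · simp [diagClass_commute_gg, h1, h2, h3]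
    · simp
    · simpa using hA
  | diag i j hij α =>
    have h1 := diagClass_mul_cls (g := g) i j α
    have h2 := diagClass_mul_cls (g := g) j i α
    rw [diagClass_comm j i] at h2
    simp only [map_mul, fTheta_fG hij, fTheta_fcls, Matrix.mul_fin_two]
    ext p q
    fin_cases p <;> fin_cases q <;> simp [h1, h2, gg_mul_cls hij]
  | cup i α β =>
    simp only [map_mul, map_zero, fTheta_fcls, Matrix.mul_fin_two]
    ext p q
    fin_cases p <;> fin_cases q <;> simp [cls_mul_cls]

/-- The algebra homomorphism `z ↦ (ε z, d z; 0, z)`, where `ε` is the parity involution and `d` is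
the differential. Its multiplicativity is the graded Leibniz rule. -/
def theta (g n : ℕ) : E2 g n →ₐ[ℚ] Matrix (Fin 2) (Fin 2) (E2 g n) :=
  RingQuot.liftAlgHom ℚ ⟨fTheta g n, fun _ _ h => fTheta_rel h⟩

theorem theta_gen {g n : ℕ} (s : Gen g n) :
    theta g n (gen s) = !![-gen s, dGen s; 0, gen s] := by
  rw [← fTheta_fgen]
  exact RingQuot.liftAlgHom_mkAlgHom_apply ℚ _ _ _

/-- The parity involution, multiplying an element of total degree `k` by `(-1)^k`. -/
def parity (g n : ℕ) : E2 g n →ₗ[ℚ] E2 g n :=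
  Matrix.entryLinearMap ℚ (E2 g n) (0 : Fin 2) (0 : Fin 2) ∘ₗ (theta g n).toLinearMap

/-- The differential of the `E₂` page: the unique linear map with `d g_{ij} = [Δ]_{ij}`,
`d α_i = 0`, and `d (a b) = (d a) b + (-1)^{|a|} a (d b)` (see `d_gen` and `d_mul`). -/
def d (g n : ℕ) : E2 g n →ₗ[ℚ] E2 g n :=
  Matrix.entryLinearMap ℚ (E2 g n) (0 : Fin 2) (1 : Fin 2) ∘ₗ (theta g n).toLinearMap

theorem induction {g n : ℕ} {P : E2 g n → Prop} (hgen : ∀ s, P (gen s))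
    (halg : ∀ r : ℚ, P (algebraMap ℚ _ r)) (hadd : ∀ a b, P a → P b → P (a + b))
    (hmul : ∀ a b, P a → P b → P (a * b)) (z : E2 g n) : P z := by
  obtain ⟨z, rfl⟩ := RingQuot.mkAlgHom_surjective ℚ (Rel g n) z
  change P (proj g n z)
  induction z using ExteriorAlgebra.induction with
  | algebraMap r => rw [AlgHom.commutes]; exact halg r
  | ι v =>
    induction v using Finsupp.induction_linear with
    | zero => simpa using halg 0
    | add v w hv hw => rw [map_add, map_add]; exact hadd _ _ hv hw
    | single s r =>
      have h : proj g n (ExteriorAlgebra.ι ℚ (Finsupp.single s r)) =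
          algebraMap ℚ _ r * gen s := by
        rw [← Algebra.smul_def, gen, fgen, ← map_smul, ← map_smul, Finsupp.smul_single,
          smul_eq_mul, mul_one]
      rw [h]
      exact hmul _ _ (halg r) (hgen s)
  | mul a b ha hb => rw [map_mul]; exact hmul _ _ ha hb
  | add a b ha hb => rw [map_add]; exact hadd _ _ ha hb

theorem theta_eq {g n : ℕ} (z : E2 g n) :
    theta g n z = !![parity g n z, d g n z; 0, z] := by
  have h : theta g n z 1 0 = 0 ∧ theta g n z 1 1 = z := by
    induction z using TotaroSS.induction with
    | hgen s => simp [theta_gen]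
    | halg r => simp [AlgHom.commutes, Matrix.algebraMap_matrix_apply]
    | hadd a b ha hb => simp [ha, hb]
    | hmul a b ha hb => simp [Matrix.mul_apply, Fin.sum_univ_two, ha, hb]
  ext i j
  fin_cases i <;> fin_cases j
  · rfl
  · rfl
  · exact h.1
  · exact h.2

theorem d_gen {g n : ℕ} (s : Gen g n) : d g n (gen s) = dGen s := by
  change theta g n (gen s) 0 1 = _
  simp [theta_gen]

theorem parity_gen {g n : ℕ} (s : Gen g n) : parity g n (gen s) = -gen s := by
  change theta g n (gen s) 0 0 = _
  simp [theta_gen]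

theorem parity_mul {g n : ℕ} (a b : E2 g n) :
    parity g n (a * b) = parity g n a * parity g n b := by
  change theta g n (a * b) 0 0 = _
  rw [map_mul, theta_eq a, theta_eq b]
  simp

/-- The graded Leibniz rule. -/
theorem d_mul {g n : ℕ} (a b : E2 g n) :
    d g n (a * b) = d g n a * b + parity g n a * d g n b := by
  change theta g n (a * b) 0 1 = _
  rw [map_mul, theta_eq a, theta_eq b]
  simp [add_comm]

theorem perm_diagClass {g n : ℕ} (σ : Equiv.Perm (Fin n)) (i j : Fin n) :
    perm σ (diagClass i j : E2 g n) = diagClass (σ i) (σ j) := by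
  simp [diagClass, xx, yy, perm_gen, Gen.perm]

/-- The differential commutes with the action of the symmetric group. -/
theorem d_perm {g n : ℕ} (σ : Equiv.Perm (Fin n)) (z : E2 g n) :
    d g n (perm σ z) = perm σ (d g n z) := by
  have h : (theta g n).comp (perm σ) = (perm σ).mapMatrix.comp (theta g n) := by
    refine hom_ext fun s => ?_
    have h' : dGen (Gen.perm σ s) = perm σ (dGen s : E2 g n) := by
      rcases s with ⟨⟨i, j⟩, h⟩ | ⟨c, i⟩
      · exact (perm_diagClass σ i j).symm
      · simp [Gen.perm, dGen]
    rw [AlgHom.comp_apply, AlgHom.comp_apply, perm_gen, theta_gen, theta_gen]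
    ext p q
    fin_cases p <;> fin_cases q <;> simp [perm_gen, h']
  exact congrFun (congrFun (DFunLike.congr_fun h z) 0) 1

theorem d_mem_E2Inv {g n : ℕ} (z : E2 g n) (hz : z ∈ E2Inv g n) : d g n z ∈ E2Inv g n := by
  intro σ
  have h : perm σ z = z := hz σ
  change perm σ (d g n z) = d g n z
  rw [← d_perm, h]

/-- The differential of the `S_n`-invariant part of the `E₂` page. -/
def dInv (g n : ℕ) : E2Inv g n →ₗ[ℚ] E2Inv g n := (d g n).restrict d_mem_E2Inv

/-! ### The quadruple grading -/

/-- A quadruple degree `(p, q, w₁, w₂)`: bidegree `(p, q)` and Hodge type `(w₁, w₂)`. -/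
abbrev Deg : Type := ℕ × ℕ × ℕ × ℕ

/-- The quadruple degrees of the generators. -/
def Gen.deg {g n : ℕ} : Gen g n → Deg
  | .G _ => (0, 1, 1, 1)
  | .C (Sum.inl _) _ => (1, 0, 1, 0)
  | .C (Sum.inr _) _ => (1, 0, 0, 1)

/-- The homogeneous part of the `E₂` page of quadruple degree `m`, spanned by the monomials in
the generators of that degree. -/
def E2piece (g n : ℕ) (m : Deg) : Submodule ℚ (E2 g n) :=
  Submodule.span ℚ {z | ∃ l : List (Gen g n), (l.map Gen.deg).sum = m ∧ (l.map gen).prod = z}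

/-! ### The combinatorial complex -/

/-- The set `Γ_g` of tuples `(ρ, S, T, u, v)`. -/
structure Gam (g : ℕ) : Type where
  rho : Fin 2
  S : Finset (Fin g)
  T : Finset (Fin g)
  u : Fin g → ℕ
  v : Fin g → ℕ

/-- The length `ℓ(t) = 2 ρ + |S| + |T| + 2 |u| + 2 |v|`. -/
def Gam.len {g : ℕ} (t : Gam g) : ℕ :=
  2 * (t.rho : ℕ) + t.S.card + t.T.card + 2 * ∑ a, t.u a + 2 * ∑ a, t.v a

/-- The quadruple degree `(p, q, w₁, w₂)` of a tuple. -/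
def Gam.deg {g : ℕ} (t : Gam g) : Deg :=
  (t.S.card + t.T.card + ∑ a, t.u a + ∑ a, t.v a,
    (t.rho : ℕ) + ∑ a, t.u a + ∑ a, t.v a,
    (t.rho : ℕ) + t.S.card + 2 * ∑ a, t.u a + ∑ a, t.v a,
    (t.rho : ℕ) + t.T.card + ∑ a, t.u a + 2 * ∑ a, t.v a)

/-- The differential on a basis vector of `ℚΓ_g`. -/
def dGamBasis {g : ℕ} (t : Gam g) : Gam g →₀ ℚ :=
  if t.rho = 1 then
    (-2 : ℚ) • ∑ a ∈ Finset.univ \ (t.S ∪ t.T),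
      (-1 : ℚ) ^ (t.S.card + (t.S.filter (· < a)).card + (t.T.filter (· < a)).card) •
        Finsupp.single (⟨0, insert a t.S, insert a t.T, t.u, t.v⟩ : Gam g) (1 : ℚ)
  else 0

/-- The differential of `ℚΓ_g`, the vector space with basis `Γ_g`. -/
def dGamAll (g : ℕ) : (Gam g →₀ ℚ) →ₗ[ℚ] (Gam g →₀ ℚ) :=
  Finsupp.linearCombination ℚ dGamBasis

/-- `ℚΓ_{g,n}`, the subspace of `ℚΓ_g` spanned by the tuples of length at most `n`. -/
def QGam (g n : ℕ) : Submodule ℚ (Gam g →₀ ℚ) := Finsupp.supported ℚ ℚ {t | t.len ≤ n}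

theorem dGamAll_mem {g n : ℕ} (f : Gam g →₀ ℚ) (hf : f ∈ QGam g n) : dGamAll g f ∈ QGam g n := by
  rw [dGamAll, Finsupp.linearCombination_apply]
  refine Submodule.sum_mem _ fun t ht => Submodule.smul_mem _ _ ?_
  have hlen : t.len ≤ n := (Finsupp.mem_supported ℚ f).1 hf ht
  unfold dGamBasis
  split_ifs with h
  · refine Submodule.smul_mem _ _ (Submodule.sum_mem _ fun a ha => Submodule.smul_mem _ _ ?_)
    simp only [Finset.mem_sdiff, Finset.mem_univ, Finset.mem_union, true_and, not_or] at ha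
    refine Finsupp.single_mem_supported ℚ _ ?_
    simp only [Gam.len, h, Set.mem_ofPred_eq] at hlen ⊢
    rw [Finset.card_insert_of_notMem ha.1, Finset.card_insert_of_notMem ha.2]
    simp only [Fin.val_one, Fin.val_zero] at hlen ⊢
    omega
  · exact Submodule.zero_mem _

/-- The differential of `ℚΓ_{g,n}`. -/
def dGam (g n : ℕ) : QGam g n →ₗ[ℚ] QGam g n := (dGamAll g).restrict dGamAll_mem

/-- The basis vector of `ℚΓ_{g,n}` given by a tuple of length at most `n`. -/
def basisVec {g n : ℕ} (t : Gam g) (ht : t.len ≤ n) : QGam g n :=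
  ⟨Finsupp.single t 1, Finsupp.single_mem_supported ℚ _ ht⟩

/-- The homogeneous part of `ℚΓ_{g,n}` of quadruple degree `m`, spanned by the tuples of
degree `m`. -/
def QGamPiece (g n : ℕ) (m : Deg) : Submodule ℚ (QGam g n) :=
  (Finsupp.supported ℚ ℚ {t : Gam g | t.deg = m}).comap (QGam g n).subtype

/-! ### The distinguished generators -/

/-- The places for points in the monomial of a tuple `t`; there are `ℓ(t)` of them. -/
inductive Slot {g : ℕ} (t : Gam g) : Type
  | pair (h : t.rho = 1) (b : Fin 2) : Slot t
  | x (a : Fin g) (h : a ∈ t.S) : Slot t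
  | y (a : Fin g) (h : a ∈ t.T) : Slot t
  | xpair (a : Fin g) (k : Fin (t.u a)) (b : Fin 2) : Slot t
  | ypair (a : Fin g) (k : Fin (t.v a)) (b : Fin 2) : Slot t

/-- The monomial
`g_{••}^ρ · ∏_{a ∈ S} x⁽ᵃ⁾_• · ∏_{a ∈ T} y⁽ᵃ⁾_• · ∏_a (x⁽ᵃ⁾_{••})^{u_a} · ∏_a (y⁽ᵃ⁾_{••})^{v_a}`,
with factors in ascending order of `a`, whose places `•` are filled with points according to `ι`.
Here `α_{ij} = g_{ij} α_i`. -/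
def monomial {g n : ℕ} (t : Gam g) (ι : Slot t → Fin n) : E2 g n :=
  (if h : t.rho = 1 then gg (ι (.pair h 0)) (ι (.pair h 1)) else 1) *
  ((List.finRange g).map fun a => if h : a ∈ t.S then xx a (ι (.x a h)) else 1).prod *
  ((List.finRange g).map fun a => if h : a ∈ t.T then yy a (ι (.y a h)) else 1).prod *
  ((List.finRange g).map fun a => ((List.finRange (t.u a)).map fun k =>
    gg (ι (.xpair a k 0)) (ι (.xpair a k 1)) * xx a (ι (.xpair a k 0))).prod).prod *
  ((List.finRange g).map fun a => ((List.finRange (t.v a)).map fun k =>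
    gg (ι (.ypair a k 0)) (ι (.ypair a k 1)) * yy a (ι (.ypair a k 0))).prod).prod

end TotaroSS

end

noncomputable section

namespace TotaroSS

/-! ### Commutation rules -/

/-! Averaging over `S_n` is a projection onto the invariants, so the claim is that the averaged
monomials span its image, are independent, and carry the stated differential and grading.

Spanning. Over the subalgebra of the remaining points, the algebra on a set of points is spanned on
one side by `1`, the classes at a chosen point `s`, and the edges `g_{sq}` (`mem_of_mem_sub`).
Points are peeled off one at a time and collected into a monomial whose blocks are a class at one
point, a bare edge, or an edge carrying a class. A repeated single class or a repeated bare edge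
dies under averaging, because exchanging two odd blocks of the same kind changes the sign. An edge
that meets another edge gives a path through at least three points. This also averages to zero
(`symm_mul_gpath`): it is the vanishing of the `S_m`-invariants in the top cohomology of the
configuration space of `m ≥ 3` points in the plane. Since this leaves only exponents `0` or `1` for
odd blocks and arbitrary exponents for the even blocks `α_{••}`, the surviving monomials are those
indexed by tuples (`symm_mul_mono_mem`).

Independence. A partition of the points into labelled blocks of size at most two defines a
homomorphism to an exterior algebra with one edge token and one class token per block; edges across
blocks and classes different from the label go to zero (`Marking.eval`). Take the partition given by
the monomial of `t` and read off the coefficient of the tokens of `t`. This vanishes on all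
monomials of other tuples, and on each permuted monomial of `t` it is `0` or `1`, never `-1`,
because the only blocks that can be interchanged are even (`coef_eval_mono`). Hence nothing cancels
in the average, and these functionals form a dual family up to positive scalars (`detect_genMap`).
As evaluation respects degrees, they also recover the grading.

Differential. The classes and the blocks `α_{••}` are cocycles, so only the bare edge contributes.
Its two points become available for `x⁽ᵃ⁾` and `y⁽ᵃ⁾`, the two halves of the diagonal class have
equal averages, and the terms with `a ∈ S ∪ T` vanish as repeated classes. -/

theorem eq_zero_of_eq_neg {V : Type*} [AddCommGroup V] [Module ℚ V] {x : V} (h : x = -x) :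
    x = 0 := by
  have h2 : (2 : ℚ) • x = 0 := by
    rw [two_smul]; nth_rewrite 2 [h]; exact add_neg_cancel x
  exact (smul_eq_zero.1 h2).resolve_left two_ne_zero

theorem gg_anticomm_gen {g n : ℕ} (i j : Fin n) (s : Gen g n) :
    (gg i j * gen s : E2 g n) = -(gen s * gg i j) := by
  by_cases h : i = j
  · simp [gg, fG, h]
  · rw [gg_of_ne h, gen_anticomm]

theorem gg_anticomm {g n : ℕ} (i j k l : Fin n) :
    (gg i j * gg k l : E2 g n) = -(gg k l * gg i j) := by
  by_cases h : k = l
  · simp [gg, fG, h]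
  · rw [gg_of_ne h, gg_anticomm_gen]

theorem gg_self {g n : ℕ} (i : Fin n) : (gg i i : E2 g n) = 0 := by
  simp [gg, fG]

theorem gg_sq {g n : ℕ} (i j : Fin n) : (gg i j * gg i j : E2 g n) = 0 :=
  eq_zero_of_eq_neg (gg_anticomm i j i j)

theorem gen_C_mul {g n : ℕ} (i : Fin n) (b c : Fin g ⊕ Fin g) :
    (gen (Gen.C b i) * gen (Gen.C c i) : E2 g n) = 0 := by
  rw [gen_cls c, gen_mul_cls]

theorem gg_mul_gen_cases {g n : ℕ} (i j : Fin n) (c : Fin g ⊕ Fin g) :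
    (gg i j * gen (Gen.C c i) : E2 g n) = gg i j * gen (Gen.C c j) := by
  by_cases h : i = j
  · rw [h]
  · exact gg_mul_gen h c

/-- The Arnold relation, rewriting two edges at a common point `v`. -/
theorem arnold_vertex {g n : ℕ} {b v t : Fin n} (hbv : b ≠ v) (hvt : v ≠ t) (htb : t ≠ b) :
    (gg v b * gg v t : E2 g n) = -(gg v t * gg t b) + gg v b * gg b t := by
  have h := arnold (g := g) hbv hvt htb
  rw [gg_comm b v, gg_anticomm t b v b, gg_comm t b] at h
  rw [gg_comm t b, ← sub_eq_zero, ← h]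
  abel

theorem commute_of_gen {g n : ℕ} {x : E2 g n} (h : ∀ s, Commute x (gen s)) (z : E2 g n) :
    Commute x z := by
  induction z using TotaroSS.induction with
  | hgen s => exact h s
  | halg r => exact (Algebra.commutes r x).symm
  | hadd a b ha hb => exact ha.add_right hb
  | hmul a b ha hb => exact ha.mul_right hb

theorem gen_mul_gen_commute {g n : ℕ} (s t : Gen g n) (z : E2 g n) :
    Commute (gen s * gen t) z := by
  refine commute_of_gen (fun r => ?_) z
  rw [Commute, SemiconjBy, mul_assoc, gen_anticomm t r, mul_neg, ← mul_assoc, gen_anticomm s r]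
  simp [mul_assoc]

theorem gg_mul_gen_commute {g n : ℕ} (i j : Fin n) (s : Gen g n) (z : E2 g n) :
    Commute (gg i j * gen s) z := by
  by_cases h : i = j
  · simp [h, gg_self]
  · rw [gg_of_ne h]; exact gen_mul_gen_commute _ _ z

theorem gg_mul_gg_commute {g n : ℕ} (i j k l : Fin n) (z : E2 g n) :
    Commute (gg i j * gg k l) z := by
  by_cases h : k = l
  · simp [h, gg_self]
  · rw [gg_of_ne h]; exact gg_mul_gen_commute _ _ _ z

/-! ### Symmetrization -/

theorem perm_gg {g n : ℕ} (σ : Equiv.Perm (Fin n)) (i j : Fin n) :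
    perm σ (gg i j : E2 g n) = gg (σ i) (σ j) := by
  by_cases h : i = j
  · simp [h, gg_self]
  · rw [gg_of_ne h, gg_of_ne (σ.injective.ne h), perm_gen]
    rfl

theorem perm_gen_C {g n : ℕ} (σ : Equiv.Perm (Fin n)) (c : Fin g ⊕ Fin g) (i : Fin n) :
    perm σ (gen (Gen.C c i) : E2 g n) = gen (Gen.C c (σ i)) :=
  perm_gen σ _

theorem symm_apply {g n : ℕ} (z : E2 g n) :
    symm g n z = (1 / (n.factorial : ℚ)) • ∑ σ : Equiv.Perm (Fin n), perm σ z := by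
  simp only [symm, LinearMap.smul_apply, LinearMap.sum_apply]
  rfl

theorem perm_mul_apply {g n : ℕ} (σ τ : Equiv.Perm (Fin n)) (z : E2 g n) :
    perm (σ * τ) z = perm σ (perm τ z) :=
  LinearMap.congr_fun ((rep g n).map_mul σ τ) z

theorem symm_perm {g n : ℕ} (σ : Equiv.Perm (Fin n)) (z : E2 g n) :
    symm g n (perm σ z) = symm g n z := by
  simp only [symm_apply, ← perm_mul_apply]
  congr 1
  exact Fintype.sum_equiv (Equiv.mulRight σ) _ _ fun _ => rfl

theorem perm_symm {g n : ℕ} (σ : Equiv.Perm (Fin n)) (z : E2 g n) :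
    perm σ (symm g n z) = symm g n z := by
  simp only [symm_apply, map_smul, map_sum, ← perm_mul_apply]
  congr 1
  exact Fintype.sum_equiv (Equiv.mulLeft σ) _ _ fun _ => rfl

theorem symm_mem_E2Inv {g n : ℕ} (z : E2 g n) : symm g n z ∈ E2Inv g n :=
  fun σ => perm_symm σ z

theorem symm_of_mem_E2Inv {g n : ℕ} {z : E2 g n} (hz : z ∈ E2Inv g n) : symm g n z = z := by
  have h : ∀ σ, perm σ z = z := hz
  have hn : (n.factorial : ℚ) ≠ 0 := by exact_mod_cast n.factorial_ne_zero
  simp only [symm_apply, h, Finset.sum_const, Finset.card_univ, Fintype.card_perm,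
    Fintype.card_fin]
  rw [← Nat.cast_smul_eq_nsmul ℚ, smul_smul, one_div, inv_mul_cancel₀ hn, one_smul]

theorem d_symm {g n : ℕ} (z : E2 g n) : d g n (symm g n z) = symm g n (d g n z) := by
  simp only [symm_apply, map_smul, map_sum, d_perm]

/-- An element that some permutation negates has trivial symmetrization. -/
theorem symm_eq_zero {g n : ℕ} (σ : Equiv.Perm (Fin n)) {z : E2 g n} (h : perm σ z = -z) :
    symm g n z = 0 := by
  have := symm_perm σ z
  rw [h, map_neg] at this
  exact eq_zero_of_eq_neg this.symm

/-! ### The subalgebra on a set of points -/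

/-- The subalgebra generated by the generators that only involve points of `U`. -/
def sub (g : ℕ) {n : ℕ} (U : Finset (Fin n)) : Subalgebra ℚ (E2 g n) :=
  Algebra.adjoin ℚ ({z | ∃ i ∈ U, ∃ j ∈ U, gg i j = z} ∪ {z | ∃ c, ∃ i ∈ U, gen (Gen.C c i) = z})

theorem gg_mem_sub {g n : ℕ} {U : Finset (Fin n)} {i j : Fin n} (hi : i ∈ U) (hj : j ∈ U) :
    gg i j ∈ sub g U :=
  Algebra.subset_adjoin (Or.inl ⟨i, hi, j, hj, rfl⟩)

theorem gen_C_mem_sub {g n : ℕ} {U : Finset (Fin n)} {i : Fin n} (c : Fin g ⊕ Fin g)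
    (hi : i ∈ U) : gen (Gen.C c i) ∈ sub g U :=
  Algebra.subset_adjoin (Or.inr ⟨c, i, hi, rfl⟩)

theorem sub_mono {g n : ℕ} {U V : Finset (Fin n)} (h : U ⊆ V) : sub g U ≤ sub g V := by
  refine Algebra.adjoin_mono (Set.union_subset_union ?_ ?_)
  · rintro _ ⟨i, hi, j, hj, rfl⟩
    exact ⟨i, h hi, j, h hj, rfl⟩
  · rintro _ ⟨c, i, hi, rfl⟩
    exact ⟨c, i, h hi, rfl⟩

theorem sub_univ {g n : ℕ} : sub g (Finset.univ : Finset (Fin n)) = ⊤ := by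
  rw [eq_top_iff]
  rintro z -
  induction z using TotaroSS.induction with
  | hgen s =>
    rcases s with ⟨⟨⟨i, j⟩, h⟩⟩ | ⟨c, i⟩
    · have hij : i ≠ j := fun e => h (Sym2.mk_isDiag_iff.2 e)
      have := gg_mem_sub (g := g) (Finset.mem_univ i) (Finset.mem_univ j)
      rwa [gg_of_ne hij] at this
    · exact gen_C_mem_sub c (Finset.mem_univ i)
  | halg r => exact Subalgebra.algebraMap_mem _ r
  | hadd a b ha hb => exact add_mem ha hb
  | hmul a b ha hb => exact mul_mem ha hb

theorem perm_of_mem_sub {g n : ℕ} {U : Finset (Fin n)} {σ : Equiv.Perm (Fin n)}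
    (hσ : ∀ i ∈ U, σ i = i) {z : E2 g n} (hz : z ∈ sub g U) : perm σ z = z := by
  have h : sub g U ≤ AlgHom.equalizer (perm σ) (AlgHom.id ℚ (E2 g n)) := by
    refine Algebra.adjoin_le ?_
    rintro _ (⟨i, hi, j, hj, rfl⟩ | ⟨c, i, hi, rfl⟩)
    · simp [perm_gg, hσ i hi, hσ j hj]
    · simp [perm_gen_C, hσ i hi]
  exact h hz

theorem mem_of_mem_sub_empty {g n : ℕ} {z : E2 g n} (hz : z ∈ sub g (∅ : Finset (Fin n))) :
    ∃ r : ℚ, z = algebraMap ℚ _ r := by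
  have h : sub g (∅ : Finset (Fin n)) = ⊥ := by simp [sub]
  rw [h, Algebra.mem_bot] at hz
  obtain ⟨r, hr⟩ := hz
  exact ⟨r, hr.symm⟩

/-- The elements into which an element of `sub g U` decomposes along a point `s`. -/
def fiberSet (g : ℕ) {n : ℕ} (U : Finset (Fin n)) (s : Fin n) : Set (E2 g n) :=
  {z | z ∈ sub g (U.erase s)} ∪
    ({z | ∃ z' ∈ sub g (U.erase s), ∃ c, z = z' * gen (Gen.C c s)} ∪
    {z | ∃ z' ∈ sub g (U.erase s), ∃ q ∈ U.erase s, z = z' * gg s q})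

/-- A generator away from `s` moves past the factor at `s` up to sign. Two classes at `s` multiply
to zero, a class at `s` next to an edge `g_{sr}` slides to `r`, and the Arnold relation rewrites two
edges at `s` so that each term has only one. -/
theorem mul_mem_span_fiberSet {g n : ℕ} {U : Finset (Fin n)} {s : Fin n} {x y : E2 g n}
    (hx : x ∈ fiberSet g U s)
    (hy : (∃ i ∈ U, ∃ j ∈ U, gg i j = y) ∨ ∃ c, ∃ i ∈ U, gen (Gen.C c i) = y) :
    x * y ∈ Submodule.span ℚ (fiberSet g U s) := by
  have A : ∀ z' ∈ sub g (U.erase s), z' ∈ Submodule.span ℚ (fiberSet g U s) :=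
    fun z' h => Submodule.subset_span (Or.inl h)
  have B : ∀ z' ∈ sub g (U.erase s), ∀ c,
      z' * gen (Gen.C c s) ∈ Submodule.span ℚ (fiberSet g U s) :=
    fun z' h c => Submodule.subset_span (Or.inr (Or.inl ⟨z', h, c, rfl⟩))
  have C : ∀ z' ∈ sub g (U.erase s), ∀ q ∈ U.erase s,
      z' * gg s q ∈ Submodule.span ℚ (fiberSet g U s) :=
    fun z' h q hq => Submodule.subset_span (Or.inr (Or.inr ⟨z', h, q, hq, rfl⟩))
  have key : (y ∈ sub g (U.erase s) ∧ (∀ c, gen (Gen.C c s) * y = -(y * gen (Gen.C c s))) ∧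
      ∀ q, gg s q * y = -(y * gg s q)) ∨ (∃ c, y = gen (Gen.C c s)) ∨
      (∃ q ∈ U.erase s, y = gg s q) ∨ y = 0 := by
    rcases hy with ⟨i, hi, j, hj, rfl⟩ | ⟨c, i, hi, rfl⟩
    · by_cases his : i = s <;> by_cases hjs : j = s
      · subst his; subst hjs; right; right; right; exact gg_self _
      · subst his; right; right; left; exact ⟨j, Finset.mem_erase.2 ⟨hjs, hj⟩, rfl⟩
      · subst hjs; right; right; left
        exact ⟨i, Finset.mem_erase.2 ⟨his, hi⟩, gg_comm _ _⟩
      · left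
        refine ⟨gg_mem_sub (Finset.mem_erase.2 ⟨his, hi⟩) (Finset.mem_erase.2 ⟨hjs, hj⟩),
          fun c => ?_, fun q => gg_anticomm _ _ _ _⟩
        rw [gg_anticomm_gen, neg_neg]
    · by_cases his : i = s
      · subst his; right; left; exact ⟨c, rfl⟩
      · left
        exact ⟨gen_C_mem_sub c (Finset.mem_erase.2 ⟨his, hi⟩), fun c => gen_anticomm _ _,
          fun q => gg_anticomm_gen _ _ _⟩
  rcases key with ⟨hy, h1, h2⟩ | ⟨c, rfl⟩ | ⟨q, hq, rfl⟩ | rfl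
  · rcases hx with hx | ⟨z', hz', b, rfl⟩ | ⟨z', hz', r, hr, rfl⟩
    · exact A _ (mul_mem hx hy)
    · rw [mul_assoc, h1, mul_neg, ← mul_assoc]
      exact neg_mem (B _ (mul_mem hz' hy) _)
    · rw [mul_assoc, h2, mul_neg, ← mul_assoc]
      exact neg_mem (C _ (mul_mem hz' hy) _ hr)
  · rcases hx with hx | ⟨z', hz', b, rfl⟩ | ⟨z', hz', r, hr, rfl⟩
    · exact B _ hx _
    · rw [mul_assoc, gen_C_mul, mul_zero]
      exact zero_mem _
    · rw [mul_assoc, gg_mul_gen_cases, gg_anticomm_gen, mul_neg, ← mul_assoc]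
      exact neg_mem (C _ (mul_mem hz' (gen_C_mem_sub c hr)) _ hr)
  · rcases hx with hx | ⟨z', hz', b, rfl⟩ | ⟨z', hz', r, hr, rfl⟩
    · exact C _ hx _ hq
    · rw [mul_assoc, ← neg_eq_iff_eq_neg.2 (gg_anticomm_gen s q (Gen.C b s)), gg_mul_gen_cases,
        gg_anticomm_gen, neg_neg, ← mul_assoc]
      exact C _ (mul_mem hz' (gen_C_mem_sub b hq)) _ hq
    · by_cases hrq : r = q
      · rw [hrq, mul_assoc, gg_sq, mul_zero]
        exact zero_mem _
      · have hrs : r ≠ s := (Finset.mem_erase.1 hr).1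
        have hqs : q ≠ s := (Finset.mem_erase.1 hq).1
        rw [mul_assoc, arnold_vertex hrs hqs.symm (Ne.symm hrq), gg_anticomm s q q r,
          gg_anticomm s r r q, neg_neg, mul_add, mul_neg, ← mul_assoc, ← mul_assoc]
        exact add_mem (C _ (mul_mem hz' (gg_mem_sub hq hr)) _ hq)
          (neg_mem (C _ (mul_mem hz' (gg_mem_sub hr hq)) _ hr))
  · rw [mul_zero]
    exact zero_mem _

/-- As a left module over `sub g (U \ {s})`, the algebra `sub g U` is spanned by `1`, the classes
at `s`, and the `g_{sq}` with `q ∈ U \ {s}`. -/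
theorem mem_of_mem_sub {g n : ℕ} {U : Finset (Fin n)} {s : Fin n} (N : Submodule ℚ (E2 g n))
    (h1 : ∀ z ∈ sub g (U.erase s), z ∈ N)
    (h2 : ∀ z ∈ sub g (U.erase s), ∀ c, z * gen (Gen.C c s) ∈ N)
    (h3 : ∀ z ∈ sub g (U.erase s), ∀ q ∈ U.erase s, z * gg s q ∈ N)
    {z : E2 g n} (hz : z ∈ sub g U) : z ∈ N := by
  have hN : Submodule.span ℚ (fiberSet g U s) ≤ N := by
    refine Submodule.span_le.2 ?_
    rintro _ (h | ⟨z', hz', b, rfl⟩ | ⟨z', hz', r, hr, rfl⟩)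
    · exact h1 _ h
    · exact h2 _ hz' _
    · exact h3 _ hz' _ hr
  refine hN ?_
  rw [← Subalgebra.mem_toSubmodule, sub, Algebra.adjoin_eq_span] at hz
  refine (Submodule.span_le.2 ?_) hz
  intro x hx
  induction hx using Submonoid.closure_induction_right with
  | one => exact Submodule.subset_span (Or.inl (one_mem (sub g (U.erase s))))
  | mul_right x _ y hy ih =>
    rw [SetLike.mem_coe] at ih ⊢
    have h : Submodule.span ℚ (fiberSet g U s) ≤
        (Submodule.span ℚ (fiberSet g U s)).comap (LinearMap.mulRight ℚ y) :=
      Submodule.span_le.2 fun x hx => mul_mem_span_fiberSet hx hy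
    exact h ih

/-! ### Paths of length at least two symmetrize to zero -/

/-- The product `g_{s₀s₁} g_{s₁s₂} ⋯` along a path. -/
def gpath {g n : ℕ} : List (Fin n) → E2 g n
  | a :: b :: l => gg a b * gpath (b :: l)
  | _ => 1

theorem gpath_cons_cons {g n : ℕ} (a b : Fin n) (l : List (Fin n)) :
    (gpath (a :: b :: l) : E2 g n) = gg a b * gpath (b :: l) := rfl

theorem gpath_singleton {g n : ℕ} (a : Fin n) : (gpath [a] : E2 g n) = 1 := rfl

theorem gpath_append {g n : ℕ} (r : List (Fin n)) (v : Fin n) (t : List (Fin n)) :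
    (gpath (r ++ v :: t) : E2 g n) = gpath (r ++ [v]) * gpath (v :: t) := by
  induction r with
  | nil => simp [gpath_singleton]
  | cons a r ih =>
    cases r with
    | nil => simp [gpath_cons_cons, gpath_singleton]
    | cons b r =>
      simp only [List.cons_append, gpath_cons_cons] at ih ⊢
      rw [ih, mul_assoc]

theorem perm_gpath {g n : ℕ} (σ : Equiv.Perm (Fin n)) (s : List (Fin n)) :
    perm σ (gpath s : E2 g n) = gpath (s.map σ) := by
  induction s with
  | nil => simp [gpath]
  | cons a s ih =>
    cases s with
    | nil => simp [gpath]
    | cons b s => simpa [gpath_cons_cons, perm_gg] using congrArg (gg (σ a) (σ b) * ·) ih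

/-- The diagonal relation lets a class slide along each edge, hence to any point of the path. -/
theorem gen_mul_gpath {g n : ℕ} (c : Fin g ⊕ Fin g) (s : List (Fin n)) {i j : Fin n} (hi : i ∈ s)
    (hj : j ∈ s) :
    (gen (Gen.C c i) * gpath s : E2 g n) = gen (Gen.C c j) * gpath s := by
  suffices h : ∀ (s : List (Fin n)) (a i : Fin n), i ∈ a :: s →
      (gen (Gen.C c i) * gpath (a :: s) : E2 g n) = gen (Gen.C c a) * gpath (a :: s) by
    cases s with
    | nil => simp at hi
    | cons a s => rw [h s a i hi, h s a j hj]
  intro s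
  induction s with
  | nil => intro a i hi; simp at hi; rw [hi]
  | cons b s ih =>
    intro a i hi
    rcases List.mem_cons.1 hi with rfl | hi
    · rfl
    · have h1 : ∀ i, (gen (Gen.C c i) * gg a b : E2 g n) = -(gg a b * gen (Gen.C c i)) :=
        fun i => (neg_eq_iff_eq_neg.2 (gg_anticomm_gen a b _)).symm
      rw [gpath_cons_cons, ← mul_assoc, ← mul_assoc, h1, h1, gg_mul_gen_cases, neg_mul, neg_mul,
        mul_assoc, mul_assoc, ih b i hi]

section Tree

variable {g n : ℕ} {F : E2 g n →ₗ[ℚ] E2 g n} {c : E2 g n} {s : List (Fin n)}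

/-- The value of an invariant functional on a path with one extra leaf `b` attached at `v`. -/
theorem map_path_leaf (hs : s.Nodup) (hF : ∀ s', s'.Perm s → F (gpath s') = c)
    (t : List (Fin n)) : ∀ (r : List (Fin n)) (v b : Fin n), (r ++ v :: b :: t).Perm s →
    F (gpath (r ++ [v]) * (gg v b * gpath (v :: t))) = if Even t.length then c else 0 := by
  induction t with
  | nil =>
    intro r v b h
    rw [gpath_singleton, mul_one, ← mul_one (gg v b), ← gpath_singleton b, ← gpath_cons_cons,
      ← gpath_append, hF _ h]
    simp
  | cons u t ih =>
    intro r v b h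
    have hnd : (r ++ v :: b :: u :: t).Nodup := h.nodup_iff.2 hs
    have hnd' := (List.nodup_append.1 hnd).2.1
    simp only [List.nodup_cons, List.mem_cons, not_or] at hnd'
    obtain ⟨⟨hvb, hvu, -⟩, ⟨hbu, -⟩, -⟩ := hnd'
    -- The Arnold relation at `v` either slides the leaf `b` on to `u`, with a sign, or inserts `b`
    -- into the path between `v` and `u`. The values therefore satisfy `w(k+1) = c - w(k)` with
    -- `w(0) = c`.
    have e1 : (gg v b * gpath (v :: u :: t) : E2 g n) =
        -(gg v u * (gg u b * gpath (u :: t))) + gpath (v :: b :: u :: t) := by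
      rw [gpath_cons_cons, gpath_cons_cons, gpath_cons_cons, ← mul_assoc,
        arnold_vertex (Ne.symm hvb) hvu (Ne.symm hbu)]
      noncomm_ring
    have e2 : (gpath (r ++ [v]) * (gg v u * (gg u b * gpath (u :: t))) : E2 g n) =
        gpath ((r ++ [v]) ++ [u]) * (gg u b * gpath (u :: t)) := by
      rw [List.append_assoc, List.singleton_append, gpath_append r v [u], gpath_cons_cons,
        gpath_singleton, mul_one, mul_assoc]
    have hp : ((r ++ [v]) ++ u :: b :: t).Perm s := by
      refine List.Perm.trans ?_ h
      rw [List.append_assoc, List.singleton_append]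
      exact ((List.Perm.swap b u t).cons v).append_left r
    rw [e1, mul_add, mul_neg, e2, map_add, map_neg, ih _ _ _ hp, ← gpath_append, hF _ h]
    by_cases ht : Even t.length
    · have : ¬ Even (u :: t).length := by
        rw [List.length_cons, Nat.even_add_one]; exact not_not.2 ht
      rw [if_pos ht, if_neg this, neg_add_cancel]
    · have : Even (u :: t).length := by
        rw [List.length_cons, Nat.even_add_one]; exact ht
      rw [if_neg ht, if_pos this, neg_zero, zero_add]

/-- The value of an invariant functional on a path with an extra branch `v - b - a`. -/
theorem map_path_branch (hs : s.Nodup) (hF : ∀ s', s'.Perm s → F (gpath s') = c)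
    (t : List (Fin n)) : ∀ (r : List (Fin n)) (v b a : Fin n), (r ++ v :: b :: a :: t).Perm s →
    F (gpath (r ++ [v]) * (gg v b * (gg b a * gpath (v :: t)))) =
      ((1 + t.length / 2 : ℕ) : ℚ) • c := by
  induction t with
  | nil =>
    intro r v b a h
    rw [gpath_singleton, mul_one, ← mul_one (gg b a), ← gpath_singleton a, ← gpath_cons_cons,
      ← gpath_cons_cons, ← gpath_append, hF _ h]
    simp
  | cons u t ih =>
    intro r v b a h
    have hnd : (r ++ v :: b :: a :: u :: t).Nodup := h.nodup_iff.2 hs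
    have hnd' := (List.nodup_append.1 hnd).2.1
    simp only [List.nodup_cons, List.mem_cons, not_or] at hnd'
    obtain ⟨⟨hvb, hva, hvu, -⟩, ⟨hba, hbu, -⟩, -⟩ := hnd'
    -- The Arnold relation moves the branch from `v` to `u`, at the cost of a path through `v, b, u`
    -- with a leaf `a` at `b`. By `map_path_leaf` the extra term contributes `c` at every second
    -- step, which gives the `t.length / 2`.
    have e1 : (gg v b * (gg b a * gpath (v :: u :: t)) : E2 g n) =
        gg v u * (gg u b * (gg b a * gpath (u :: t))) +
          gg v b * (gg b a * gpath (b :: u :: t)) := by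
      have h1 : (gg b a * gg v u : E2 g n) = -(gg v u * gg b a) := gg_anticomm _ _ _ _
      have h2 : (gg b u * gg b a : E2 g n) = -(gg b a * gg b u) := gg_anticomm _ _ _ _
      have h3 := arnold_vertex (g := g) (Ne.symm hvb) hvu (Ne.symm hbu)
      calc (gg v b * (gg b a * gpath (v :: u :: t)) : E2 g n)
          = gg v b * ((gg b a * gg v u) * gpath (u :: t)) := by
            rw [gpath_cons_cons, mul_assoc]
        _ = -((gg v b * gg v u) * (gg b a * gpath (u :: t))) := by
            rw [h1]; noncomm_ring
        _ = gg v u * (gg u b * (gg b a * gpath (u :: t))) -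
              gg v b * ((gg b u * gg b a) * gpath (u :: t)) := by
            rw [h3]; noncomm_ring
        _ = _ := by
            rw [h2, gpath_cons_cons]
            noncomm_ring
    have e2 : ∀ w : Fin n, ∀ z : E2 g n, gpath (r ++ [v]) * (gg v w * z) =
        gpath ((r ++ [v]) ++ [w]) * z := by
      intro w z
      rw [List.append_assoc, List.singleton_append, gpath_append r v [w], gpath_cons_cons,
        gpath_singleton, mul_one, mul_assoc]
    have hp1 : ((r ++ [v]) ++ u :: b :: a :: t).Perm s := by
      refine List.Perm.trans ?_ h
      rw [List.append_assoc, List.singleton_append]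
      refine List.Perm.append_left r (List.Perm.cons v ?_)
      exact (List.Perm.swap b u _).trans ((List.Perm.swap a u t).cons b)
    have hp2 : ((r ++ [v]) ++ b :: a :: u :: t).Perm s := by
      rwa [List.append_assoc, List.singleton_append]
    rw [e1, mul_add, map_add, e2, e2, ih _ _ _ _ hp1, map_path_leaf hs hF _ _ _ _ hp2,
      List.length_cons]
    by_cases ht : Even (t.length + 1)
    · have h2 : (t.length + 1) / 2 = t.length / 2 + 1 := by
        obtain ⟨k, hk⟩ := ht; omega
      rw [if_pos ht, h2]
      push_cast
      module
    · have h2 : (t.length + 1) / 2 = t.length / 2 := by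
        obtain ⟨k, hk⟩ := Nat.not_even_iff_odd.1 ht; omega
      rw [if_neg ht, h2, add_zero]

/-- A branch `v - b - a` at the initial point of a path is itself the path `a, b, v, …`, with two
odd edges exchanged. Its value is thus `-c`, while `map_path_branch` gives `(1 + k) c` with `k ≥ 0`,
so `(2 + k) c = 0`. -/
theorem map_gpath_eq_zero (hs : s.Nodup) (hF : ∀ s', s'.Perm s → F (gpath s') = c)
    (hlen : 3 ≤ s.length) : c = 0 := by
  match s, hlen with
  | a :: b :: v :: t, _ =>
    have hp : ([] ++ v :: b :: a :: t).Perm (a :: b :: v :: t) := by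
      refine ((List.Perm.swap b v _).trans ((List.Perm.swap a v t).cons b)).trans ?_
      exact List.Perm.swap a b _
    have h := map_path_branch hs hF t [] v b a hp
    have e : (gg v b * (gg b a * gpath (v :: t)) : E2 g n) = -gpath (a :: b :: v :: t) := by
      rw [← mul_assoc, gg_anticomm, gg_comm b a, gg_comm v b, gpath_cons_cons, gpath_cons_cons]
      noncomm_ring
    rw [List.nil_append, gpath_singleton, one_mul, e, map_neg, hF _ (List.Perm.refl _)] at h
    have h2 : ((2 + t.length / 2 : ℕ) : ℚ) • c = 0 := by
      have h3 : c + ((1 + t.length / 2 : ℕ) : ℚ) • c = 0 := by rw [← h, add_neg_cancel]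
      rw [← h3]
      push_cast
      module
    refine (smul_eq_zero.1 h2).resolve_left ?_
    exact_mod_cast (by omega : 2 + t.length / 2 ≠ 0)

end Tree

/-- Fixing all points off the list is what allows a path to be reordered without disturbing a
cofactor that avoids it. -/
theorem exists_perm_of_list_perm {n : ℕ} {s s' : List (Fin n)} (h : s.Perm s') (hs : s.Nodup) :
    ∃ σ : Equiv.Perm (Fin n), s.map σ = s' ∧ ∀ i ∉ s, σ i = i := by
  induction h with
  | nil => exact ⟨1, rfl, fun _ _ => rfl⟩
  | @cons a l l' h ih =>
    obtain ⟨ha, hl⟩ := List.nodup_cons.1 hs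
    obtain ⟨σ, h1, h2⟩ := ih hl
    refine ⟨σ, by simp [h1, h2 a ha], fun i hi => h2 i fun h => hi (List.mem_cons_of_mem _ h)⟩
  | swap a b l =>
    simp only [List.nodup_cons, List.mem_cons, not_or] at hs
    refine ⟨Equiv.swap a b, ?_, ?_⟩
    · simp only [List.map_cons, Equiv.swap_apply_left, Equiv.swap_apply_right]
      congr 2
      refine (List.map_congr_left fun i hi => ?_).trans (List.map_id l)
      exact Equiv.swap_apply_of_ne_of_ne (fun h => hs.2.1 (h ▸ hi)) fun h => hs.1.2 (h ▸ hi)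
    · intro i hi
      simp only [List.mem_cons, not_or] at hi
      exact Equiv.swap_apply_of_ne_of_ne hi.2.1 hi.1
  | trans h₁ h₂ ih₁ ih₂ =>
    obtain ⟨σ, h1, h2⟩ := ih₁ hs
    obtain ⟨τ, h3, h4⟩ := ih₂ (h₁.nodup_iff.1 hs)
    refine ⟨τ * σ, by rw [← h3, ← h1, List.map_map]; rfl, fun i hi => ?_⟩
    rw [Equiv.Perm.mul_apply, h2 i hi, h4 i fun h => hi (h₁.mem_iff.2 h)]

/-- A path through at least three points, multiplied by an element that involves none of them
except the first, has trivial symmetrization. -/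
theorem symm_mul_gpath {g n : ℕ} (N : ℕ) : ∀ (s : List (Fin n)) (a : Fin n), n ≤ N + s.length →
    (a :: s).Nodup → 2 ≤ s.length → ∀ z ∈ sub g (Finset.univ \ s.toFinset),
    symm g n (z * gpath (a :: s)) = 0 := by
  induction N with
  -- `N` bounds the number of points outside `s`. Since `a` is one of them, `N = 0` is impossible.
  | zero =>
    intro s a hN hs hlen z hz
    have := List.Nodup.length_le_card hs
    simp at this
    omega
  | succ N ih =>
    intro s a hN hs hlen z hz
    have hsub : ∀ z ∈ sub g ((Finset.univ \ s.toFinset).erase a),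
        ∀ σ : Equiv.Perm (Fin n), (∀ i ∉ a :: s, σ i = i) → perm σ z = z := by
      intro z hz σ hσ
      refine perm_of_mem_sub (fun i hi => hσ i ?_) hz
      simpa [List.mem_cons] using hi
    -- Split `z` along `a`. If `a` is absent, or present only through a class, which can slide along
    -- the path, then the value does not depend on the order of the path and `map_gpath_eq_zero`
    -- applies. An edge `g_{aq}` prolongs the path to `q, a, s`, and the induction hypothesis
    -- applies.
    have := mem_of_mem_sub (s := a)
      (LinearMap.ker ((symm g n).comp (LinearMap.mulRight ℚ (gpath (a :: s))))) ?_ ?_ ?_ hz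
    · exact this
    · intro z hz
      refine map_gpath_eq_zero (F := (symm g n).comp (LinearMap.mulLeft ℚ z)) (s := a :: s) hs ?_
        (by simpa using hlen)
      intro s' hs'
      obtain ⟨σ, h1, h2⟩ := exists_perm_of_list_perm hs'.symm hs
      simp only [LinearMap.comp_apply, LinearMap.mulLeft_apply, LinearMap.mulRight_apply]
      rw [← symm_perm σ (z * gpath (a :: s)), map_mul (perm σ), hsub z hz σ h2, perm_gpath, h1]
    · intro z hz c
      have hz' : symm g n ((z * gen (Gen.C c a)) * gpath (a :: s)) = 0 := by
        refine map_gpath_eq_zero (F := (symm g n).comp (LinearMap.mulLeft ℚ (z * gen (Gen.C c a))))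
          (s := a :: s) hs ?_ (by simpa using hlen)
        intro s' hs'
        obtain ⟨σ, h1, h2⟩ := exists_perm_of_list_perm hs'.symm hs
        simp only [LinearMap.comp_apply, LinearMap.mulLeft_apply]
        rw [← symm_perm σ (z * gen (Gen.C c a) * gpath (a :: s)),
          map_mul (perm σ), map_mul (perm σ),
          hsub z hz σ h2, perm_gpath, h1, perm_gen_C, mul_assoc, mul_assoc,
          gen_mul_gpath c s' (hs'.mem_iff.2 List.mem_cons_self) (i := a)]
        rw [← h1]
        exact List.mem_map_of_mem List.mem_cons_self
      exact hz'
    · intro z hz q hq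
      have hq' : q ≠ a ∧ q ∉ s := by simpa using hq
      have := ih (a :: s) q (by simp; omega) (List.nodup_cons.2 ⟨by simpa using hq', hs⟩)
        (by simp; omega) z (by
          refine sub_mono ?_ hz
          intro i; simp)
      rw [LinearMap.mem_ker, LinearMap.comp_apply, LinearMap.mulRight_apply, mul_assoc, gg_comm,
        ← gpath_cons_cons, this]

/-! ### Monomials with places indexed independently of the tuple -/

/-- The places for points in the monomials of all tuples: the `g`-factor, the factors `α_•`, and
the `k`-th factor `α_{••}`. -/
inductive Place (g : ℕ) : Type
  | pair (b : Fin 2) : Place g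
  | cls (c : Fin g ⊕ Fin g) : Place g
  | cpair (c : Fin g ⊕ Fin g) (k : ℕ) (b : Fin 2) : Place g

instance (g : ℕ) : DecidableEq (Place g) := Classical.decEq _

/-- The set of classes that occur alone in a tuple. -/
def Gam.has {g : ℕ} (t : Gam g) : Fin g ⊕ Fin g → Prop :=
  Sum.elim (fun a => a ∈ t.S) (fun a => a ∈ t.T)

/-- The number of factors `α_{••}` of each class in a tuple. -/
def Gam.mult {g : ℕ} (t : Gam g) : Fin g ⊕ Fin g → ℕ := Sum.elim t.u t.v

/-- The places that occur in the monomial of a tuple. -/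
def Gam.places {g : ℕ} (t : Gam g) : Set (Place g) :=
  {p | match p with
    | .pair _ => t.rho = 1
    | .cls c => t.has c
    | .cpair c k _ => k < t.mult c}

/-- The factor `g_{••}^ρ`. -/
def pairPart {g n : ℕ} (ρ : Fin 2) (κ : Place g → Fin n) : E2 g n :=
  if ρ = 1 then gg (κ (.pair 0)) (κ (.pair 1)) else 1

/-- The factor `∏_{a ∈ S} α⁽ᵃ⁾_•`. -/
def clsPart {g n : ℕ} (e : Fin g → Fin g ⊕ Fin g) (S : Finset (Fin g)) (κ : Place g → Fin n) :
    E2 g n :=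
  ((List.finRange g).map fun a => if a ∈ S then gen (Gen.C (e a) (κ (.cls (e a)))) else 1).prod

/-- The element `α_{ij}` with the `k`-th points of class `c`. -/
def cpairFactor {g n : ℕ} (c : Fin g ⊕ Fin g) (k : ℕ) (κ : Place g → Fin n) : E2 g n :=
  gg (κ (.cpair c k 0)) (κ (.cpair c k 1)) * gen (Gen.C c (κ (.cpair c k 0)))

/-- The factor `∏_a (α⁽ᵃ⁾_{••})^{u_a}`. -/
def cpairPart {g n : ℕ} (e : Fin g → Fin g ⊕ Fin g) (u : Fin g → ℕ) (κ : Place g → Fin n) :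
    E2 g n :=
  ((List.finRange g).map fun a =>
    ((List.range (u a)).map fun k => cpairFactor (e a) k κ).prod).prod

/-- The monomial of a tuple `t`, with places filled with points according to `κ`. -/
def mono {g n : ℕ} (t : Gam g) (κ : Place g → Fin n) : E2 g n :=
  pairPart t.rho κ * clsPart Sum.inl t.S κ * clsPart Sum.inr t.T κ * cpairPart Sum.inl t.u κ *
    cpairPart Sum.inr t.v κ

/-- The inclusion of the places of a tuple. -/
def Slot.place {g : ℕ} {t : Gam g} : Slot t → Place g
  | .pair _ b => .pair b
  | .x a _ => .cls (Sum.inl a)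
  | .y a _ => .cls (Sum.inr a)
  | .xpair a k b => .cpair (Sum.inl a) k b
  | .ypair a k b => .cpair (Sum.inr a) k b

theorem Slot.place_injective {g : ℕ} {t : Gam g} : Function.Injective (Slot.place (t := t)) := by
  intro s s' h
  cases s <;> cases s' <;> simp [Slot.place] at h ⊢
  · exact h
  · exact h
  · exact h
  · obtain ⟨rfl, h, rfl⟩ := h
    exact ⟨rfl, heq_of_eq (Fin.ext h), rfl⟩
  · obtain ⟨rfl, h, rfl⟩ := h
    exact ⟨rfl, heq_of_eq (Fin.ext h), rfl⟩

theorem Slot.range_place {g : ℕ} {t : Gam g} : Set.range (Slot.place (t := t)) = t.places := by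
  ext p
  constructor
  · rintro ⟨s, rfl⟩
    cases s with
    | pair h b => exact h
    | x a h => exact h
    | y a h => exact h
    | xpair a k b => exact k.2
    | ypair a k b => exact k.2
  · intro hp
    rcases p with b | (a | a) | ⟨a | a, k, b⟩
    · exact ⟨.pair hp b, rfl⟩
    · exact ⟨.x a hp, rfl⟩
    · exact ⟨.y a hp, rfl⟩
    · exact ⟨.xpair a ⟨k, hp⟩ b, rfl⟩
    · exact ⟨.ypair a ⟨k, hp⟩ b, rfl⟩

theorem List.map_range_eq_map_finRange {β : Type*} (m : ℕ) (f : ℕ → β) (f' : Fin m → β)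
    (h : ∀ k : Fin m, f k = f' k) : (List.range m).map f = (List.finRange m).map f' := by
  rw [← List.map_coe_finRange_eq_range, List.map_map]
  exact List.map_congr_left fun k _ => h k

/-- `Slot t` depends on `t`, whereas a filling `κ` of `Place g` serves all tuples at once. Adding a
factor to a tuple then becomes a `Function.update` of `κ`. -/
theorem monomial_eq_mono {g n : ℕ} (t : Gam g) (ι : Slot t → Fin n) (κ : Place g → Fin n)
    (h : ∀ s, κ s.place = ι s) : monomial t ι = mono t κ := by
  have h1 : (if h : t.rho = 1 then gg (ι (.pair h 0)) (ι (.pair h 1)) else 1 : E2 g n) =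
      pairPart t.rho κ := by
    unfold pairPart
    split_ifs with hr
    · rw [← h, ← h]; rfl
    · rfl
  have h2 : ((List.finRange g).map fun a => if h : a ∈ t.S then xx a (ι (.x a h)) else 1).prod =
      (clsPart Sum.inl t.S κ : E2 g n) := by
    unfold clsPart
    refine congrArg List.prod (List.map_congr_left fun a _ => ?_)
    split_ifs with ha
    · rw [← h]; rfl
    · rfl
  have h3 : ((List.finRange g).map fun a => if h : a ∈ t.T then yy a (ι (.y a h)) else 1).prod =
      (clsPart Sum.inr t.T κ : E2 g n) := by
    unfold clsPart
    refine congrArg List.prod (List.map_congr_left fun a _ => ?_)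
    split_ifs with ha
    · rw [← h]; rfl
    · rfl
  have h4 : ((List.finRange g).map fun a => ((List.finRange (t.u a)).map fun k =>
      gg (ι (.xpair a k 0)) (ι (.xpair a k 1)) * xx a (ι (.xpair a k 0))).prod).prod =
      (cpairPart Sum.inl t.u κ : E2 g n) := by
    unfold cpairPart
    refine congrArg List.prod (List.map_congr_left fun a _ => congrArg List.prod ?_)
    refine (List.map_range_eq_map_finRange _ _ _ fun k => ?_).symm
    rw [← h, ← h]; rfl
  have h5 : ((List.finRange g).map fun a => ((List.finRange (t.v a)).map fun k =>
      gg (ι (.ypair a k 0)) (ι (.ypair a k 1)) * yy a (ι (.ypair a k 0))).prod).prod =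
      (cpairPart Sum.inr t.v κ : E2 g n) := by
    unfold cpairPart
    refine congrArg List.prod (List.map_congr_left fun a _ => congrArg List.prod ?_)
    refine (List.map_range_eq_map_finRange _ _ _ fun k => ?_).symm
    rw [← h, ← h]; rfl
  rw [monomial, h1, h2, h3, h4, h5, mono]

/-! ### Dependence on the places -/

theorem pairPart_congr {g n : ℕ} {ρ : Fin 2} {κ κ' : Place g → Fin n}
    (h : ρ = 1 → ∀ b, κ (.pair b) = κ' (.pair b)) : (pairPart ρ κ : E2 g n) = pairPart ρ κ' := by
  unfold pairPart
  split_ifs with hr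
  · rw [h hr, h hr]
  · rfl

theorem clsPart_congr {g n : ℕ} {e : Fin g → Fin g ⊕ Fin g} {S : Finset (Fin g)}
    {κ κ' : Place g → Fin n} (h : ∀ a ∈ S, κ (.cls (e a)) = κ' (.cls (e a))) :
    (clsPart e S κ : E2 g n) = clsPart e S κ' := by
  unfold clsPart
  refine congrArg List.prod (List.map_congr_left fun a _ => ?_)
  split_ifs with ha
  · rw [h a ha]
  · rfl

theorem cpairPart_congr {g n : ℕ} {e : Fin g → Fin g ⊕ Fin g} {u : Fin g → ℕ}
    {κ κ' : Place g → Fin n} (h : ∀ a, ∀ k < u a, ∀ b, κ (.cpair (e a) k b) = κ' (.cpair (e a) k b)) :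
    (cpairPart e u κ : E2 g n) = cpairPart e u κ' := by
  unfold cpairPart
  refine congrArg List.prod (List.map_congr_left fun a _ => congrArg List.prod ?_)
  refine List.map_congr_left fun k hk => ?_
  have hk := List.mem_range.1 hk
  rw [cpairFactor, cpairFactor, h a k hk, h a k hk]

theorem mono_congr {g n : ℕ} {t : Gam g} {κ κ' : Place g → Fin n}
    (h : ∀ p ∈ t.places, κ p = κ' p) : (mono t κ : E2 g n) = mono t κ' := by
  rw [mono, mono, pairPart_congr fun hr b => h (.pair b) hr,
    clsPart_congr (e := Sum.inl) fun a ha => h (.cls (Sum.inl a)) ha,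
    clsPart_congr (e := Sum.inr) fun a ha => h (.cls (Sum.inr a)) ha,
    cpairPart_congr (e := Sum.inl) (u := t.u) fun a k hk b => h (.cpair (Sum.inl a) k b) hk,
    cpairPart_congr (e := Sum.inr) (u := t.v) fun a k hk b => h (.cpair (Sum.inr a) k b) hk]

theorem perm_mono {g n : ℕ} (σ : Equiv.Perm (Fin n)) (t : Gam g) (κ : Place g → Fin n) :
    perm σ (mono t κ : E2 g n) = mono t (σ ∘ κ) := by
  have h1 : perm σ (pairPart t.rho κ : E2 g n) = pairPart t.rho (σ ∘ κ) := by
    unfold pairPart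
    split_ifs <;> simp [perm_gg]
  have h2 : ∀ e S, perm σ (clsPart e S κ : E2 g n) = clsPart e S (σ ∘ κ) := by
    intro e S
    unfold clsPart
    rw [map_list_prod, List.map_map]
    refine congrArg List.prod (List.map_congr_left fun a _ => ?_)
    rw [Function.comp_apply]
    split_ifs <;> simp [perm_gen_C]
  have h3 : ∀ e u, perm σ (cpairPart e u κ : E2 g n) = cpairPart e u (σ ∘ κ) := by
    intro e S
    unfold cpairPart
    rw [map_list_prod, List.map_map]
    refine congrArg List.prod (List.map_congr_left fun a _ => ?_)
    rw [Function.comp_apply, map_list_prod, List.map_map]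
    refine congrArg List.prod (List.map_congr_left fun k _ => ?_)
    simp [cpairFactor, perm_gg, perm_gen_C]
  simp only [mono, map_mul, h1, h2, h3]

/-- Used for both `sub g U` and `cocycles`. The blocks `α_{••}` are kept whole because their edges
alone are not cocycles. -/
theorem mono_mem {g n : ℕ} (A : Subalgebra ℚ (E2 g n)) (t : Gam g) (κ : Place g → Fin n)
    (hp : t.rho = 1 → gg (κ (.pair 0)) (κ (.pair 1)) ∈ A)
    (hc : ∀ c, t.has c → gen (Gen.C c (κ (.cls c))) ∈ A)
    (hcp : ∀ c, ∀ k < t.mult c, cpairFactor c k κ ∈ A) : mono t κ ∈ A := by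
  refine mul_mem (mul_mem (mul_mem (mul_mem ?_ ?_) ?_) ?_) ?_
  · unfold pairPart
    split_ifs with h
    · exact hp h
    · exact one_mem A
  · refine list_prod_mem fun x hx => ?_
    obtain ⟨a, -, rfl⟩ := List.mem_map.1 hx
    split_ifs with h
    · exact hc _ h
    · exact one_mem A
  · refine list_prod_mem fun x hx => ?_
    obtain ⟨a, -, rfl⟩ := List.mem_map.1 hx
    split_ifs with h
    · exact hc _ h
    · exact one_mem A
  · refine list_prod_mem fun x hx => ?_
    obtain ⟨a, -, rfl⟩ := List.mem_map.1 hx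
    refine list_prod_mem fun x hx => ?_
    obtain ⟨k, hk, rfl⟩ := List.mem_map.1 hx
    exact hcp _ k (List.mem_range.1 hk)
  · refine list_prod_mem fun x hx => ?_
    obtain ⟨a, -, rfl⟩ := List.mem_map.1 hx
    refine list_prod_mem fun x hx => ?_
    obtain ⟨k, hk, rfl⟩ := List.mem_map.1 hx
    exact hcp _ k (List.mem_range.1 hk)

theorem mono_mem_sub {g n : ℕ} {t : Gam g} {κ : Place g → Fin n} {U : Finset (Fin n)}
    (h : ∀ p ∈ t.places, κ p ∈ U) : mono t κ ∈ sub g U := by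
  refine mono_mem _ t κ (fun hr => gg_mem_sub (h (.pair 0) hr) (h (.pair 1) hr))
    (fun c hc => gen_C_mem_sub c (h (.cls c) hc)) fun c k hk => ?_
  exact mul_mem (gg_mem_sub (h (.cpair c k 0) hk) (h (.cpair c k 1) hk))
    (gen_C_mem_sub c (h (.cpair c k 0) hk))

/-! ### Multiplying a monomial by one more factor -/

theorem cpairFactor_commute {g n : ℕ} (c : Fin g ⊕ Fin g) (k : ℕ) (κ : Place g → Fin n)
    (z : E2 g n) : Commute (cpairFactor c k κ) z :=
  gg_mul_gen_commute _ _ _ z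

theorem gen_mul_pairPart {g n : ℕ} (s : Gen g n) (ρ : Fin 2) (κ : Place g → Fin n) :
    (gen s * pairPart ρ κ : E2 g n) = (-1 : ℚ) ^ (ρ : ℕ) • (pairPart ρ κ * gen s) := by
  unfold pairPart
  fin_cases ρ
  · simp
  · simp [gg_anticomm_gen]

theorem gen_mul_list_prod {g n : ℕ} (s : Gen g n) (S : Finset (Fin g)) (f : Fin g → Gen g n)
    (l : List (Fin g)) :
    (gen s * (l.map fun a => if a ∈ S then gen (f a) else 1).prod : E2 g n) =
      (-1 : ℚ) ^ (l.filter (· ∈ S)).length •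
        ((l.map fun a => if a ∈ S then gen (f a) else 1).prod * gen s) := by
  induction l with
  | nil => simp
  | cons a l ih =>
    rw [List.map_cons, List.prod_cons]
    by_cases ha : a ∈ S
    · rw [if_pos ha, ← mul_assoc, gen_anticomm, neg_mul, mul_assoc, ih,
        List.filter_cons_of_pos (by simpa using ha), List.length_cons, pow_succ]
      simp [mul_assoc]
    · rw [if_neg ha, one_mul, ih, List.filter_cons_of_neg (by simpa using ha)]

theorem length_filter_finRange {g : ℕ} (S : Finset (Fin g)) :
    ((List.finRange g).filter (· ∈ S)).length = S.card := by
  rw [← List.toFinset_card_of_nodup ((List.nodup_finRange g).filter _)]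
  congr 1
  ext a
  simp

theorem gen_mul_clsPart {g n : ℕ} (s : Gen g n) (e : Fin g → Fin g ⊕ Fin g)
    (S : Finset (Fin g)) (κ : Place g → Fin n) :
    (gen s * clsPart e S κ : E2 g n) = (-1 : ℚ) ^ S.card • (clsPart e S κ * gen s) := by
  rw [clsPart, gen_mul_list_prod s S fun a => Gen.C (e a) (κ (.cls (e a))),
    length_filter_finRange]

/-- On its way to its sorted position the new class passes exactly the elements of `S` below `a`,
each with a sign. -/
theorem gen_mul_insert_list_prod {g n : ℕ} (S : Finset (Fin g)) (f : Fin g → Gen g n) {a : Fin g}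
    (ha : a ∉ S) (l : List (Fin g)) (hl : l.Pairwise (· < ·)) (hal : a ∈ l) :
    (gen (f a) * (l.map fun b => if b ∈ S then gen (f b) else 1).prod : E2 g n) =
      (-1 : ℚ) ^ (l.filter fun b => b ∈ S ∧ b < a).length •
        (l.map fun b => if b ∈ insert a S then gen (f b) else 1).prod := by
  induction l with
  | nil => simp at hal
  | cons b l ih =>
    obtain ⟨hb, hl⟩ := List.pairwise_cons.1 hl
    by_cases hab : b = a
    · subst hab
      have h1 : l.filter (fun c => c ∈ S ∧ c < b) = [] := by
        rw [List.filter_eq_nil_iff]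
        intro c hc
        simpa using fun _ => (hb c hc).le
      have h2 : (l.map fun c => if c ∈ S then gen (f c) else 1 : List (E2 g n)) =
          l.map fun c => if c ∈ insert b S then gen (f c) else 1 := by
        refine List.map_congr_left fun c hc => ?_
        simp [(hb c hc).ne']
      rw [List.map_cons, List.map_cons, List.prod_cons, List.prod_cons, if_neg ha,
        if_pos (Finset.mem_insert_self b S), List.filter_cons_of_neg (by simp), h1, h2]
      simp
    · have hal : a ∈ l := (List.mem_cons.1 hal).resolve_left (Ne.symm hab)
      have hba : b < a := hb a hal
      rw [List.map_cons, List.map_cons, List.prod_cons, List.prod_cons]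
      by_cases hbS : b ∈ S
      · rw [if_pos hbS, if_pos (Finset.mem_insert_of_mem hbS), ← mul_assoc, gen_anticomm, neg_mul,
          mul_assoc, ih hl hal, List.filter_cons_of_pos (by simpa using ⟨hbS, hba⟩),
          List.length_cons, pow_succ]
        simp
      · rw [if_neg hbS, if_neg (by simp [hab, hbS]), one_mul, one_mul, ih hl hal,
          List.filter_cons_of_neg (by simp [hbS])]

theorem gen_mul_insert_clsPart {g n : ℕ} (e : Fin g → Fin g ⊕ Fin g) (he : Function.Injective e)
    {S : Finset (Fin g)} {a : Fin g} (ha : a ∉ S) (κ : Place g → Fin n) (i : Fin n) :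
    (gen (Gen.C (e a) i) * clsPart e S κ : E2 g n) =
      (-1 : ℚ) ^ (S.filter (· < a)).card •
        clsPart e (insert a S) (Function.update κ (.cls (e a)) i) := by
  have h1 : (clsPart e S κ : E2 g n) = clsPart e S (Function.update κ (.cls (e a)) i) := by
    refine clsPart_congr fun b hb => ?_
    rw [Function.update_of_ne]
    intro h
    simp only [Place.cls.injEq] at h
    exact ha (he h ▸ hb)
  have h := gen_mul_insert_list_prod (n := n) S
    (fun b => Gen.C (e b) (Function.update κ (.cls (e a)) i (.cls (e b)))) ha (List.finRange g)
    (List.pairwise_lt_finRange g) (List.mem_finRange a)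
  rw [Function.update_self] at h
  rw [h1, clsPart, h, clsPart]
  congr 2
  rw [← List.toFinset_card_of_nodup ((List.nodup_finRange g).filter _)]
  congr 1
  ext b
  simp

theorem list_prod_update {A β : Type*} [Monoid A] [DecidableEq β] (f f' : β → A) (x : A) (a : β)
    (l : List β) (hl : l.Nodup) (hal : a ∈ l) (hx : ∀ z, Commute x z) (ha : f' a = x * f a)
    (hf : ∀ b ≠ a, f' b = f b) : (l.map f').prod = x * (l.map f).prod := by
  induction l with
  | nil => simp at hal
  | cons b l ih =>
    obtain ⟨hb, hl⟩ := List.nodup_cons.1 hl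
    rw [List.map_cons, List.map_cons, List.prod_cons, List.prod_cons]
    by_cases hab : b = a
    · subst hab
      rw [ha, mul_assoc, List.map_congr_left fun c hc => hf c fun h => hb (h ▸ hc)]
    · have hal : a ∈ l := (List.mem_cons.1 hal).resolve_left (Ne.symm hab)
      rw [hf b hab, ih hl hal, ← mul_assoc, ← mul_assoc, (hx _).eq]

/-- An edge times a class is even, hence central, so the new block can be appended as the factor of
index `u a` without a sign. -/
theorem cpairPart_update {g n : ℕ} (e : Fin g → Fin g ⊕ Fin g) (he : Function.Injective e)
    (u : Fin g → ℕ) (a : Fin g) (κ : Place g → Fin n) (i j : Fin n) :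
    (cpairPart e (Function.update u a (u a + 1)) (Function.update
      (Function.update κ (.cpair (e a) (u a) 0) i) (.cpair (e a) (u a) 1) j) : E2 g n) =
      (gg i j * gen (Gen.C (e a) i)) * cpairPart e u κ := by
  set κ' := Function.update (Function.update κ (.cpair (e a) (u a) 0) i) (.cpair (e a) (u a) 1) j
    with hκ'
  have h0 : κ' (.cpair (e a) (u a) 0) = i := by
    rw [hκ', Function.update_of_ne (by simp), Function.update_self]
  have h1 : κ' (.cpair (e a) (u a) 1) = j := by
    rw [hκ', Function.update_self]
  have h2 : (cpairPart e u κ : E2 g n) = cpairPart e u κ' := by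
    refine cpairPart_congr fun c k hk b => ?_
    have : ∀ b', (Place.cpair (e c) k b) ≠ .cpair (e a) (u a) b' := by
      intro b' h
      simp only [Place.cpair.injEq] at h
      have := he h.1
      subst this
      omega
    rw [hκ', Function.update_of_ne (this 1), Function.update_of_ne (this 0)]
  rw [h2]
  refine list_prod_update _ _ _ a _ (List.nodup_finRange g) (List.mem_finRange a)
    (gg_mul_gen_commute i j _) ?_ ?_
  · rw [Function.update_self, List.range_succ, List.map_append, List.prod_append, List.map_singleton,
      List.prod_singleton]
    rw [← (cpairFactor_commute (e a) (u a) κ' _).eq, cpairFactor, h0, h1]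
  · intro b hb
    rw [Function.update_of_ne hb]

theorem pairPart_update {g n : ℕ} (ρ : Fin 2) (κ : Place g → Fin n) (p : Place g) (i : Fin n)
    (hp : ∀ b, p ≠ .pair b) : (pairPart ρ (Function.update κ p i) : E2 g n) = pairPart ρ κ :=
  pairPart_congr fun _ b => Function.update_of_ne (hp b).symm _ _

theorem clsPart_update {g n : ℕ} (e : Fin g → Fin g ⊕ Fin g) (S : Finset (Fin g))
    (κ : Place g → Fin n) (p : Place g) (i : Fin n) (hp : ∀ a, p ≠ .cls (e a)) :
    (clsPart e S (Function.update κ p i) : E2 g n) = clsPart e S κ :=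
  clsPart_congr fun a _ => Function.update_of_ne (hp a).symm _ _

theorem cpairPart_update_of_ne {g n : ℕ} (e : Fin g → Fin g ⊕ Fin g) (u : Fin g → ℕ)
    (κ : Place g → Fin n) (p : Place g) (i : Fin n) (hp : ∀ a k b, p ≠ .cpair (e a) k b) :
    (cpairPart e u (Function.update κ p i) : E2 g n) = cpairPart e u κ :=
  cpairPart_congr fun a k _ b => Function.update_of_ne (hp a k b).symm _ _

theorem gen_mul_mono_inl {g n : ℕ} {t : Gam g} {a : Fin g} (ha : a ∉ t.S) (κ : Place g → Fin n)
    (i : Fin n) : (gen (Gen.C (Sum.inl a) i) * mono t κ : E2 g n) =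
      (-1 : ℚ) ^ ((t.rho : ℕ) + (t.S.filter (· < a)).card) •
        mono { t with S := insert a t.S } (Function.update κ (.cls (Sum.inl a)) i) := by
  simp only [mono]
  rw [pairPart_update _ _ _ _ (by simp), clsPart_update Sum.inr _ _ _ _ (by simp),
    cpairPart_update_of_ne _ _ _ _ _ (by simp), cpairPart_update_of_ne _ _ _ _ _ (by simp)]
  simp only [← mul_assoc]
  rw [gen_mul_pairPart, smul_mul_assoc, mul_assoc (pairPart t.rho κ),
    gen_mul_insert_clsPart Sum.inl Sum.inl_injective ha]
  simp only [smul_mul_assoc, mul_smul_comm, smul_smul, pow_add]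

/-- The class `y⁽ᵃ⁾` must pass the bare edge, all the `x` classes, and the smaller `y` classes,
which accounts for the exponent. -/
theorem gen_mul_mono_inr {g n : ℕ} {t : Gam g} {a : Fin g} (ha : a ∉ t.T) (κ : Place g → Fin n)
    (i : Fin n) : (gen (Gen.C (Sum.inr a) i) * mono t κ : E2 g n) =
      (-1 : ℚ) ^ ((t.rho : ℕ) + t.S.card + (t.T.filter (· < a)).card) •
        mono { t with T := insert a t.T } (Function.update κ (.cls (Sum.inr a)) i) := by
  simp only [mono]
  rw [pairPart_update _ _ _ _ (by simp), clsPart_update Sum.inl _ _ _ _ (by simp),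
    cpairPart_update_of_ne _ _ _ _ _ (by simp), cpairPart_update_of_ne _ _ _ _ _ (by simp)]
  simp only [← mul_assoc]
  rw [gen_mul_pairPart, smul_mul_assoc, mul_assoc (pairPart t.rho κ), gen_mul_clsPart,
    mul_smul_comm, ← mul_assoc]
  simp only [smul_mul_assoc]
  rw [mul_assoc (pairPart t.rho κ * clsPart Sum.inl t.S κ),
    gen_mul_insert_clsPart Sum.inr Sum.inr_injective ha]
  simp only [smul_mul_assoc, mul_smul_comm, smul_smul, pow_add, mul_assoc]

theorem gg_mul_mono {g n : ℕ} {t : Gam g} (ht : t.rho = 0) (κ : Place g → Fin n) (i j : Fin n) :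
    (gg i j * mono t κ : E2 g n) = mono { t with rho := 1 }
      (Function.update (Function.update κ (.pair 0) i) (.pair 1) j) := by
  set κ' := Function.update (Function.update κ (.pair 0) i) (.pair 1) j with hκ'
  have h0 : κ' (.pair 0) = i := by
    rw [hκ', Function.update_of_ne (by simp), Function.update_self]
  have h1 : κ' (.pair 1) = j := by
    rw [hκ', Function.update_self]
  have h2 : ∀ e S, (clsPart e S κ' : E2 g n) = clsPart e S κ := by
    intro e S
    rw [hκ', clsPart_update _ _ _ _ _ (by simp), clsPart_update _ _ _ _ _ (by simp)]
  have h3 : ∀ e u, (cpairPart e u κ' : E2 g n) = cpairPart e u κ := by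
    intro e S
    rw [hκ', cpairPart_update_of_ne _ _ _ _ _ (by simp), cpairPart_update_of_ne _ _ _ _ _ (by simp)]
  simp only [mono, h2, h3, ht, pairPart, h0, h1]
  simp [mul_assoc]

theorem cpair_mul_mono_inl {g n : ℕ} (t : Gam g) (a : Fin g) (κ : Place g → Fin n) (i j : Fin n) :
    ((gg i j * gen (Gen.C (Sum.inl a) i)) * mono t κ : E2 g n) =
      mono { t with u := Function.update t.u a (t.u a + 1) } (Function.update (Function.update κ
        (.cpair (Sum.inl a) (t.u a) 0) i) (.cpair (Sum.inl a) (t.u a) 1) j) := by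
  simp only [mono, cpairPart_update Sum.inl Sum.inl_injective]
  rw [pairPart_update _ _ _ _ (by simp), pairPart_update _ _ _ _ (by simp)]
  rw [clsPart_update _ _ _ _ _ (by simp), clsPart_update _ _ _ _ _ (by simp),
    clsPart_update _ _ _ _ _ (by simp), clsPart_update _ _ _ _ _ (by simp)]
  rw [cpairPart_update_of_ne Sum.inr _ _ _ _ (by simp),
    cpairPart_update_of_ne Sum.inr _ _ _ _ (by simp)]
  have h : ∀ P Q R S : E2 g n, (gg i j * gen (Gen.C (Sum.inl a) i)) * (P * Q * R * S) =
      P * Q * (gg i j * gen (Gen.C (Sum.inl a) i) * R) * S := by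
    intro P Q R S
    rw [← mul_assoc, ← mul_assoc, (gg_mul_gen_commute _ _ _ (P * Q)).eq]
    simp only [mul_assoc]
  rw [h]

theorem cpair_mul_mono_inr {g n : ℕ} (t : Gam g) (a : Fin g) (κ : Place g → Fin n) (i j : Fin n) :
    ((gg i j * gen (Gen.C (Sum.inr a) i)) * mono t κ : E2 g n) =
      mono { t with v := Function.update t.v a (t.v a + 1) } (Function.update (Function.update κ
        (.cpair (Sum.inr a) (t.v a) 0) i) (.cpair (Sum.inr a) (t.v a) 1) j) := by
  simp only [mono, cpairPart_update Sum.inr Sum.inr_injective]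
  rw [pairPart_update _ _ _ _ (by simp), pairPart_update _ _ _ _ (by simp)]
  rw [clsPart_update _ _ _ _ _ (by simp), clsPart_update _ _ _ _ _ (by simp),
    clsPart_update _ _ _ _ _ (by simp), clsPart_update _ _ _ _ _ (by simp)]
  rw [cpairPart_update_of_ne Sum.inl _ _ _ _ (by simp),
    cpairPart_update_of_ne Sum.inl _ _ _ _ (by simp)]
  rw [← mul_assoc, (gg_mul_gen_commute _ _ _ (_ * _ * _ * _)).eq]
  simp only [mul_assoc]

/-! ### Adding a factor to a tuple -/

/-- The tuple with the class `c` added to `S` or `T`. -/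
def Gam.addCls {g : ℕ} (t : Gam g) : Fin g ⊕ Fin g → Gam g
  | .inl a => { t with S := insert a t.S }
  | .inr a => { t with T := insert a t.T }

/-- The tuple with the class `c` removed from `S` or `T`. -/
def Gam.eraseCls {g : ℕ} (t : Gam g) : Fin g ⊕ Fin g → Gam g
  | .inl a => { t with S := t.S.erase a }
  | .inr a => { t with T := t.T.erase a }

/-- The tuple with the exponent of the class `c` raised by one. -/
def Gam.addCpair {g : ℕ} (t : Gam g) : Fin g ⊕ Fin g → Gam g
  | .inl a => { t with u := Function.update t.u a (t.u a + 1) }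
  | .inr a => { t with v := Function.update t.v a (t.v a + 1) }

theorem Gam.addCls_eraseCls {g : ℕ} {t : Gam g} {c : Fin g ⊕ Fin g} (h : t.has c) :
    (t.eraseCls c).addCls c = t := by
  cases c with
  | inl a => simp only [addCls, eraseCls]; rw [Finset.insert_erase h]
  | inr a => simp only [addCls, eraseCls]; rw [Finset.insert_erase h]

theorem Gam.not_has_eraseCls {g : ℕ} (t : Gam g) (c : Fin g ⊕ Fin g) : ¬ (t.eraseCls c).has c := by
  cases c <;> simp [has, eraseCls]

theorem Gam.places_addCls {g : ℕ} (t : Gam g) (c : Fin g ⊕ Fin g) :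
    (t.addCls c).places = insert (.cls c) t.places := by
  ext p
  rw [Set.mem_insert_iff]
  rcases c with a | a <;> rcases p with b | (b | b) | ⟨b | b, k, l⟩ <;>
    simp only [places, addCls, has, mult, Set.mem_ofPred_eq, Sum.elim_inl, Sum.elim_inr,
      Finset.mem_insert, reduceCtorEq, false_or, Place.cls.injEq, Sum.inl.injEq, Sum.inr.injEq]

theorem Gam.places_addCpair {g : ℕ} (t : Gam g) (c : Fin g ⊕ Fin g) :
    (t.addCpair c).places =
      insert (.cpair c (t.mult c) 1) (insert (.cpair c (t.mult c) 0) t.places) := by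
  have key : ∀ k l, k < (t.addCpair c).mult c ↔ Place.cpair c k l = .cpair c (t.mult c) 1 ∨
      Place.cpair c k l = .cpair c (t.mult c) 0 ∨ k < t.mult c := by
    intro k l
    have h : (t.addCpair c).mult c = t.mult c + 1 := by
      cases c <;> simp [addCpair, mult]
    rw [h]
    fin_cases l <;> simp <;> omega
  ext p
  rw [Set.mem_insert_iff, Set.mem_insert_iff]
  rcases p with b | b | ⟨b, k, l⟩
  · cases c <;> simp [places, addCpair]
  · cases c <;> simp [places, addCpair, has]
  · by_cases hb : b = c
    · subst hb
      exact key k l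
    · have h : (t.addCpair c).mult b = t.mult b := by
        rcases c with a | a <;> rcases b with b | b <;> simp [addCpair, mult]
        · rw [Function.update_of_ne (fun e : b = a => hb (e ▸ rfl))]
        · rw [Function.update_of_ne (fun e : b = a => hb (e ▸ rfl))]
      simp [places, h, hb]

theorem Gam.places_addPair {g : ℕ} (t : Gam g) :
    ({ t with rho := 1 } : Gam g).places = insert (.pair 1) (insert (.pair 0) t.places) := by
  ext p
  rcases p with b | (b | b) | ⟨b | b, k, l⟩ <;> simp [places, has, mult]
  fin_cases b <;> simp

theorem Gam.notMem_places_cls {g : ℕ} {t : Gam g} {c : Fin g ⊕ Fin g} (h : ¬ t.has c) :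
    Place.cls c ∉ t.places := h

/-- The sign is left unspecified: spanning and vanishing arguments need only that it is invertible.
-/
theorem gen_mul_mono {g n : ℕ} {t : Gam g} {c : Fin g ⊕ Fin g} (hc : ¬ t.has c)
    (κ : Place g → Fin n) (i : Fin n) : ∃ ε : ℚ, ε * ε = 1 ∧
      (gen (Gen.C c i) * mono t κ : E2 g n) =
        ε • mono (t.addCls c) (Function.update κ (.cls c) i) := by
  have h : ∀ k : ℕ, (-1 : ℚ) ^ k * (-1 : ℚ) ^ k = 1 := by
    intro k; rw [← mul_pow]; simp
  cases c with
  | inl a => exact ⟨_, h _, gen_mul_mono_inl hc κ i⟩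
  | inr a => exact ⟨_, h _, gen_mul_mono_inr hc κ i⟩

theorem cpair_mul_mono {g n : ℕ} (t : Gam g) (c : Fin g ⊕ Fin g) (κ : Place g → Fin n)
    (i j : Fin n) : ((gg i j * gen (Gen.C c i)) * mono t κ : E2 g n) =
      mono (t.addCpair c) (Function.update (Function.update κ
        (.cpair c (t.mult c) 0) i) (.cpair c (t.mult c) 1) j) := by
  cases c with
  | inl a => exact cpair_mul_mono_inl t a κ i j
  | inr a => exact cpair_mul_mono_inr t a κ i j

/-- Erasing `c` and multiplying it back in changes the monomial only by a sign, so a single class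
can be pulled to the front. -/
theorem exists_mono_of_has {g n : ℕ} {t : Gam g} {c : Fin g ⊕ Fin g} (hc : t.has c)
    (κ : Place g → Fin n) : ∃ ε : ℚ,
      (mono t κ : E2 g n) = ε • (gen (Gen.C c (κ (.cls c))) * mono (t.eraseCls c) κ) := by
  obtain ⟨ε, h1, h2⟩ := gen_mul_mono (t.not_has_eraseCls c) κ (κ (.cls c))
  refine ⟨ε, ?_⟩
  rw [h2, Gam.addCls_eraseCls hc, Function.update_eq_self, smul_smul, h1, one_smul]

theorem exists_mono_of_rho {g n : ℕ} {t : Gam g} (ht : t.rho = 1)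
    (κ : Place g → Fin n) :
      (mono t κ : E2 g n) =
        gg (κ (.pair 0)) (κ (.pair 1)) * mono { t with rho := 0 } κ := by
  rw [gg_mul_mono rfl, Function.update_eq_self, Function.update_eq_self]
  congr 1
  rw [← ht]

/-! ### The symmetrized monomials span the invariants -/

/-- The span of the symmetrized monomials. -/
def monoSpan (g n : ℕ) : Submodule ℚ (E2 g n) :=
  Submodule.span ℚ {z | ∃ (t : Gam g) (κ : Place g → Fin n),
    Set.InjOn κ t.places ∧ z = symm g n (mono t κ)}

/-- The places of `t` are filled with distinct points outside `U`. -/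
def Avoids {g n : ℕ} (t : Gam g) (κ : Place g → Fin n) (U : Finset (Fin n)) : Prop :=
  Set.InjOn κ t.places ∧ ∀ p ∈ t.places, κ p ∉ U

theorem Avoids.mono {g n : ℕ} {t : Gam g} {κ : Place g → Fin n} {U V : Finset (Fin n)}
    (h : Avoids t κ U) (hV : V ⊆ U) : Avoids t κ V :=
  ⟨h.1, fun p hp hpV => h.2 p hp (hV hpV)⟩

theorem Avoids.update {g n : ℕ} {t t' : Gam g} {κ : Place g → Fin n} {U : Finset (Fin n)}
    {p : Place g} {i : Fin n} (h : Avoids t κ U) (hi : i ∈ U) (hp : p ∉ t.places)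
    (ht : t'.places = insert p t.places) : Avoids t' (Function.update κ p i) (U.erase i) := by
  have h0 : ∀ q ∈ t.places, Function.update κ p i q = κ q :=
    fun q hq => Function.update_of_ne (fun e : q = p => hp (e ▸ hq)) _ _
  refine ⟨?_, ?_⟩
  · rw [ht, Set.injOn_insert hp]
    refine ⟨h.1.congr fun q hq => (h0 q hq).symm, ?_⟩
    rintro ⟨q, hq, e⟩
    rw [h0 q hq, Function.update_self] at e
    exact h.2 q hq (e ▸ hi)
  · intro q hq
    rw [ht] at hq
    rcases hq with rfl | hq
    · simp
    · rw [h0 q hq]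
      exact fun hm => h.2 q hq (Finset.mem_of_mem_erase hm)

theorem Avoids.update_two {g n : ℕ} {t t' : Gam g} {κ : Place g → Fin n} {U : Finset (Fin n)}
    {p q : Place g} {i j : Fin n} (h : Avoids t κ U) (hi : i ∈ U) (hj : j ∈ U.erase i)
    (hp : p ∉ t.places) (hq : q ∉ insert p t.places)
    (ht : t'.places = insert q (insert p t.places)) :
    Avoids t' (Function.update (Function.update κ p i) q j) ((U.erase i).erase j) := by
  have hqp : q ≠ p := fun e => hq (e ▸ Set.mem_insert _ _)
  have hij : i ≠ j := fun e => (Finset.mem_erase.1 hj).1 e.symm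
  have h0 : ∀ r ∈ t.places, Function.update (Function.update κ p i) q j r = κ r := by
    intro r hr
    rw [Function.update_of_ne (fun e : r = q => hq (Set.mem_insert_of_mem _ (e ▸ hr))),
      Function.update_of_ne (fun e : r = p => hp (e ▸ hr))]
  have h1 : Function.update (Function.update κ p i) q j p = i := by
    rw [Function.update_of_ne hqp.symm, Function.update_self]
  have h2 : Function.update (Function.update κ p i) q j q = j := Function.update_self _ _ _
  refine ⟨?_, ?_⟩
  · rw [ht, Set.injOn_insert hq, Set.injOn_insert hp]
    refine ⟨⟨h.1.congr fun r hr => (h0 r hr).symm, ?_⟩, ?_⟩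
    · rintro ⟨r, hr, e⟩
      rw [h0 r hr, h1] at e
      exact h.2 r hr (e ▸ hi)
    · rintro ⟨r, rfl | hr, e⟩
      · rw [h1, h2] at e
        exact hij e
      · rw [h0 r hr, h2] at e
        exact h.2 r hr (e ▸ Finset.mem_of_mem_erase hj)
  · intro r hr
    rw [ht] at hr
    rcases hr with rfl | rfl | hr
    · rw [h2]; simp
    · rw [h1]; simp [hij]
    · rw [h0 r hr]
      exact fun hm => h.2 r hr (Finset.mem_of_mem_erase (Finset.mem_of_mem_erase hm))

/-- A repeated odd class has trivial symmetrization. -/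
theorem symm_gen_mul_mono {g n : ℕ} {t : Gam g} {κ : Place g → Fin n} {c : Fin g ⊕ Fin g}
    (hc : t.has c) (hκ : Set.InjOn κ t.places) {s : Fin n} (hs : ∀ p ∈ t.places, κ p ≠ s)
    {z : E2 g n} (hz : perm (Equiv.swap s (κ (.cls c))) z = z) :
    symm g n (z * (gen (Gen.C c s) * mono t κ)) = 0 := by
  obtain ⟨ε, h⟩ := exists_mono_of_has (n := n) hc κ
  have hpl : t.places = insert (.cls c) (t.eraseCls c).places := by
    rw [← Gam.places_addCls, Gam.addCls_eraseCls hc]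
  have hnot : Place.cls c ∉ (t.eraseCls c).places :=
    Gam.notMem_places_cls (t.not_has_eraseCls c)
  refine symm_eq_zero (Equiv.swap s (κ (.cls c))) ?_
  have hm : (mono (t.eraseCls c) (Equiv.swap s (κ (.cls c)) ∘ κ) : E2 g n) =
      mono (t.eraseCls c) κ := by
    refine mono_congr fun p hp => ?_
    have hpt : p ∈ t.places := hpl ▸ Set.mem_insert_of_mem _ hp
    refine Equiv.swap_apply_of_ne_of_ne (hs p hpt) fun e => ?_
    have := hκ hpt (hpl ▸ Set.mem_insert _ _) e
    exact hnot (this ▸ hp)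
  rw [h]
  simp only [map_mul, map_smul, hz, perm_gen_C, perm_mono, hm, Equiv.swap_apply_left,
    Equiv.swap_apply_right, mul_smul_comm, ← mul_assoc]
  rw [mul_assoc z, gen_anticomm, mul_neg, neg_mul, smul_neg, ← mul_assoc]

/-- A repeated factor `g_{••}` has trivial symmetrization. -/
theorem symm_gg_mul_mono {g n : ℕ} {t : Gam g} {κ : Place g → Fin n}
    (ht : t.rho = 1) (hκ : Set.InjOn κ t.places) {s q : Fin n} (hsq : s ≠ q)
    (hs : ∀ p ∈ t.places, κ p ≠ s) (hq : ∀ p ∈ t.places, κ p ≠ q) {z : E2 g n}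
    (hz : ∀ σ : Equiv.Perm (Fin n), (∀ i, i ≠ s → i ≠ q → (∀ p ∈ t.places, κ p ≠ i) → σ i = i) →
      perm σ z = z) :
    symm g n (z * (gg s q * mono t κ)) = 0 := by
  set i := κ (.pair 0) with hi
  set j := κ (.pair 1) with hj
  have hpl : t.places = insert (.pair 1)
      (insert (.pair 0) ({ t with rho := 0 } : Gam g).places) := by
    rw [← Gam.places_addPair, ← ht]
  have h0 : Place.pair 0 ∈ t.places := ht
  have h1 : Place.pair 1 ∈ t.places := ht
  have hij : i ≠ j := fun e => by simpa using hκ h0 h1 e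
  have his : i ≠ s := hs _ h0
  have hiq : i ≠ q := hq _ h0
  have hjs : j ≠ s := hs _ h1
  have hjq : j ≠ q := hq _ h1
  let σ := Equiv.swap s i * Equiv.swap q j
  have hσ' : ∀ k, σ k = Equiv.swap s i (Equiv.swap q j k) := fun _ => rfl
  have hσs : σ s = i := by
    rw [hσ', Equiv.swap_apply_of_ne_of_ne hsq hjs.symm, Equiv.swap_apply_left]
  have hσq : σ q = j := by
    rw [hσ', Equiv.swap_apply_left, Equiv.swap_apply_of_ne_of_ne hjs hij.symm]
  have hσi : σ i = s := by
    rw [hσ', Equiv.swap_apply_of_ne_of_ne hiq hij, Equiv.swap_apply_right]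
  have hσj : σ j = q := by
    rw [hσ', Equiv.swap_apply_right, Equiv.swap_apply_of_ne_of_ne hsq.symm hiq.symm]
  have hσ : ∀ k, k ≠ s → k ≠ q → k ≠ i → k ≠ j → σ k = k := by
    intro k h1 h2 h3 h4
    rw [hσ', Equiv.swap_apply_of_ne_of_ne h2 h4, Equiv.swap_apply_of_ne_of_ne h1 h3]
  have hm : (mono ({ t with rho := 0 } : Gam g) (σ ∘ κ) : E2 g n) =
      mono { t with rho := 0 } κ := by
    refine mono_congr fun p hp => ?_
    have hpt : p ∈ t.places := by
      rw [hpl]; exact Set.mem_insert_of_mem _ (Set.mem_insert_of_mem _ hp)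
    have hnp : ∀ b, p ≠ .pair b := by
      rintro b rfl
      simp [Gam.places] at hp
    exact hσ _ (hs p hpt) (hq p hpt) (fun e => hnp 0 (hκ hpt h0 e))
      (fun e => hnp 1 (hκ hpt h1 e))
  refine symm_eq_zero σ ?_
  rw [exists_mono_of_rho ht, ← hi, ← hj]
  rw [map_mul, map_mul, map_mul, perm_gg, perm_gg, perm_mono, hm, hσs, hσq, hσi, hσj,
    hz σ fun k h1' h2 h3 => hσ k h1' h2 (Ne.symm (h3 _ h0)) (Ne.symm (h3 _ h1)),
    ← mul_assoc (gg i j), gg_anticomm]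
  noncomm_ring

/-- The spanning argument: `mono t κ` holds the blocks already built, and `z` involves only the
points `U` not yet used. Peeling off a point `s` either leaves the monomial alone, adds a class at
`s`, or starts an edge at `s`; every surviving case leaves a smaller `U`. -/
theorem symm_mul_mono_mem {g n : ℕ} (U : Finset (Fin n)) : ∀ (t : Gam g) (κ : Place g → Fin n),
    Avoids t κ U → ∀ z ∈ sub g U, symm g n (z * mono t κ) ∈ monoSpan g n := by
  induction U using Finset.strongInduction with
  | H U ih =>
  intro t κ h z hz
  rcases U.eq_empty_or_nonempty with rfl | ⟨s, hs⟩
  · obtain ⟨r, rfl⟩ := mem_of_mem_sub_empty hz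
    rw [← Algebra.smul_def, map_smul]
    exact Submodule.smul_mem _ _ (Submodule.subset_span ⟨t, κ, h.1, rfl⟩)
  have hss : U.erase s ⊂ U := Finset.erase_ssubset hs
  refine mem_of_mem_sub (s := s)
    ((monoSpan g n).comap ((symm g n).comp (LinearMap.mulRight ℚ (mono t κ)))) ?_ ?_ ?_ hz
  · exact fun z hz => ih _ hss t κ (h.mono hss.subset) z hz
  · intro z hz c
    rw [Submodule.mem_comap, LinearMap.comp_apply, LinearMap.mulRight_apply, mul_assoc]
    by_cases hc : t.has c
    · rw [symm_gen_mul_mono hc h.1 (fun p hp e => h.2 p hp (e ▸ hs))]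
      · exact zero_mem _
      · refine perm_of_mem_sub (fun i hi => ?_) hz
        have hi := Finset.mem_erase.1 hi
        exact Equiv.swap_apply_of_ne_of_ne hi.1 fun e => h.2 (.cls c) hc (e ▸ hi.2)
    · obtain ⟨ε, -, e⟩ := gen_mul_mono hc κ s
      rw [e, mul_smul_comm, map_smul]
      refine Submodule.smul_mem _ _ (ih _ hss _ _ ?_ z hz)
      exact h.update hs (Gam.notMem_places_cls hc) (Gam.places_addCls t c)
  · intro z hz q hq
    have hsq : s ≠ q := fun e => (Finset.mem_erase.1 hq).1 e.symm
    have hqU : q ∈ U := Finset.mem_of_mem_erase hq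
    have hss' : (U.erase s).erase q ⊂ U := (Finset.erase_ssubset hq).trans hss
    rw [Submodule.mem_comap, LinearMap.comp_apply, LinearMap.mulRight_apply, mul_assoc]
    -- Peeling off the other end `q` of the edge decides whether the edge stays bare, carries a
    -- class, or meets another edge.
    refine mem_of_mem_sub (s := q) ((monoSpan g n).comap
      ((symm g n).comp (LinearMap.mulRight ℚ (gg s q * mono t κ)))) ?_ ?_ ?_ hz
    · intro z hz
      rw [Submodule.mem_comap, LinearMap.comp_apply, LinearMap.mulRight_apply]
      by_cases ht : t.rho = 1
      · rw [symm_gg_mul_mono ht h.1 hsq (fun p hp e => h.2 p hp (e ▸ hs))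
          (fun p hp e => h.2 p hp (e ▸ hqU))]
        · exact zero_mem _
        · intro σ hσ
          refine perm_of_mem_sub (fun i hi => ?_) hz
          obtain ⟨h1, h2, h3⟩ : i ≠ q ∧ i ≠ s ∧ i ∈ U := by simpa using hi
          exact hσ i h2 h1 fun p hp e => h.2 p hp (e ▸ h3)
      · have ht : t.rho = 0 := by omega
        rw [gg_mul_mono ht]
        refine ih _ hss' _ _ (h.update_two hs hq ?_ ?_ (Gam.places_addPair t)) z hz
        · simp [Gam.places, ht]
        · simp [Gam.places, ht]
    · intro z hz c
      -- Here `α_q g_{sq} = -g_{sq} α_q = -g_{sq} α_s`, so the edge and the class form a new block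
      -- `α_{sq}`.
      rw [Submodule.mem_comap, LinearMap.comp_apply, LinearMap.mulRight_apply, mul_assoc,
        ← mul_assoc (gen _), ← neg_eq_iff_eq_neg.2 (gg_anticomm_gen s q (Gen.C c q)),
        ← gg_mul_gen hsq, neg_mul, mul_neg, map_neg, cpair_mul_mono]
      refine neg_mem (ih _ hss' _ _ (h.update_two hs hq ?_ ?_ (Gam.places_addCpair t c)) z hz)
      · simp [Gam.places]
      · simp [Gam.places]
    · intro z hz r hr
      obtain ⟨hrq, hrs, hrU⟩ : r ≠ q ∧ r ≠ s ∧ r ∈ U := by simpa using hr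
      rw [Submodule.mem_comap, LinearMap.comp_apply, LinearMap.mulRight_apply]
      -- The edges form the path `r, q, s`. The rest of the product avoids `q` and `s`, although `z`
      -- may still involve `r`, which `symm_mul_gpath` allows for the first point of a path.
      have e : z * gg q r * (gg s q * mono t κ) = (z * mono t κ) * gpath [r, q, s] := by
        have h1 : (gg q r * gg s q : E2 g n) = gpath [r, q, s] := by
          rw [gpath_cons_cons, gpath_cons_cons, gpath_singleton, mul_one, gg_comm q r, gg_comm s q]
        rw [mul_assoc, ← mul_assoc (gg q r), (gg_mul_gg_commute q r s q _).eq, h1, mul_assoc]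
      rw [e, symm_mul_gpath n [q, s] r (by simp) (by simp [hrq, hrs, hsq.symm]) (by simp)]
      · exact zero_mem _
      · refine mul_mem (sub_mono ?_ hz) (mono_mem_sub fun p hp => ?_)
        · intro i; simp; tauto
        · have h1 : κ p ≠ q := fun e => h.2 p hp (e ▸ hqU)
          have h2 : κ p ≠ s := fun e => h.2 p hp (e ▸ hs)
          simp [h1, h2]

theorem Gam.places_zero {g : ℕ} : (⟨0, ∅, ∅, 0, 0⟩ : Gam g).places = ∅ := by
  ext p
  rcases p with b | (b | b) | ⟨b | b, k, l⟩ <;> simp [places, has, mult]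

theorem mono_zero {g n : ℕ} (κ : Place g → Fin n) : (mono ⟨0, ∅, ∅, 0, 0⟩ κ : E2 g n) = 1 := by
  simp [mono, pairPart, clsPart, cpairPart]

theorem symm_mem_monoSpan {g n : ℕ} (hn : 1 ≤ n) (z : E2 g n) : symm g n z ∈ monoSpan g n := by
  have h := symm_mul_mono_mem Finset.univ ⟨0, ∅, ∅, 0, 0⟩ (fun _ => ⟨0, hn⟩)
    ⟨by simp [Gam.places_zero], by simp [Gam.places_zero]⟩ z (by rw [sub_univ]; trivial)
  rwa [mono_zero, mul_one] at h

/-! ### Evaluation on a matching of the points with labelled blocks -/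

/-- Tokens attached to the blocks of a matching: `inl j` stands for the edge of the block
represented by `j` and `inr j` for its class. -/
abbrev Tok (n : ℕ) : Type := Fin n ⊕ Fin n

/-- The exterior algebra on the tokens. -/
abbrev TokAlg (n : ℕ) : Type := ExteriorAlgebra ℚ (Tok n →₀ ℚ)

/-- A token as an element of the exterior algebra. -/
def tk {n : ℕ} (x : Tok n) : TokAlg n := ExteriorAlgebra.ι ℚ (Finsupp.single x 1)

theorem tk_sq {n : ℕ} (x : Tok n) : tk x * tk x = 0 := ExteriorAlgebra.ι_sq_zero _

theorem tk_anticomm {n : ℕ} (x y : Tok n) : tk x * tk y = -(tk y * tk x) :=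
  eq_neg_of_add_eq_zero_left (ExteriorAlgebra.ι_add_mul_swap _ _)

/-- A matching of the points, given by representatives of the blocks, with blocks labelled by
basis classes. -/
structure Marking (g n : ℕ) where
  rep : Fin n → Fin n
  lab : Fin n → Option (Fin g ⊕ Fin g)
  two : ∀ i j k, i ≠ j → j ≠ k → k ≠ i → rep i = rep j → rep j ≠ rep k

namespace Marking

variable {g n : ℕ} (M : Marking g n)

/-- The image of a generator in the span of the tokens. -/
def vec : Gen g n → (Tok n →₀ ℚ)
  | .G e => Sym2.lift ⟨fun i j => if M.rep i = M.rep j then Finsupp.single (.inl (M.rep i)) 1 else 0,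
      fun i j => by
        by_cases h : M.rep i = M.rep j
        · simp [h]
        · simp [h, Ne.symm h]⟩ e.1
  | .C c i => if M.lab (M.rep i) = some c then Finsupp.single (.inr (M.rep i)) 1 else 0

/-- The evaluation of the free algebra. -/
def fEval : Free g n →ₐ[ℚ] TokAlg n := ExteriorAlgebra.map (Finsupp.linearCombination ℚ M.vec)

theorem fEval_fgen (s : Gen g n) : M.fEval (fgen s) = ExteriorAlgebra.ι ℚ (M.vec s) := by
  simp [fEval, fgen]

theorem fEval_fG {i j : Fin n} (h : i ≠ j) :
    M.fEval (fG i j) = if M.rep i = M.rep j then tk (.inl (M.rep i)) else 0 := by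
  rw [fG, dif_neg h, fEval_fgen]
  change ExteriorAlgebra.ι ℚ (if M.rep i = M.rep j then _ else _) = _
  split_ifs <;> simp [tk]

theorem fEval_gen_C (c : Fin g ⊕ Fin g) (i : Fin n) :
    M.fEval (fgen (Gen.C c i)) =
      if M.lab (M.rep i) = some c then tk (.inr (M.rep i)) else 0 := by
  rw [fEval_fgen]
  change ExteriorAlgebra.ι ℚ (if M.lab (M.rep i) = some c then _ else _) = _
  split_ifs <;> simp [tk]

theorem fEval_fcls (α : H1 g) (i : Fin n) :
    M.fEval (fcls α i) =
      ((M.lab (M.rep i)).elim 0 fun c => α c • tk (.inr (M.rep i)) : TokAlg n) := by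
  rw [fcls, map_sum]
  simp only [map_smul, fEval_gen_C]
  cases h : M.lab (M.rep i) with
  | none => simp
  | some c => simp [Finset.sum_ite_eq]

/-- Two edges of a triangle inside blocks would put three points in one block, so each Arnold term
dies separately. Points in the same block share a label and a class token, which gives the diagonal
relation. All classes at a point go to multiples of one odd token, so their products vanish. -/
theorem fEval_rel {a b : Free g n} (h : Rel g n a b) : M.fEval a = M.fEval b := by
  cases h with
  | arnold i j k hij hjk hki =>
    have h1 := M.two i j k hij hjk hki
    have h2 := M.two j k i hjk hki hij
    have h3 := M.two k i j hki hij hjk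
    simp only [map_add, map_mul, map_zero, fEval_fG _ hij, fEval_fG _ hjk, fEval_fG _ hki]
    have key : ∀ (p q : Prop) [Decidable p] [Decidable q] (x y : TokAlg n), (p → ¬q) →
        (if p then x else 0) * (if q then y else 0) = 0 := by
      intro p q _ _ x y h
      by_cases hp : p
      · rw [if_neg (h hp), mul_zero]
      · rw [if_neg hp, zero_mul]
    rw [key _ _ _ _ h1, key _ _ _ _ h2, key _ _ _ _ h3]
    simp
  | diag i j hij α =>
    rw [map_mul, map_mul, fEval_fG _ hij, fEval_fcls, fEval_fcls]
    split_ifs with h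
    · rw [h]
    · simp
  | cup i α β =>
    rw [map_mul, map_zero, fEval_fcls, fEval_fcls]
    cases M.lab (M.rep i) with
    | none => simp
    | some c => simp [tk_sq]

/-- The evaluation of the `E₂` page at a marking. -/
def eval : E2 g n →ₐ[ℚ] TokAlg n :=
  RingQuot.liftAlgHom ℚ ⟨M.fEval, fun _ _ h => M.fEval_rel h⟩

theorem eval_proj (z : Free g n) : M.eval (proj g n z) = M.fEval z :=
  RingQuot.liftAlgHom_mkAlgHom_apply ℚ _ _ _

theorem eval_gg {i j : Fin n} (h : i ≠ j) :
    M.eval (gg i j) = if M.rep i = M.rep j then tk (.inl (M.rep i)) else 0 := by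
  rw [gg, eval_proj, fEval_fG _ h]

theorem eval_gen_C (c : Fin g ⊕ Fin g) (i : Fin n) :
    M.eval (gen (Gen.C c i)) = if M.lab (M.rep i) = some c then tk (.inr (M.rep i)) else 0 := by
  rw [gen, eval_proj, fEval_gen_C]

/-- The degree of a token. -/
def tokDeg : Tok n → Deg
  | .inl _ => (0, 1, 1, 1)
  | .inr j => match M.lab j with
    | some (.inl _) => (1, 0, 1, 0)
    | some (.inr _) => (1, 0, 0, 1)
    -- Evaluating a generator never produces the class token of an unlabelled block, so this value
    -- is immaterial.
    | none => 0

theorem eval_gen (s : Gen g n) : M.eval (gen s) = 0 ∨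
    ∃ x, M.eval (gen s) = tk x ∧ M.tokDeg x = s.deg := by
  rcases s with ⟨⟨⟨i, j⟩, h⟩⟩ | ⟨c, i⟩
  · have hij : i ≠ j := fun e => h (Sym2.mk_isDiag_iff.2 e)
    have e := M.eval_gg hij
    rw [gg_of_ne hij] at e
    by_cases hr : M.rep i = M.rep j
    · rw [if_pos hr] at e
      exact Or.inr ⟨_, e, rfl⟩
    · rw [if_neg hr] at e
      exact Or.inl e
  · by_cases hl : M.lab (M.rep i) = some c
    · refine Or.inr ⟨_, by rw [eval_gen_C, if_pos hl], ?_⟩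
      cases c <;> simp [tokDeg, hl, Gen.deg]
    · exact Or.inl (by rw [eval_gen_C, if_neg hl])

end Marking

/-! ### Coefficients in the exterior algebra -/

/-- The product of a list of tokens. -/
def tokProd {n : ℕ} (l : List (Tok n)) : TokAlg n := (l.map tk).prod

theorem tokProd_append {n : ℕ} (l l' : List (Tok n)) :
    tokProd (l ++ l') = tokProd l * tokProd l' := by
  simp [tokProd]

/-- The functional that takes the coefficient of the product of the tokens in `l₀`. -/
def coef {n : ℕ} (l₀ : List (Tok n)) : TokAlg n →ₗ[ℚ] ℚ :=
  ExteriorAlgebra.liftAlternating (Pi.single l₀.length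
    ((Matrix.detRowAlternating (n := Fin l₀.length) (R := ℚ)).compLinearMap
      (LinearMap.pi fun j => Finsupp.lapply (l₀.get j))))

theorem tokProd_eq_ιMulti {n : ℕ} (l : List (Tok n)) :
    tokProd l = ExteriorAlgebra.ιMulti ℚ l.length (fun i => Finsupp.single (l.get i) (1 : ℚ)) := by
  rw [ExteriorAlgebra.ιMulti_apply, tokProd]
  congr 1
  conv_lhs => rw [← List.ofFn_get l, List.map_ofFn]
  rfl

theorem coef_tokProd {n : ℕ} (l₀ l : List (Tok n)) (h : l.length = l₀.length) :
    coef l₀ (tokProd l) = Matrix.det (Matrix.of fun i j : Fin l₀.length =>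
      if l.get (i.cast h.symm) = l₀.get j then (1 : ℚ) else 0) := by
  have key : ∀ (k : ℕ) (hk : k = l₀.length) (w : Fin k → Tok n),
      coef l₀ (ExteriorAlgebra.ιMulti ℚ k fun i => Finsupp.single (w i) (1 : ℚ)) =
        Matrix.det (Matrix.of fun i j : Fin l₀.length =>
          if w (i.cast hk.symm) = l₀.get j then (1 : ℚ) else 0) := by
    rintro k rfl w
    rw [coef, ExteriorAlgebra.liftAlternating_apply_ιMulti, Pi.single_eq_same,
      AlternatingMap.compLinearMap_apply]
    change Matrix.det _ = _
    congr 1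
    ext i j
    simp [Finsupp.single_apply]
  rw [tokProd_eq_ιMulti, key _ h]

theorem coef_tokProd_of_length_ne {n : ℕ} (l₀ l : List (Tok n)) (h : l.length ≠ l₀.length) :
    coef l₀ (tokProd l) = 0 := by
  rw [tokProd_eq_ιMulti, coef, ExteriorAlgebra.liftAlternating_apply_ιMulti, Pi.single_eq_of_ne h,
    AlternatingMap.zero_apply]

theorem coef_tokProd_self {n : ℕ} {l₀ : List (Tok n)} (h : l₀.Nodup) :
    coef l₀ (tokProd l₀) = 1 := by
  rw [coef_tokProd l₀ l₀ rfl, ← Matrix.det_one (n := Fin l₀.length)]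
  congr 1
  ext i j
  simp [Matrix.one_apply, h.getElem_inj_iff, Fin.ext_iff]

/-- If some token of `l₀` is missing from `l`, the determinant has a zero column. As `l₀` has no
repetitions, equal lengths then force a rearrangement. -/
theorem perm_of_coef_ne_zero {n : ℕ} {l₀ l : List (Tok n)} (h₀ : l₀.Nodup)
    (h : coef l₀ (tokProd l) ≠ 0) : l₀.Perm l := by
  have hlen : l.length = l₀.length := by
    by_contra hne
    exact h (coef_tokProd_of_length_ne _ _ hne)
  refine (h₀.subperm fun x hx => ?_).perm_of_length_le hlen.le
  by_contra hxl
  refine h ?_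
  obtain ⟨j, rfl⟩ := List.get_of_mem hx
  rw [coef_tokProd l₀ l hlen]
  refine Matrix.det_eq_zero_of_column_eq_zero j fun i => ?_
  rw [Matrix.of_apply, if_neg]
  intro e
  exact hxl (e ▸ List.get_mem _ _)

/-- A monomial in the generators evaluates to zero or to a product of tokens of the same total
degree. A nonzero coefficient would make those tokens a rearrangement of `l₀`, hence of the wrong
degree. -/
theorem coef_eval_eq_zero {g n : ℕ} (M : Marking g n) {l₀ : List (Tok n)} (h₀ : l₀.Nodup)
    {m : Deg} (hm : (l₀.map M.tokDeg).sum ≠ m) {z : E2 g n} (hz : z ∈ E2piece g n m) :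
    coef l₀ (M.eval z) = 0 := by
  have hle : E2piece g n m ≤ LinearMap.ker ((coef l₀).comp M.eval.toLinearMap) := by
    refine Submodule.span_le.2 ?_
    rintro _ ⟨l, hl, rfl⟩
    have key : M.eval (l.map gen).prod = 0 ∨ ∃ l', M.eval (l.map gen).prod = tokProd l' ∧
        (l'.map M.tokDeg).sum = (l.map Gen.deg).sum := by
      clear hl
      induction l with
      | nil => exact Or.inr ⟨[], by simp [tokProd], rfl⟩
      | cons s l ih =>
        rw [List.map_cons, List.prod_cons, map_mul]
        rcases M.eval_gen s with h | ⟨x, h, hx⟩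
        · exact Or.inl (by rw [h, zero_mul])
        · rcases ih with h' | ⟨l', h', hl'⟩
          · exact Or.inl (by rw [h', mul_zero])
          · exact Or.inr ⟨x :: l', by rw [h, h']; rfl, by simp [hx, hl']⟩
    change coef l₀ (M.eval (l.map gen).prod) = 0
    rcases key with h | ⟨l', h, hl'⟩
    · rw [h, map_zero]
    · rw [h]
      by_contra hne
      refine hm ?_
      rw [((perm_of_coef_ne_zero h₀ hne).map M.tokDeg).sum_eq, hl', hl]
  exact hle hz

/-! ### The marking of a filled tuple -/

/-- The place of the first point of a block. -/
def Place.head {g : ℕ} : Place g → Place g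
  | .pair _ => .pair 0
  | .cls c => .cls c
  | .cpair c k _ => .cpair c k 0

/-- The class that labels the block of a place. -/
def Place.label {g : ℕ} : Place g → Option (Fin g ⊕ Fin g)
  | .pair _ => none
  | .cls c => some c
  | .cpair c _ _ => some c

theorem Place.head_mem {g : ℕ} {t : Gam g} {p : Place g} (hp : p ∈ t.places) :
    p.head ∈ t.places := by
  cases p <;> exact hp

theorem Place.label_head {g : ℕ} (p : Place g) : p.head.label = p.label := by
  cases p <;> rfl

/-- Places of one block differ at most in an index in `Fin 2`, so three of them cannot be distinct.
This supplies the field `Marking.two`. -/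
theorem Place.eq_of_head_eq {g : ℕ} {p q r : Place g} (h1 : p.head = q.head)
    (h2 : q.head = r.head) : p = q ∨ q = r ∨ r = p := by
  have hb : ∀ a b c : Fin 2, a = b ∨ b = c ∨ c = a := by decide
  rcases p with b | b | ⟨b, k, l⟩ <;> rcases q with b' | b' | ⟨b', k', l'⟩ <;>
    rcases r with b'' | b'' | ⟨b'', k'', l''⟩ <;> simp only [Place.head, reduceCtorEq] at h1 h2
  · simpa using hb b b' b''
  · exact Or.inl h1
  · obtain ⟨rfl, rfl, -⟩ := Place.cpair.inj h1
    obtain ⟨rfl, rfl, -⟩ := Place.cpair.inj h2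
    simpa using hb l l' l''

section Marking

variable {g n : ℕ} {t : Gam g} {κ : Place g → Fin n}

open Classical in
/-- The representative of the block of a point. -/
def repOf (t : Gam g) (κ : Place g → Fin n) (i : Fin n) : Fin n :=
  -- A point that fills no place forms a block by itself; `labOf` gives it no label.
  if h : ∃ p ∈ t.places, κ p = i then κ h.choose.head else i

open Classical in
/-- The label of the block of a point. -/
def labOf (t : Gam g) (κ : Place g → Fin n) (i : Fin n) : Option (Fin g ⊕ Fin g) :=
  if h : ∃ p ∈ t.places, κ p = i then h.choose.label else none

theorem repOf_apply (hκ : Set.InjOn κ t.places) {p : Place g} (hp : p ∈ t.places) :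
    repOf t κ (κ p) = κ p.head := by
  have h : ∃ q ∈ t.places, κ q = κ p := ⟨p, hp, rfl⟩
  rw [repOf, dif_pos h, hκ h.choose_spec.1 hp h.choose_spec.2]

theorem labOf_apply (hκ : Set.InjOn κ t.places) {p : Place g} (hp : p ∈ t.places) :
    labOf t κ (κ p) = p.label := by
  have h : ∃ q ∈ t.places, κ q = κ p := ⟨p, hp, rfl⟩
  rw [labOf, dif_pos h, hκ h.choose_spec.1 hp h.choose_spec.2]

theorem repOf_of_forall_ne {i : Fin n} (h : ∀ p ∈ t.places, κ p ≠ i) : repOf t κ i = i := by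
  rw [repOf, dif_neg]
  rintro ⟨p, hp, e⟩
  exact h p hp e

/-- The representative of a filled point is a filled point, and an unfilled point represents itself.
Distinct points can therefore share a representative only when both fill places with the same head.
-/
theorem exists_places_of_repOf_eq (hκ : Set.InjOn κ t.places) {i j : Fin n} (hij : i ≠ j)
    (h : repOf t κ i = repOf t κ j) : ∃ p ∈ t.places, ∃ q ∈ t.places, κ p = i ∧ κ q = j ∧
      p.head = q.head := by
  by_cases hi : ∃ p ∈ t.places, κ p = i
  · obtain ⟨p, hp, rfl⟩ := hi
    rw [repOf_apply hκ hp] at h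
    by_cases hj : ∃ q ∈ t.places, κ q = j
    · obtain ⟨q, hq, rfl⟩ := hj
      rw [repOf_apply hκ hq] at h
      exact ⟨p, hp, q, hq, rfl, rfl, hκ (Place.head_mem hp) (Place.head_mem hq) h⟩
    · push Not at hj
      rw [repOf_of_forall_ne hj] at h
      exact absurd h (hj _ (Place.head_mem hp))
  · push Not at hi
    rw [repOf_of_forall_ne hi] at h
    by_cases hj : ∃ q ∈ t.places, κ q = j
    · obtain ⟨q, hq, rfl⟩ := hj
      rw [repOf_apply hκ hq] at h
      exact absurd h.symm (hi _ (Place.head_mem hq))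
    · push Not at hj
      rw [repOf_of_forall_ne hj] at h
      exact absurd h hij

/-- The marking in which the blocks are those of the monomial of `t` filled according to `κ`. -/
def marking (t : Gam g) (κ : Place g → Fin n) (hκ : Set.InjOn κ t.places) : Marking g n where
  rep := repOf t κ
  lab := labOf t κ
  two i j k hij hjk hki h1 h2 := by
    obtain ⟨p, hp, q, hq, rfl, rfl, e1⟩ := exists_places_of_repOf_eq hκ hij h1
    obtain ⟨q', hq', r, hr, e, rfl, e2⟩ := exists_places_of_repOf_eq hκ hjk h2
    obtain rfl := hκ hq' hq e
    rcases Place.eq_of_head_eq e1 e2 with rfl | rfl | rfl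
    · exact hij rfl
    · exact hjk rfl
    · exact hki rfl

theorem lab_rep_apply (hκ : Set.InjOn κ t.places) {p : Place g} (hp : p ∈ t.places) :
    (marking t κ hκ).lab ((marking t κ hκ).rep (κ p)) = p.label := by
  change labOf t κ (repOf t κ (κ p)) = _
  rw [repOf_apply hκ hp, labOf_apply hκ (Place.head_mem hp), Place.label_head]

/-- A block with a label is the block of a place. -/
theorem exists_place_of_lab (hκ : Set.InjOn κ t.places) {i : Fin n} {c : Fin g ⊕ Fin g}
    (h : (marking t κ hκ).lab ((marking t κ hκ).rep i) = some c) :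
    (t.has c ∧ (marking t κ hκ).rep i = κ (.cls c)) ∨
      ∃ k < t.mult c, (marking t κ hκ).rep i = κ (.cpair c k 0) := by
  by_cases hi : ∃ p ∈ t.places, κ p = i
  · obtain ⟨p, hp, rfl⟩ := hi
    rw [lab_rep_apply hκ hp] at h
    have e : (marking t κ hκ).rep (κ p) = κ p.head := repOf_apply hκ hp
    rw [e]
    rcases p with b | b | ⟨b, k, l⟩ <;> simp only [Place.label, Option.some.injEq,
      reduceCtorEq] at h
    · subst h
      exact Or.inl ⟨hp, rfl⟩
    · subst h
      exact Or.inr ⟨k, hp, rfl⟩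
  · have h' := hi
    push Not at hi
    change labOf t κ (repOf t κ i) = _ at h
    rw [repOf_of_forall_ne hi, labOf, dif_neg h'] at h
    cases h

/-- A block with two points is the block of a place with two points. -/
theorem exists_place_of_rep_eq (hκ : Set.InjOn κ t.places) {i j : Fin n} (hij : i ≠ j)
    (h : (marking t κ hκ).rep i = (marking t κ hκ).rep j) :
    (t.rho = 1 ∧ (marking t κ hκ).rep i = κ (.pair 0)) ∨
      ∃ c, ∃ k < t.mult c, (marking t κ hκ).rep i = κ (.cpair c k 0) := by
  obtain ⟨p, hp, q, hq, rfl, rfl, e1⟩ := exists_places_of_repOf_eq hκ hij h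
  have e : (marking t κ hκ).rep (κ p) = κ p.head := repOf_apply hκ hp
  rw [e]
  rcases p with b | b | ⟨b, k, l⟩
  · exact Or.inl ⟨hp, rfl⟩
  · rcases q with b' | b' | ⟨b', k', l'⟩ <;> simp only [Place.head, reduceCtorEq] at e1
    exact absurd (congrArg κ e1) hij
  · exact Or.inr ⟨b, k, hp, rfl⟩

end Marking

/-! ### The tokens of a tuple -/

/-- The list of the token places of a tuple, in the order of the factors of the monomial. -/
def placeList {g : ℕ} (t : Gam g) : List (Place g ⊕ Place g) :=
  (if t.rho = 1 then [.inl (.pair 0)] else []) ++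
  ((List.finRange g).flatMap fun a => if a ∈ t.S then [.inr (.cls (.inl a))] else []) ++
  ((List.finRange g).flatMap fun a => if a ∈ t.T then [.inr (.cls (.inr a))] else []) ++
  ((List.finRange g).flatMap fun a => (List.range (t.u a)).flatMap fun k =>
    [.inl (.cpair (.inl a) k 0), .inr (.cpair (.inl a) k 0)]) ++
  ((List.finRange g).flatMap fun a => (List.range (t.v a)).flatMap fun k =>
    [.inl (.cpair (.inr a) k 0), .inr (.cpair (.inr a) k 0)])

theorem inl_mem_placeList {g : ℕ} {t : Gam g} {p : Place g} : .inl p ∈ placeList t ↔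
    (t.rho = 1 ∧ p = .pair 0) ∨ ∃ c, ∃ k < t.mult c, p = .cpair c k 0 := by
  simp only [placeList, List.mem_append, List.mem_flatMap, List.mem_finRange, true_and,
    List.mem_range, Sum.exists, Gam.mult, Sum.elim_inl, Sum.elim_inr]
  have h1 : ∀ (P : Prop) [Decidable P] (x : Place g ⊕ Place g) (y : Place g ⊕ Place g),
      x ∈ (if P then [y] else []) ↔ P ∧ x = y := by
    intro P _ x y
    split_ifs with h <;> simp [h]
  simp only [h1]
  simp [or_assoc]

theorem inr_mem_placeList {g : ℕ} {t : Gam g} {p : Place g} : .inr p ∈ placeList t ↔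
    (∃ c, t.has c ∧ p = .cls c) ∨ ∃ c, ∃ k < t.mult c, p = .cpair c k 0 := by
  simp only [placeList, List.mem_append, List.mem_flatMap, List.mem_finRange, true_and,
    List.mem_range, Sum.exists, Gam.mult, Gam.has, Sum.elim_inl, Sum.elim_inr]
  have h1 : ∀ (P : Prop) [Decidable P] (x : Place g ⊕ Place g) (y : Place g ⊕ Place g),
      x ∈ (if P then [y] else []) ↔ P ∧ x = y := by
    intro P _ x y
    split_ifs with h <;> simp [h]
  simp only [h1]
  simp [or_assoc]

theorem nodup_placeList {g : ℕ} (t : Gam g) : (placeList t).Nodup := by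
  have h1 : ∀ (e : Fin g → Fin g ⊕ Fin g) (_ : Function.Injective e) (S : Finset (Fin g)),
      ((List.finRange g).flatMap fun a =>
        if a ∈ S then [(.inr (.cls (e a)) : Place g ⊕ Place g)] else []).Nodup := by
    intro e he S
    refine List.nodup_flatMap.2 ⟨fun a _ => by split_ifs <;> simp, ?_⟩
    refine (List.nodup_finRange g).imp fun {a b} hab => ?_
    simp only [Function.onFun]
    split_ifs <;> simp [(he.ne hab).symm]
  have h2 : ∀ (e : Fin g → Fin g ⊕ Fin g) (_ : Function.Injective e) (u : Fin g → ℕ),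
      ((List.finRange g).flatMap fun a => (List.range (u a)).flatMap fun k =>
        [(.inl (.cpair (e a) k 0) : Place g ⊕ Place g), .inr (.cpair (e a) k 0)]).Nodup := by
    intro e he u
    refine List.nodup_flatMap.2 ⟨fun a _ => ?_, ?_⟩
    · refine List.nodup_flatMap.2 ⟨fun k _ => by simp, ?_⟩
      refine List.nodup_range.imp fun {a b} hab => ?_
      simp [Function.onFun, Ne.symm hab]
    · refine (List.nodup_finRange g).imp fun {a b} hab => ?_
      simp only [Function.onFun, List.disjoint_left, List.mem_flatMap]
      rintro x ⟨k, -, hk⟩ ⟨l, -, hl⟩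
      simp at hk hl
      rcases hk with rfl | rfl <;> simp [he.ne hab] at hl
  rw [placeList, List.nodup_append, List.nodup_append, List.nodup_append, List.nodup_append]
  refine ⟨⟨⟨⟨by split_ifs <;> simp, h1 _ Sum.inl_injective _, ?_⟩, h1 _ Sum.inr_injective _, ?_⟩,
    h2 _ Sum.inl_injective _, ?_⟩, h2 _ Sum.inr_injective _, ?_⟩ <;>
  · intro x hx y hy
    simp only [List.mem_append, List.mem_flatMap] at hx hy
    rintro rfl
    split_ifs at hx <;> simp at hx hy <;> grind

theorem placeList_mem_places {g : ℕ} {t : Gam g} {x : Place g ⊕ Place g} (hx : x ∈ placeList t) :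
    x.elim id id ∈ t.places := by
  rcases x with p | p
  · rcases inl_mem_placeList.1 hx with ⟨h, rfl⟩ | ⟨c, k, hk, rfl⟩
    · exact h
    · exact hk
  · rcases inr_mem_placeList.1 hx with ⟨c, h, rfl⟩ | ⟨c, k, hk, rfl⟩
    · exact h
    · exact hk

/-- The list of tokens of a tuple, with places filled by blocks according to `f`. -/
def tokList {g n : ℕ} (t : Gam g) (f : Place g → Fin n) : List (Tok n) :=
  (placeList t).map (Sum.map f f)

theorem nodup_tokList {g n : ℕ} {t : Gam g} {κ : Place g → Fin n} (hκ : Set.InjOn κ t.places) :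
    (tokList t κ).Nodup := by
  refine List.Nodup.map_on (fun x hx y hy h => ?_) (nodup_placeList t)
  have h1 := placeList_mem_places hx
  have h2 := placeList_mem_places hy
  rcases x with p | p <;> rcases y with q | q <;> simp at h h1 h2
  · rw [hκ h1 h2 h]
  · rw [hκ h1 h2 h]

theorem inl_mem_tokList {g n : ℕ} {t : Gam g} {f : Place g → Fin n} {j : Fin n} :
    .inl j ∈ tokList t f ↔
      (t.rho = 1 ∧ f (.pair 0) = j) ∨ ∃ c, ∃ k < t.mult c, f (.cpair c k 0) = j := by
  rw [tokList, List.mem_map]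
  constructor
  · rintro ⟨x | x, hx, h⟩
    · simp only [Sum.map_inl, Sum.inl.injEq] at h
      subst h
      rcases inl_mem_placeList.1 hx with ⟨h, rfl⟩ | ⟨c, k, hk, rfl⟩
      · exact Or.inl ⟨h, rfl⟩
      · exact Or.inr ⟨c, k, hk, rfl⟩
    · simp at h
  · rintro (⟨h, rfl⟩ | ⟨c, k, hk, rfl⟩)
    · exact ⟨_, inl_mem_placeList.2 (Or.inl ⟨h, rfl⟩), rfl⟩
    · exact ⟨_, inl_mem_placeList.2 (Or.inr ⟨c, k, hk, rfl⟩), rfl⟩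

theorem inr_mem_tokList {g n : ℕ} {t : Gam g} {f : Place g → Fin n} {j : Fin n} :
    .inr j ∈ tokList t f ↔
      (∃ c, t.has c ∧ f (.cls c) = j) ∨ ∃ c, ∃ k < t.mult c, f (.cpair c k 0) = j := by
  rw [tokList, List.mem_map]
  constructor
  · rintro ⟨x | x, hx, h⟩
    · simp at h
    · simp only [Sum.map_inr, Sum.inr.injEq] at h
      subst h
      rcases inr_mem_placeList.1 hx with ⟨c, h, rfl⟩ | ⟨c, k, hk, rfl⟩
      · exact Or.inl ⟨c, h, rfl⟩
      · exact Or.inr ⟨c, k, hk, rfl⟩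
  · rintro (⟨c, h, rfl⟩ | ⟨c, k, hk, rfl⟩)
    · exact ⟨_, inr_mem_placeList.2 (Or.inl ⟨c, h, rfl⟩), rfl⟩
    · exact ⟨_, inr_mem_placeList.2 (Or.inr ⟨c, k, hk, rfl⟩), rfl⟩

theorem tokProd_map_flatMap {α β : Type*} {n : ℕ} (l : List α) (F : α → List β) (h : β → Tok n) :
    tokProd ((l.flatMap F).map h) = (l.map fun a => tokProd ((F a).map h)).prod := by
  induction l with
  | nil => simp [tokProd]
  | cons a l ih => rw [List.flatMap_cons, List.map_append, tokProd_append, ih]; simp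

theorem tokProd_tokList {g n : ℕ} (t : Gam g) (f : Place g → Fin n) : tokProd (tokList t f) =
    (if t.rho = 1 then tk (.inl (f (.pair 0))) else 1) *
    ((List.finRange g).map fun a => if a ∈ t.S then tk (.inr (f (.cls (.inl a)))) else 1).prod *
    ((List.finRange g).map fun a => if a ∈ t.T then tk (.inr (f (.cls (.inr a)))) else 1).prod *
    ((List.finRange g).map fun a => ((List.range (t.u a)).map fun k =>
      tk (.inl (f (.cpair (.inl a) k 0))) * tk (.inr (f (.cpair (.inl a) k 0)))).prod).prod *
    ((List.finRange g).map fun a => ((List.range (t.v a)).map fun k =>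
      tk (.inl (f (.cpair (.inr a) k 0))) * tk (.inr (f (.cpair (.inr a) k 0)))).prod).prod := by
  have h1 : ∀ (P : Prop) [Decidable P] (x : Place g ⊕ Place g),
      tokProd ((if P then [x] else []).map (Sum.map f f)) =
        if P then tk (Sum.map f f x) else 1 := by
    intro P _ x
    split_ifs <;> simp [tokProd]
  have h2 : ∀ x y : Place g ⊕ Place g, tokProd ([x, y].map (Sum.map f f)) =
      tk (Sum.map f f x) * tk (Sum.map f f y) := by
    intro x y
    simp [tokProd]
  simp only [tokList, placeList, List.map_append, tokProd_append, tokProd_map_flatMap, h1, h2,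
    Sum.map_inl, Sum.map_inr]

/-! ### Evaluation of monomials at markings -/

section Eval

variable {g n : ℕ}

/-- The blocks of a filled tuple are blocks of the marking, with the same classes. -/
def Fits (M : Marking g n) (t : Gam g) (κ : Place g → Fin n) : Prop :=
  (t.rho = 1 → M.rep (κ (.pair 0)) = M.rep (κ (.pair 1))) ∧
  (∀ c, t.has c → M.lab (M.rep (κ (.cls c))) = some c) ∧
  ∀ c, ∀ k < t.mult c, M.rep (κ (.cpair c k 0)) = M.rep (κ (.cpair c k 1)) ∧
    M.lab (M.rep (κ (.cpair c k 0))) = some c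

theorem pair_ne {t : Gam g} {κ : Place g → Fin n} (hκ : Set.InjOn κ t.places) (h : t.rho = 1) :
    κ (.pair 0) ≠ κ (.pair 1) := by
  intro e
  have := hκ (show Place.pair 0 ∈ t.places from h) (show Place.pair 1 ∈ t.places from h) e
  simp at this

theorem cpair_ne {t : Gam g} {κ : Place g → Fin n} (hκ : Set.InjOn κ t.places)
    {c : Fin g ⊕ Fin g} {k : ℕ} (h : k < t.mult c) : κ (.cpair c k 0) ≠ κ (.cpair c k 1) := by
  intro e
  have := hκ (show Place.cpair c k 0 ∈ t.places from h) (show Place.cpair c k 1 ∈ t.places from h) e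
  simp at this

theorem eval_cpairFactor (M : Marking g n) {t : Gam g} {κ : Place g → Fin n}
    (hκ : Set.InjOn κ t.places) {c : Fin g ⊕ Fin g} {k : ℕ} (hk : k < t.mult c) :
    M.eval (cpairFactor c k κ) =
      (if M.rep (κ (.cpair c k 0)) = M.rep (κ (.cpair c k 1)) then
        tk (.inl (M.rep (κ (.cpair c k 0)))) else 0) *
      (if M.lab (M.rep (κ (.cpair c k 0))) = some c then
        tk (.inr (M.rep (κ (.cpair c k 0)))) else 0) := by
  rw [cpairFactor, map_mul, M.eval_gg (cpair_ne hκ hk), M.eval_gen_C]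

theorem eval_mono (M : Marking g n) {t : Gam g} {κ : Place g → Fin n}
    (hκ : Set.InjOn κ t.places) (h : Fits M t κ) :
    M.eval (mono t κ) = tokProd (tokList t (M.rep ∘ κ)) := by
  obtain ⟨h1, h2, h3⟩ := h
  have e1 : M.eval (pairPart t.rho κ) =
      if t.rho = 1 then tk (.inl (M.rep (κ (.pair 0)))) else 1 := by
    unfold pairPart
    split_ifs with h
    · rw [M.eval_gg (pair_ne hκ h), if_pos (h1 h)]
    · simp
  have e2 : ∀ (e : Fin g → Fin g ⊕ Fin g) (S : Finset (Fin g)), (∀ a ∈ S, t.has (e a)) →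
      M.eval (clsPart e S κ) = ((List.finRange g).map fun a =>
        if a ∈ S then tk (.inr (M.rep (κ (.cls (e a))))) else 1).prod := by
    intro e S hS
    rw [clsPart, map_list_prod, List.map_map]
    refine congrArg List.prod (List.map_congr_left fun a _ => ?_)
    rw [Function.comp_apply]
    split_ifs with ha
    · rw [M.eval_gen_C, if_pos (h2 _ (hS a ha))]
    · simp
  have e3 : ∀ (e : Fin g → Fin g ⊕ Fin g) (u : Fin g → ℕ), (∀ a, u a = t.mult (e a)) →
      M.eval (cpairPart e u κ) = ((List.finRange g).map fun a => ((List.range (u a)).map fun k =>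
        tk (.inl (M.rep (κ (.cpair (e a) k 0)))) *
          tk (.inr (M.rep (κ (.cpair (e a) k 0))))).prod).prod := by
    intro e u hu
    rw [cpairPart, map_list_prod, List.map_map]
    refine congrArg List.prod (List.map_congr_left fun a _ => ?_)
    rw [Function.comp_apply, map_list_prod, List.map_map]
    refine congrArg List.prod (List.map_congr_left fun k hk => ?_)
    have hk : k < t.mult (e a) := hu a ▸ List.mem_range.1 hk
    rw [Function.comp_apply, eval_cpairFactor M hκ hk, if_pos (h3 _ k hk).1, if_pos (h3 _ k hk).2]
  rw [mono, map_mul, map_mul, map_mul, map_mul, e1, e2 Sum.inl t.S fun a ha => ha,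
    e2 Sum.inr t.T fun a ha => ha, e3 Sum.inl t.u fun a => rfl, e3 Sum.inr t.v fun a => rfl,
    tokProd_tokList]
  rfl

/-- The conditions are read off factor by factor: a bare edge, a single class or an `α_{••}` that
does not match the marking evaluates to zero and kills the product. -/
theorem fits_of_eval_ne_zero (M : Marking g n) {t : Gam g} {κ : Place g → Fin n}
    (hκ : Set.InjOn κ t.places) (h : M.eval (mono t κ) ≠ 0) : Fits M t κ := by
  refine ⟨fun hr => ?_, fun c hc => ?_, fun c k hk => ?_⟩
  · by_contra hne
    rw [exists_mono_of_rho hr, map_mul, M.eval_gg (pair_ne hκ hr), if_neg hne, zero_mul] at h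
    exact h rfl
  · by_contra hne
    obtain ⟨ε, e⟩ := exists_mono_of_has (n := n) hc κ
    rw [e, map_smul, map_mul, M.eval_gen_C, if_neg hne, zero_mul, smul_zero] at h
    exact h rfl
  · have key : M.eval (cpairFactor c k κ) ≠ 0 := by
      intro h0
      have hz : ∀ (e : Fin g → Fin g ⊕ Fin g) (u : Fin g → ℕ) (a : Fin g), e a = c → k < u a →
          M.eval (cpairPart e u κ) = 0 := by
        rintro e u a rfl hk
        rw [cpairPart, map_list_prod, List.map_map]
        refine List.prod_eq_zero (List.mem_map.2 ⟨a, List.mem_finRange a, ?_⟩)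
        rw [Function.comp_apply, map_list_prod, List.map_map]
        exact List.prod_eq_zero (List.mem_map.2 ⟨k, List.mem_range.2 hk, h0⟩)
      refine h ?_
      rw [mono, map_mul, map_mul]
      rcases c with a | a
      · rw [hz Sum.inl t.u a rfl hk, mul_zero, zero_mul]
      · rw [hz Sum.inr t.v a rfl hk, mul_zero]
    rw [eval_cpairFactor M hκ hk] at key
    constructor
    · by_contra hne
      rw [if_neg hne, zero_mul] at key
      exact key rfl
    · by_contra hne
      rw [if_neg hne, mul_zero] at key
      exact key rfl

end Eval

section Compare

variable {g n : ℕ} {t t' : Gam g} {κ κ' : Place g → Fin n} {hκ : Set.InjOn κ t.places}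

/-- This bound on block size gives most of the contradictions in `tokens_eq`: tokens in an
unexpected position would require a third point in a block. -/
theorem not_three (hκ' : Set.InjOn κ' t'.places) {p q r : Place g} (hp : p ∈ t'.places)
    (hq : q ∈ t'.places) (hr : r ∈ t'.places) (hpq : p ≠ q) (hqr : q ≠ r) (hrp : r ≠ p)
    (h1 : (marking t κ hκ).rep (κ' p) = (marking t κ hκ).rep (κ' q)) (h2 : (marking t κ hκ).rep (κ' q) = (marking t κ hκ).rep (κ' r)) : False :=
  (marking t κ hκ).two _ _ _ (hκ'.ne hp hq hpq) (hκ'.ne hq hr hqr) (hκ'.ne hr hp hrp) h1 h2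

/-- Two tuples with the same tokens have the same edges and classes in each block. -/
theorem tokens_eq (hκ' : Set.InjOn κ' t'.places) (hf : Fits (marking t κ hκ) t' κ')
    (hp : (tokList t κ).Perm (tokList t' ((marking t κ hκ).rep ∘ κ'))) :
    (t'.rho = 1 ↔ t.rho = 1) ∧ (t.rho = 1 → (marking t κ hκ).rep (κ' (.pair 0)) = κ (.pair 0)) ∧
    (∀ c, t'.has c ↔ t.has c) ∧ (∀ c, t.has c → (marking t κ hκ).rep (κ' (.cls c)) = κ (.cls c)) ∧
    ∀ c, ((List.range (t'.mult c)).map fun k => (marking t κ hκ).rep (κ' (.cpair c k 0))).Perm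
      ((List.range (t.mult c)).map fun k => κ (.cpair c k 0)) := by
  obtain ⟨f1, f2, f3⟩ := hf
  have rep_fix : ∀ p ∈ t.places, p.head = p → (marking t κ hκ).rep (κ p) = κ p := by
    intro p hp hh
    have := repOf_apply hκ hp
    rwa [hh] at this
  have lab_fix : ∀ p ∈ t.places, p.head = p → (marking t κ hκ).lab (κ p) = p.label := by
    intro p hp hh
    rw [← lab_rep_apply hκ hp, rep_fix p hp hh]
  -- a block of `t` with two points carrying a class comes from such a block of `t'`
  have B : ∀ c, ∀ k < t.mult c, ∃ k' < t'.mult c, (marking t κ hκ).rep (κ' (.cpair c k' 0)) = κ (.cpair c k 0) := by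
    intro c k hk
    have hl : (marking t κ hκ).lab (κ (.cpair c k 0)) = some c := lab_fix (.cpair c k 0) hk rfl
    have m1 := hp.mem_iff.1 (inl_mem_tokList.2 (Or.inr ⟨c, k, hk, rfl⟩))
    have m2 := hp.mem_iff.1 (inr_mem_tokList.2 (Or.inr ⟨c, k, hk, rfl⟩))
    -- If the edge token came from the bare edge of `t'`, the class token of the same block would
    -- have to come from a third point. So it comes from some `α_{••}`, whose class is forced by the
    -- label.
    rcases inl_mem_tokList.1 m1 with ⟨hr, e⟩ | ⟨c', k', hk', e⟩
    · exfalso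
      have e' := f1 hr
      rcases inr_mem_tokList.1 m2 with ⟨c', hc', e2⟩ | ⟨c', k', hk', e2⟩
      · exact not_three (hκ := hκ) hκ' (p := .pair 0) (q := .pair 1) (r := .cls c') hr hr hc'
          (by simp) (by simp) (by simp) e' ((e'.symm.trans e).trans e2.symm)
      · exact not_three (hκ := hκ) hκ' (p := .pair 0) (q := .pair 1) (r := .cpair c' k' 0) hr hr hk'
          (by simp) (by simp) (by simp) e' ((e'.symm.trans e).trans e2.symm)
    · have h := (f3 c' k' hk').2
      change (marking t κ hκ).rep (κ' (.cpair c' k' 0)) = _ at e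
      rw [e, hl] at h
      obtain rfl := Option.some.inj h
      exact ⟨k', hk', e⟩
  have hasC : ∀ c, t'.has c → t.has c ∧ (marking t κ hκ).rep (κ' (.cls c)) = κ (.cls c) := by
    intro c hc
    -- The alternative is a two-point block of `t` with label `c`, but by `B` that block is already
    -- filled by two points of `t'`.
    rcases exists_place_of_lab hκ (f2 c hc) with h | ⟨k, hk, e⟩
    · exact h
    · exfalso
      obtain ⟨k', hk', e2⟩ := B c k hk
      exact not_three (hκ := hκ) hκ' (p := .cpair c k' 0) (q := .cpair c k' 1) (r := .cls c) hk' hk'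
        hc (by simp) (by simp) (by simp) (f3 c k' hk').1
        (((f3 c k' hk').1.symm.trans e2).trans e.symm)
  have hasC' : ∀ c, t.has c → t'.has c := by
    intro c hc
    have hl : (marking t κ hκ).lab (κ (.cls c)) = some c := lab_fix (.cls c) hc rfl
    have m := hp.mem_iff.1 (inr_mem_tokList.2 (Or.inl ⟨c, hc, rfl⟩))
    rcases inr_mem_tokList.1 m with ⟨c', hc', e⟩ | ⟨c', k', hk', e⟩
    · have h := f2 c' hc'
      change (marking t κ hκ).rep (κ' (.cls c')) = _ at e
      rw [e, hl] at h
      obtain rfl := Option.some.inj h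
      exact hc'
    · exfalso
      change (marking t κ hκ).rep (κ' (.cpair c' k' 0)) = _ at e
      -- The two points of an `α_{••}` of `t'` lie in a two-point block of `t`, whereas the block at
      -- hand is that of a single class.
      rcases exists_place_of_rep_eq hκ (cpair_ne hκ' hk') (f3 c' k' hk').1 with
        ⟨h0, h⟩ | ⟨c'', k'', hk'', h⟩
      · have := hκ (show Place.cls c ∈ t.places from hc) (show Place.pair 0 ∈ t.places from h0)
          (e.symm.trans h)
        simp at this
      · have := hκ (show Place.cls c ∈ t.places from hc)
          (show Place.cpair c'' k'' 0 ∈ t.places from hk'') (e.symm.trans h)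
        simp at this
  have rho1 : t'.rho = 1 → t.rho = 1 ∧ (marking t κ hκ).rep (κ' (.pair 0)) = κ (.pair 0) := by
    intro hr
    rcases exists_place_of_rep_eq hκ (pair_ne hκ' hr) (f1 hr) with h | ⟨c, k, hk, e⟩
    · exact h
    · exfalso
      obtain ⟨k', hk', e2⟩ := B c k hk
      exact not_three (hκ := hκ) hκ' (p := .cpair c k' 0) (q := .cpair c k' 1) (r := .pair 0) hk' hk'
        hr (by simp) (by simp) (by simp) (f3 c k' hk').1
        (((f3 c k' hk').1.symm.trans e2).trans e.symm)
  have rho2 : t.rho = 1 → t'.rho = 1 := by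
    intro hr
    -- The block of the bare edge of `t` is unlabelled, which excludes the labelled blocks of the
    -- `α_{••}` in `t'` as sources of its edge token.
    have hl : (marking t κ hκ).lab (κ (.pair 0)) = none := lab_fix (.pair 0) hr rfl
    have m := hp.mem_iff.1 (inl_mem_tokList.2 (Or.inl ⟨hr, rfl⟩))
    rcases inl_mem_tokList.1 m with ⟨h, -⟩ | ⟨c', k', hk', e⟩
    · exact h
    · have h := (f3 c' k' hk').2
      change (marking t κ hκ).rep (κ' (.cpair c' k' 0)) = _ at e
      rw [e, hl] at h
      cases h
  refine ⟨⟨fun h => (rho1 h).1, rho2⟩, fun h => (rho1 (rho2 h)).2, fun c => ⟨fun h => (hasC c h).1,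
    hasC' c⟩, fun c h => (hasC c (hasC' c h)).2, fun c => ?_⟩
  refine (List.perm_ext_iff_of_nodup ?_ ?_).2 fun j => ?_
  · refine List.Nodup.map_on (fun k hk l hl e => ?_) List.nodup_range
    by_contra hkl
    have hk := List.mem_range.1 hk
    have hl := List.mem_range.1 hl
    exact not_three (hκ := hκ) hκ' (p := .cpair c k 1) (q := .cpair c k 0) (r := .cpair c l 0) hk hk
      hl (by simp) (by simp [hkl]) (by simp) (f3 c k hk).1.symm e
  · refine List.Nodup.map_on (fun k hk l hl e => ?_) List.nodup_range
    have := hκ (show Place.cpair c k 0 ∈ t.places from List.mem_range.1 hk)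
      (show Place.cpair c l 0 ∈ t.places from List.mem_range.1 hl) e
    simpa using this
  · simp only [List.mem_map, List.mem_range]
    constructor
    · rintro ⟨k, hk, rfl⟩
      rcases exists_place_of_lab hκ (f3 c k hk).2 with ⟨hc, e⟩ | ⟨l, hl, e⟩
      · exfalso
        have hc' := hasC' c hc
        exact not_three (hκ := hκ) hκ' (p := .cpair c k 0) (q := .cpair c k 1) (r := .cls c) hk hk
          hc' (by simp) (by simp) (by simp) (f3 c k hk).1
          (((f3 c k hk).1.symm.trans e).trans (hasC c hc').2.symm)
      · exact ⟨l, hl, e.symm⟩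
    · rintro ⟨k, hk, rfl⟩
      exact B c k hk

/-- Positivity is the point. The tokens of the bare edge and of the single classes match those of
`t` one by one and in order, while the blocks `α_{••}` of a given class may be permuted. Each such
block contributes an even product of two tokens, so no sign appears and the coefficient is exactly
`1`. -/
theorem coef_eval_mono (hκ' : Set.InjOn κ' t'.places)
    (h : coef (tokList t κ) ((marking t κ hκ).eval (mono t' κ')) ≠ 0) :
    t' = t ∧ coef (tokList t κ) ((marking t κ hκ).eval (mono t' κ')) = 1 := by
  have hf : Fits (marking t κ hκ) t' κ' := fits_of_eval_ne_zero (marking t κ hκ) hκ' fun e => h (by rw [e, map_zero])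
  rw [eval_mono (marking t κ hκ) hκ' hf] at h ⊢
  obtain ⟨r1, r2, c1, c2, b⟩ := tokens_eq hκ' hf (perm_of_coef_ne_zero (nodup_tokList hκ) h)
  have hmult : ∀ c, t'.mult c = t.mult c := fun c => by simpa using (b c).length_eq
  have ht : t' = t := by
    obtain ⟨ρ, S, T, u, v⟩ := t
    obtain ⟨ρ', S', T', u', v'⟩ := t'
    have hρ : ρ' = ρ := by
      simp only at r1
      omega
    have hS : S' = S := Finset.ext fun a => c1 (Sum.inl a)
    have hT : T' = T := Finset.ext fun a => c1 (Sum.inr a)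
    have hu : u' = u := funext fun a => hmult (Sum.inl a)
    have hv : v' = v := funext fun a => hmult (Sum.inr a)
    subst hρ hS hT hu hv
    rfl
  subst ht
  refine ⟨rfl, ?_⟩
  rw [← coef_tokProd_self (nodup_tokList hκ)]
  congr 1
  have hc : ∀ x y : Fin n, Commute (tk (.inl x) * tk (.inr x)) (tk (.inl y) * tk (.inr y)) := by
    intro x y
    have h1 : ∀ a b c : Tok n, Commute (tk a * tk b) (tk c) := by
      intro a b c
      rw [Commute, SemiconjBy, mul_assoc, tk_anticomm b c, mul_neg, ← mul_assoc, tk_anticomm a c]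
      simp [mul_assoc]
    exact (h1 _ _ _).mul_right (h1 _ _ _)
  have e3 : ∀ c : Fin g ⊕ Fin g, ((List.range (t'.mult c)).map fun k =>
      tk (.inl ((marking t' κ hκ).rep (κ' (.cpair c k 0)))) * tk (.inr ((marking t' κ hκ).rep (κ' (.cpair c k 0))))).prod =
      ((List.range (t'.mult c)).map fun k =>
        tk (.inl (κ (.cpair c k 0))) * tk (.inr (κ (.cpair c k 0)))).prod := by
    intro c
    have h1 := ((b c).map fun j : Fin n => tk (.inl j) * tk (.inr j)).prod_eq' (by
      refine List.pairwise_of_forall_mem_list fun x hx y hy => ?_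
      obtain ⟨j, -, rfl⟩ := List.mem_map.1 hx
      obtain ⟨k, -, rfl⟩ := List.mem_map.1 hy
      exact hc j k)
    rwa [List.map_map, List.map_map] at h1
  rw [tokProd_tokList, tokProd_tokList]
  simp only [Function.comp_apply]
  congr 1
  · congr 1
    · congr 1
      · congr 1
        · split_ifs with hr
          · rw [r2 hr]
          · rfl
        · refine congrArg List.prod (List.map_congr_left fun a _ => ?_)
          split_ifs with ha
          · rw [c2 (Sum.inl a) ha]
          · rfl
      · refine congrArg List.prod (List.map_congr_left fun a _ => ?_)
        split_ifs with ha
        · rw [c2 (Sum.inr a) ha]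
        · rfl
    · exact congrArg List.prod (List.map_congr_left fun a _ => e3 (Sum.inl a))
  · exact congrArg List.prod (List.map_congr_left fun a _ => e3 (Sum.inr a))

end Compare

/-! ### Degrees of monomials -/

section Degree

variable {g n : ℕ}

theorem gen_mem_E2piece (s : Gen g n) : gen s ∈ E2piece g n s.deg :=
  Submodule.subset_span ⟨[s], by simp, by simp⟩

theorem one_mem_E2piece : (1 : E2 g n) ∈ E2piece g n 0 :=
  Submodule.subset_span ⟨[], by simp, by simp⟩

theorem mul_mem_E2piece {m m' : Deg} {x y : E2 g n} (hx : x ∈ E2piece g n m)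
    (hy : y ∈ E2piece g n m') : x * y ∈ E2piece g n (m + m') := by
  have h1 : ∀ l : List (Gen g n), (l.map Gen.deg).sum = m → ∀ y ∈ E2piece g n m',
      (l.map gen).prod * y ∈ E2piece g n (m + m') := by
    intro l hl y hy
    have h : E2piece g n m' ≤
        (E2piece g n (m + m')).comap (LinearMap.mulLeft ℚ (l.map gen).prod) := by
      refine Submodule.span_le.2 ?_
      rintro _ ⟨l', hl', rfl⟩
      exact Submodule.subset_span ⟨l ++ l', by simp [hl, hl'], by simp⟩
    exact h hy
  have h2 : E2piece g n m ≤ (E2piece g n (m + m')).comap (LinearMap.mulRight ℚ y) := by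
    refine Submodule.span_le.2 ?_
    rintro _ ⟨l, hl, rfl⟩
    exact h1 l hl y hy
  exact h2 hx

theorem gg_mem_E2piece (i j : Fin n) : gg i j ∈ E2piece g n (0, 1, 1, 1) := by
  by_cases h : i = j
  · rw [h, gg_self]
    exact zero_mem _
  · rw [gg_of_ne h]
    exact gen_mem_E2piece (Gen.G _)

theorem list_prod_mem_E2piece {β : Type*} (l : List β) (f : β → E2 g n) (D : β → Deg)
    (h : ∀ b, f b ∈ E2piece g n (D b)) : (l.map f).prod ∈ E2piece g n (l.map D).sum := by
  induction l with
  | nil => exact one_mem_E2piece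
  | cons b l ih => exact mul_mem_E2piece (h b) ih

theorem clsPart_mem_E2piece (e : Fin g → Fin g ⊕ Fin g) (D : Deg)
    (hD : ∀ a i, (Gen.C (e a) i : Gen g n).deg = D) (S : Finset (Fin g)) (κ : Place g → Fin n) :
    clsPart e S κ ∈ E2piece g n (S.card • D) := by
  have h := list_prod_mem_E2piece (g := g) (n := n) (List.finRange g)
    (fun a => if a ∈ S then gen (Gen.C (e a) (κ (.cls (e a)))) else 1)
    (fun a => if a ∈ S then D else 0) fun a => by
      split_ifs
      · rw [← hD a (κ (.cls (e a)))]
        exact gen_mem_E2piece _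
      · exact one_mem_E2piece
  rwa [← Fin.sum_univ_def, Finset.sum_ite_mem, Finset.univ_inter, Finset.sum_const] at h

theorem cpairPart_mem_E2piece (e : Fin g → Fin g ⊕ Fin g) (D : Deg)
    (hD : ∀ a i, (Gen.C (e a) i : Gen g n).deg = D) (u : Fin g → ℕ) (κ : Place g → Fin n) :
    cpairPart e u κ ∈ E2piece g n ((∑ a, u a) • ((0, 1, 1, 1) + D)) := by
  have h := list_prod_mem_E2piece (g := g) (n := n) (List.finRange g)
    (fun a => ((List.range (u a)).map fun k => cpairFactor (e a) k κ).prod)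
    (fun a => u a • ((0, 1, 1, 1) + D)) fun a => by
      have h := list_prod_mem_E2piece (List.range (u a)) (fun k => cpairFactor (e a) k κ)
        (fun _ => (0, 1, 1, 1) + D) fun k => by
          rw [← hD a (κ (.cpair (e a) k 0))]
          exact mul_mem_E2piece (gg_mem_E2piece _ _) (gen_mem_E2piece _)
      rwa [List.map_const', List.sum_replicate, List.length_range] at h
  rwa [← Fin.sum_univ_def, ← Finset.sum_smul] at h

theorem mono_mem_E2piece (t : Gam g) (κ : Place g → Fin n) : mono t κ ∈ E2piece g n t.deg := by
  have h1 : pairPart t.rho κ ∈ E2piece g n ((t.rho : ℕ) • (0, 1, 1, 1)) := by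
    unfold pairPart
    split_ifs with h
    · rw [h]
      simpa using gg_mem_E2piece _ _
    · have h : t.rho = 0 := by omega
      rw [h]
      simpa using one_mem_E2piece
  have h := mul_mem_E2piece (mul_mem_E2piece (mul_mem_E2piece (mul_mem_E2piece h1
    (clsPart_mem_E2piece Sum.inl (1, 0, 1, 0) (fun _ _ => rfl) t.S κ))
    (clsPart_mem_E2piece Sum.inr (1, 0, 0, 1) (fun _ _ => rfl) t.T κ))
    (cpairPart_mem_E2piece Sum.inl (1, 0, 1, 0) (fun _ _ => rfl) t.u κ))
    (cpairPart_mem_E2piece Sum.inr (1, 0, 0, 1) (fun _ _ => rfl) t.v κ)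
  have hdeg : t.deg = (t.rho : ℕ) • (0, 1, 1, 1) + t.S.card • (1, 0, 1, 0) +
      t.T.card • (1, 0, 0, 1) + (∑ a, t.u a) • ((0, 1, 1, 1) + (1, 0, 1, 0)) +
      (∑ a, t.v a) • ((0, 1, 1, 1) + (1, 0, 0, 1)) := by
    simp only [Gam.deg, Prod.smul_mk, Prod.mk_add_mk, smul_eq_mul, Prod.mk.injEq]
    refine ⟨?_, ?_, ?_, ?_⟩ <;> ring
  rw [hdeg]
  exact h

theorem symm_mem_E2piece {m : Deg} {z : E2 g n} (hz : z ∈ E2piece g n m) :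
    symm g n z ∈ E2piece g n m := by
  rw [symm_apply]
  refine Submodule.smul_mem _ _ (Submodule.sum_mem _ fun σ _ => ?_)
  have h : E2piece g n m ≤ (E2piece g n m).comap (perm σ).toLinearMap := by
    refine Submodule.span_le.2 ?_
    rintro _ ⟨l, hl, rfl⟩
    refine Submodule.subset_span ⟨l.map (Gen.perm σ), ?_, ?_⟩
    · rw [← hl, List.map_map]
      refine congrArg List.sum (List.map_congr_left fun s _ => ?_)
      rcases s with e | ⟨c | c, i⟩ <;> rfl
    · change _ = perm σ (l.map gen).prod
      rw [map_list_prod, List.map_map, List.map_map]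
      exact congrArg List.prod (List.map_congr_left fun s _ => (perm_gen σ s).symm)
  exact h hz

end Degree

/-! ### Independence of the choice of points -/

section Choice

variable {g n : ℕ}

/-- Two injective fillings differ on the places of `t` by a partial bijection of the points. It
extends to a permutation, which averaging absorbs. -/
theorem symm_mono_eq {t : Gam g} {κ κ' : Place g → Fin n} (hκ : Set.InjOn κ t.places)
    (hκ' : Set.InjOn κ' t.places) : symm g n (mono t κ) = symm g n (mono t κ') := by
  classical
  let e := (hκ.bijOn_image.equiv κ).symm.trans (hκ'.bijOn_image.equiv κ')
  have he : ∀ p (hp : p ∈ t.places), e ⟨κ p, Set.mem_image_of_mem κ hp⟩ =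
      ⟨κ' p, Set.mem_image_of_mem κ' hp⟩ := by
    intro p hp
    have h1 : (hκ.bijOn_image.equiv κ) ⟨p, hp⟩ = ⟨κ p, Set.mem_image_of_mem κ hp⟩ := rfl
    rw [← h1]
    simp only [e, Equiv.trans_apply, Equiv.symm_apply_apply]
    rfl
  let σ : Equiv.Perm (Fin n) := Equiv.extendSubtype e
  have hσ : ∀ p ∈ t.places, (σ ∘ κ) p = κ' p := by
    intro p hp
    have h := Equiv.extendSubtype_apply_of_mem e (κ p) (Set.mem_image_of_mem κ hp)
    rw [Function.comp_apply, h, he p hp]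
  rw [← symm_perm σ, perm_mono, mono_congr hσ]

/-- The places of a tuple, as a sum of finite types. -/
def slotEquiv (t : Gam g) : Slot t ≃
    (PLift (t.rho = 1) × Fin 2) ⊕ t.S ⊕ t.T ⊕ (Σ a, Fin (t.u a) × Fin 2) ⊕
      (Σ a, Fin (t.v a) × Fin 2) where
  toFun
    | .pair h b => .inl (⟨h⟩, b)
    | .x a h => .inr (.inl ⟨a, h⟩)
    | .y a h => .inr (.inr (.inl ⟨a, h⟩))
    | .xpair a k b => .inr (.inr (.inr (.inl ⟨a, k, b⟩)))
    | .ypair a k b => .inr (.inr (.inr (.inr ⟨a, k, b⟩)))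
  invFun
    | .inl (h, b) => .pair h.down b
    | .inr (.inl a) => .x a a.2
    | .inr (.inr (.inl a)) => .y a a.2
    | .inr (.inr (.inr (.inl ⟨a, k, b⟩))) => .xpair a k b
    | .inr (.inr (.inr (.inr ⟨a, k, b⟩))) => .ypair a k b
  left_inv s := by cases s <;> rfl
  right_inv s := by rcases s with ⟨⟨h⟩, b⟩ | a | a | ⟨a, k, b⟩ | ⟨a, k, b⟩ <;> rfl

instance (t : Gam g) : Finite (Slot t) := Finite.of_equiv _ (slotEquiv t).symm

theorem card_slot (t : Gam g) : Nat.card (Slot t) = t.len := by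
  have h : Nat.card (PLift (t.rho = 1)) = (t.rho : ℕ) := by
    by_cases h : t.rho = 1
    · have : Unique (PLift (t.rho = 1)) := ⟨⟨⟨h⟩⟩, fun _ => rfl⟩
      rw [Nat.card_unique, h]
      rfl
    · have : IsEmpty (PLift (t.rho = 1)) := ⟨fun x => h x.down⟩
      have h0 : t.rho = 0 := by omega
      rw [Nat.card_of_isEmpty, h0]
      rfl
  rw [Nat.card_congr (slotEquiv t)]
  simp only [Nat.card_sum, Nat.card_prod, h, Nat.card_sigma, Nat.card_fin, Gam.len,
    Nat.card_eq_finsetCard, ← Finset.sum_mul]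
  ring

theorem exists_injOn (hn : 1 ≤ n) {t : Gam g} (ht : t.len ≤ n) :
    ∃ κ : Place g → Fin n, Set.InjOn κ t.places := by
  have := Fintype.ofFinite (Slot t)
  have hc : Fintype.card (Slot t) ≤ Fintype.card (Fin n) := by
    rw [← Nat.card_eq_fintype_card, card_slot, Fintype.card_fin]
    exact ht
  obtain ⟨f⟩ := Function.Embedding.nonempty_of_card_le hc
  -- Places outside `t` receive an arbitrary point, which exists because `1 ≤ n`.
  refine ⟨Function.extend Slot.place f fun _ => ⟨0, hn⟩, ?_⟩
  rw [← Slot.range_place]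
  rintro _ ⟨s, rfl⟩ _ ⟨s', rfl⟩ h
  rw [Slot.place_injective.extend_apply, Slot.place_injective.extend_apply] at h
  rw [f.injective h]

theorem len_le_of_injOn {t : Gam g} {κ : Place g → Fin n} (hκ : Set.InjOn κ t.places) :
    t.len ≤ n := by
  rw [← card_slot, ← Nat.card_fin n]
  refine Nat.card_le_card_of_injective (fun s : Slot t => κ s.place) fun s s' h => ?_
  refine Slot.place_injective (hκ ?_ ?_ h)
  · rw [← Slot.range_place]; exact ⟨s, rfl⟩
  · rw [← Slot.range_place]; exact ⟨s', rfl⟩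

theorem symm_monomial_eq (hn : 1 ≤ n) {t : Gam g} {ι : Slot t → Fin n} (hι : Function.Injective ι)
    {κ : Place g → Fin n} (hκ : Set.InjOn κ t.places) :
    symm g n (monomial t ι) = symm g n (mono t κ) := by
  have he : ∀ s, Function.extend Slot.place ι (fun _ => ⟨0, hn⟩) s.place = ι s :=
    Slot.place_injective.extend_apply _ _
  rw [monomial_eq_mono t ι _ he]
  refine symm_mono_eq ?_ hκ
  rw [← Slot.range_place]
  rintro _ ⟨s, rfl⟩ _ ⟨s', rfl⟩ h
  rw [he, he] at h
  rw [hι h]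

end Choice

/-! ### The differential of a symmetrized monomial -/

section Differential

variable {g n : ℕ}

/-- The subalgebra of cocycles. -/
def cocycles (g n : ℕ) : Subalgebra ℚ (E2 g n) where
  carrier := {z | d g n z = 0}
  mul_mem' {a b} ha hb := by
    change d g n (a * b) = 0
    rw [d_mul, show d g n a = 0 from ha, show d g n b = 0 from hb, zero_mul, mul_zero, add_zero]
  add_mem' {a b} ha hb := by
    change d g n (a + b) = 0
    rw [map_add, show d g n a = 0 from ha, show d g n b = 0 from hb, add_zero]
  algebraMap_mem' r := by
    change theta g n (algebraMap ℚ _ r) 0 1 = 0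
    simp [AlgHom.commutes, Matrix.algebraMap_matrix_apply]

theorem d_gen_C (c : Fin g ⊕ Fin g) (i : Fin n) : d g n (gen (Gen.C c i)) = 0 := by
  rw [d_gen]; rfl

theorem d_gg {i j : Fin n} (h : i ≠ j) : d g n (gg i j) = diagClass i j := by
  rw [gg_of_ne h, d_gen]; rfl

/-- The differential of `g_{ij} α_i` is the diagonal class times `α_i`. Each of its terms contains a
product of two classes at `i`, so every factor other than the bare edge is a cocycle. -/
theorem d_mono_of_rho_zero {t : Gam g} (ht : t.rho = 0) (κ : Place g → Fin n) :
    d g n (mono t κ) = 0 := by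
  refine mono_mem (cocycles g n) t κ (fun h => by simp [ht] at h) (fun c _ => d_gen_C c _)
    fun c k _ => ?_
  change d g n (cpairFactor c k κ) = 0
  rw [cpairFactor]
  by_cases h : κ (.cpair c k 0) = κ (.cpair c k 1)
  · rw [h, gg_self, zero_mul, map_zero]
  · rw [d_mul, d_gen_C, mul_zero, add_zero, d_gg h, gen_cls, diagClass_mul_cls]

theorem d_mono_of_rho_one {t : Gam g} (ht : t.rho = 1) {κ : Place g → Fin n}
    (hκ : Set.InjOn κ t.places) : d g n (mono t κ) =
      diagClass (κ (.pair 0)) (κ (.pair 1)) * mono { t with rho := 0 } κ := by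
  rw [exists_mono_of_rho ht, d_mul, d_gg (pair_ne hκ ht), d_mono_of_rho_zero rfl, mul_zero,
    add_zero]

/-- With no bare edge left, `y⁽ᵃ⁾` passes all of `S` and the part of `T` below `a`, then `x⁽ᵃ⁾`
passes the part of `S` below `a`. This is the sign in `dGamBasis`. -/
theorem symm_xx_mul_yy_mul_mono {t : Gam g} {κ : Place g → Fin n} {i j : Fin n} (hij : i ≠ j)
    (ht : t.rho = 0) (hκ : Avoids t κ {i, j}) {a : Fin g} (hS : a ∉ t.S) (hT : a ∉ t.T)
    {κ' : Place g → Fin n}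
    (hκ' : Set.InjOn κ' (⟨0, insert a t.S, insert a t.T, t.u, t.v⟩ : Gam g).places) :
    symm g n (xx a i * (yy a j * mono t κ)) =
      (-1 : ℚ) ^ (t.S.card + (t.S.filter (· < a)).card + (t.T.filter (· < a)).card) •
        symm g n (mono ⟨0, insert a t.S, insert a t.T, t.u, t.v⟩ κ') := by
  have h1 := hκ.update (i := j) (by simp) (Gam.notMem_places_cls (c := Sum.inr a) hT)
    (Gam.places_addCls t (Sum.inr a))
  have h2 := h1.update (i := i) (by simp [hij])
    (Gam.notMem_places_cls (c := Sum.inl a) (t := t.addCls (Sum.inr a)) hS)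
    (Gam.places_addCls _ (Sum.inl a))
  have e := gen_mul_mono_inl (n := n) (t := t.addCls (Sum.inr a)) hS
    (Function.update κ (.cls (Sum.inr a)) j) i
  have ht' : (⟨0, insert a t.S, insert a t.T, t.u, t.v⟩ : Gam g) =
      (t.addCls (Sum.inr a)).addCls (Sum.inl a) := by
    simp only [Gam.addCls, ht]
  rw [ht'] at hκ' ⊢
  rw [yy, gen_mul_mono_inr hT, xx, mul_smul_comm]
  change symm g n (_ • (gen (Gen.C (Sum.inl a) i) * mono (t.addCls (Sum.inr a)) _)) = _
  rw [e, smul_smul, map_smul, ← pow_add]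
  change _ • symm g n (mono ((t.addCls (Sum.inr a)).addCls (Sum.inl a)) _) = _
  rw [symm_mono_eq h2.1 hκ']
  congr 2
  simp only [Gam.addCls, ht, Fin.val_zero]
  ring

/-- One of the two new classes repeats a single class of `t`, and exchanging the two points involved
changes the sign. -/
theorem symm_xx_mul_yy_mul_mono_eq_zero {t : Gam g} {κ : Place g → Fin n} {i j : Fin n}
    (hij : i ≠ j) (hκ : Avoids t κ {i, j}) {a : Fin g} (ha : a ∈ t.S ∨ a ∈ t.T) :
    symm g n (xx a i * (yy a j * mono t κ)) = 0 := by
  have hi : ∀ p ∈ t.places, κ p ≠ i := fun p hp e => hκ.2 p hp (by simp [e])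
  have hj : ∀ p ∈ t.places, κ p ≠ j := fun p hp e => hκ.2 p hp (by simp [e])
  rcases ha with ha | ha
  · rw [← mul_assoc, xx, yy, gen_anticomm, neg_mul, map_neg, mul_assoc,
      symm_gen_mul_mono (c := Sum.inl a) ha hκ.1 hi, neg_zero]
    rw [perm_gen_C, Equiv.swap_apply_of_ne_of_ne hij.symm (hj (.cls (Sum.inl a)) ha).symm]
  · rw [xx, yy, symm_gen_mul_mono (c := Sum.inr a) ha hκ.1 hj]
    rw [perm_gen_C, Equiv.swap_apply_of_ne_of_ne hij (hi (.cls (Sum.inr a)) ha).symm]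

/-- Exchanging `i` and `j` fixes the monomial and interchanges the two halves of the diagonal class.
This is the source of the factor `2`. -/
theorem symm_diagClass_mul_mono {t : Gam g} {κ : Place g → Fin n} {i j : Fin n}
    (hκ : Avoids t κ {i, j}) : symm g n (diagClass i j * mono t κ) =
      (-2 : ℚ) • ∑ a, symm g n (xx a i * (yy a j * mono t κ)) := by
  have hsw : ∀ a, symm g n (xx a j * (yy a i * mono t κ)) =
      symm g n (xx a i * (yy a j * mono t κ)) := by
    intro a
    rw [← symm_perm (Equiv.swap i j)]
    simp only [map_mul, perm_mono, xx, yy, perm_gen_C, Equiv.swap_apply_left,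
      Equiv.swap_apply_right]
    rw [mono_congr (κ := Equiv.swap i j ∘ κ) (κ' := κ)]
    intro p hp
    exact Equiv.swap_apply_of_ne_of_ne (fun e => hκ.2 p hp (by simp [e]))
      fun e => hκ.2 p hp (by simp [e])
  rw [diagClass, neg_mul, Finset.sum_mul, map_neg, map_sum, Finset.smul_sum, ← Finset.sum_neg_distrib]
  refine Finset.sum_congr rfl fun a _ => ?_
  rw [add_mul, map_add, mul_assoc, mul_assoc, hsw a]
  module

end Differential

/-! ### The comparison map -/

section Comparison

variable {g n : ℕ}

theorem marking_rep_of_head {t : Gam g} {κ : Place g → Fin n} (hκ : Set.InjOn κ t.places)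
    {p : Place g} (hp : p ∈ t.places) : (marking t κ hκ).rep (κ p) = κ p.head :=
  repOf_apply hκ hp

/-- Tokens sit at heads of blocks, which the marking of `t` itself fixes, so the evaluated token
list is the original one. -/
theorem coef_eval_mono_self {t : Gam g} {κ : Place g → Fin n} (hκ : Set.InjOn κ t.places) :
    coef (tokList t κ) ((marking t κ hκ).eval (mono t κ)) = 1 := by
  have hf : Fits (marking t κ hκ) t κ := by
    refine ⟨fun h => ?_, fun c hc => ?_, fun c k hk => ⟨?_, ?_⟩⟩
    · rw [marking_rep_of_head hκ (p := .pair 0) h, marking_rep_of_head hκ (p := .pair 1) h]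
      rfl
    · exact lab_rep_apply hκ (p := .cls c) hc
    · rw [marking_rep_of_head hκ (p := .cpair c k 0) hk,
        marking_rep_of_head hκ (p := .cpair c k 1) hk]
      rfl
    · exact lab_rep_apply hκ (p := .cpair c k 0) hk
  refine (coef_eval_mono hκ ?_).2
  have h : tokList t ((marking t κ hκ).rep ∘ κ) = tokList t κ := by
    refine List.map_congr_left fun x hx => ?_
    have hm := placeList_mem_places hx
    rcases x with p | p
    · have hh : p.head = p := by
        rcases inl_mem_placeList.1 hx with ⟨-, rfl⟩ | ⟨c, k, -, rfl⟩ <;> rfl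
      have := marking_rep_of_head hκ hm
      simp only [Sum.elim_inl, id_eq, hh] at this
      simp [this]
    · have hh : p.head = p := by
        rcases inr_mem_placeList.1 hx with ⟨c, -, rfl⟩ | ⟨c, k, -, rfl⟩ <;> rfl
      have := marking_rep_of_head hκ hm
      simp only [Sum.elim_inr, id_eq, hh] at this
      simp [this]
  rw [eval_mono _ hκ hf, h, coef_tokProd_self (nodup_tokList hκ)]
  exact one_ne_zero

/-- The functional detecting the tuple `t` on symmetrized monomials. -/
def detect (t : Gam g) (κ : Place g → Fin n) (hκ : Set.InjOn κ t.places) : E2 g n →ₗ[ℚ] ℚ :=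
  (coef (tokList t κ)).comp (marking t κ hκ).eval.toLinearMap

theorem detect_symm {t : Gam g} {κ : Place g → Fin n} (hκ : Set.InjOn κ t.places) (z : E2 g n) :
    detect t κ hκ (symm g n z) = (1 / (n.factorial : ℚ)) *
      ∑ σ : Equiv.Perm (Fin n), detect t κ hκ (perm σ z) := by
  rw [symm_apply, map_smul, map_sum, smul_eq_mul]

theorem injOn_comp {t : Gam g} {κ : Place g → Fin n} (hκ : Set.InjOn κ t.places)
    (σ : Equiv.Perm (Fin n)) : Set.InjOn (σ ∘ κ) t.places :=
  σ.injective.comp_injOn hκ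

theorem detect_symm_mono_of_ne {t t' : Gam g} {κ κ' : Place g → Fin n}
    (hκ : Set.InjOn κ t.places) (hκ' : Set.InjOn κ' t'.places) (h : t' ≠ t) :
    detect t κ hκ (symm g n (mono t' κ')) = 0 := by
  rw [detect_symm, Finset.sum_eq_zero, mul_zero]
  intro σ _
  rw [perm_mono]
  by_contra hne
  exact h (coef_eval_mono (injOn_comp hκ' σ) hne).1

/-- Each permutation contributes `0` or `1`, and the identity contributes `1`. -/
theorem detect_symm_mono_pos {t : Gam g} {κ : Place g → Fin n} (hκ : Set.InjOn κ t.places) :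
    0 < detect t κ hκ (symm g n (mono t κ)) := by
  rw [detect_symm]
  refine mul_pos (by positivity) (Finset.sum_pos' (fun σ _ => ?_) ⟨1, Finset.mem_univ _, ?_⟩)
  · rw [perm_mono]
    by_cases h : detect t κ hκ (mono t (σ ∘ κ)) = 0
    · exact h.ge
    · have := (coef_eval_mono (injOn_comp hκ σ) h).2
      change detect t κ hκ (mono t (σ ∘ κ)) = 1 at this
      rw [this]
      exact zero_le_one
  · rw [perm_mono]
    change 0 < coef (tokList t κ) ((marking t κ hκ).eval (mono t κ))
    rw [coef_eval_mono_self hκ]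
    exact one_pos

theorem detect_eq_zero_of_deg_ne {t : Gam g} {κ : Place g → Fin n} (hκ : Set.InjOn κ t.places)
    {m : Deg} (hm : t.deg ≠ m) {z : E2 g n} (hz : z ∈ E2piece g n m) : detect t κ hκ z = 0 := by
  refine coef_eval_eq_zero _ (nodup_tokList hκ) (fun h => hm ?_) hz
  -- The degree of the token list need not be computed: it must be `t.deg`, since otherwise the
  -- functional would vanish on `mono t κ`, where its value is `1`.
  by_contra hne
  have h1 := coef_eval_mono_self hκ
  rw [coef_eval_eq_zero _ (nodup_tokList hκ) (fun h' => hne (h'.symm.trans h))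
    (mono_mem_E2piece t κ)] at h1
  exact zero_ne_one h1

/-- A choice of distinct points for the places of a tuple of length at most `n`. -/
def filling (hn : 1 ≤ n) (t : Gam g) : Place g → Fin n :=
  if h : t.len ≤ n then (exists_injOn hn h).choose else fun _ => ⟨0, hn⟩

theorem filling_injOn (hn : 1 ≤ n) {t : Gam g} (h : t.len ≤ n) :
    Set.InjOn (filling hn t) t.places := by
  rw [filling, dif_pos h]
  exact (exists_injOn hn h).choose_spec

/-- The linear map sending `f_t` to the symmetrization of the monomial of `t`. -/
def genMap (g : ℕ) {n : ℕ} (hn : 1 ≤ n) : (Gam g →₀ ℚ) →ₗ[ℚ] E2 g n :=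
  Finsupp.linearCombination ℚ fun t => symm g n (mono t (filling hn t))

theorem genMap_single (hn : 1 ≤ n) (t : Gam g) (r : ℚ) :
    genMap g hn (Finsupp.single t r) = r • symm g n (mono t (filling hn t)) := by
  simp [genMap]

theorem genMap_mem (hn : 1 ≤ n) (f : Gam g →₀ ℚ) : genMap g hn f ∈ E2Inv g n := by
  rw [genMap, Finsupp.linearCombination_apply]
  exact Submodule.sum_mem _ fun t _ => Submodule.smul_mem _ _ (symm_mem_E2Inv _)

theorem len_le_of_mem {f : Gam g →₀ ℚ} (hf : f ∈ QGam g n) {t : Gam g} (ht : t ∈ f.support) :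
    t.len ≤ n :=
  (Finsupp.mem_supported ℚ f).1 hf ht

/-- Up to a positive scalar the functionals `detect` are dual to the averaged monomials. Both
injectivity and the recovery of degrees rest on this. -/
theorem detect_genMap (hn : 1 ≤ n) {f : Gam g →₀ ℚ} (hf : f ∈ QGam g n) {t : Gam g}
    (ht : t.len ≤ n) : detect t (filling hn t) (filling_injOn hn ht) (genMap g hn f) =
      f t * detect t (filling hn t) (filling_injOn hn ht) (symm g n (mono t (filling hn t))) := by
  rw [genMap, Finsupp.linearCombination_apply, Finsupp.sum, map_sum]
  rw [Finset.sum_eq_single t]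
  · rw [map_smul, smul_eq_mul]
  · intro t' ht' hne
    rw [map_smul, detect_symm_mono_of_ne _ (filling_injOn hn (len_le_of_mem hf ht')) hne,
      smul_zero]
  · intro h
    rw [Finsupp.notMem_support_iff.1 h, zero_smul, map_zero]

/-- The comparison map, as a linear map. -/
def compMap (g : ℕ) {n : ℕ} (hn : 1 ≤ n) : QGam g n →ₗ[ℚ] E2Inv g n where
  toFun f := ⟨genMap g hn f.1, genMap_mem hn f.1⟩
  map_add' f f' := Subtype.ext (map_add (genMap g hn) f.1 f'.1)
  map_smul' r f := Subtype.ext (map_smul (genMap g hn) r f.1)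

theorem compMap_injective (hn : 1 ≤ n) : Function.Injective (compMap g hn) := by
  rw [← LinearMap.ker_eq_bot, LinearMap.ker_eq_bot']
  rintro ⟨f, hf⟩ h
  have h0 : genMap g hn f = 0 := congrArg Subtype.val h
  refine Subtype.ext (Finsupp.ext fun t => ?_)
  by_cases ht : t ∈ f.support
  · have h1 := detect_genMap hn hf (len_le_of_mem hf ht)
    rw [h0, map_zero] at h1
    exact (mul_eq_zero.1 h1.symm).resolve_right
      (detect_symm_mono_pos (filling_injOn hn (len_le_of_mem hf ht))).ne'
  · exact Finsupp.notMem_support_iff.1 ht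

theorem compMap_surjective (hn : 1 ≤ n) : Function.Surjective (compMap g hn) := by
  have h : monoSpan g n ≤ (QGam g n).map (genMap g hn) := by
    refine Submodule.span_le.2 ?_
    rintro _ ⟨t, κ, hκ, rfl⟩
    have ht := len_le_of_injOn hκ
    refine ⟨Finsupp.single t 1, Finsupp.single_mem_supported ℚ _ ht, ?_⟩
    rw [genMap_single, one_smul, symm_mono_eq hκ (filling_injOn hn ht)]
  rintro ⟨z, hz⟩
  have hz' := symm_mem_monoSpan hn z
  rw [symm_of_mem_E2Inv hz] at hz'
  obtain ⟨f, hf, e⟩ := h hz'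
  exact ⟨⟨f, hf⟩, Subtype.ext e⟩

/-- The comparison isomorphism. -/
def compEquiv (g : ℕ) {n : ℕ} (hn : 1 ≤ n) : QGam g n ≃ₗ[ℚ] E2Inv g n :=
  LinearEquiv.ofBijective (compMap g hn) ⟨compMap_injective hn, compMap_surjective hn⟩

theorem compEquiv_apply (hn : 1 ≤ n) (f : QGam g n) :
    (compEquiv g hn f : E2 g n) = genMap g hn f := rfl

theorem genMap_dGamBasis (hn : 1 ≤ n) {t : Gam g} (ht : t.len ≤ n) :
    genMap g hn (dGamBasis t) = d g n (symm g n (mono t (filling hn t))) := by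
  have hκ := filling_injOn hn ht
  rw [d_symm]
  by_cases hr : t.rho = 1
  · have hpl : t.places = insert (.pair 1)
        (insert (.pair 0) ({ t with rho := 0 } : Gam g).places) := by
      rw [← Gam.places_addPair, ← hr]
    have hav : Avoids ({ t with rho := 0 } : Gam g) (filling hn t)
        {filling hn t (.pair 0), filling hn t (.pair 1)} := by
      have hsub : ∀ p ∈ ({ t with rho := 0 } : Gam g).places, p ∈ t.places := fun p hp => by
        rw [hpl]; exact Set.mem_insert_of_mem _ (Set.mem_insert_of_mem _ hp)
      refine ⟨hκ.mono hsub, fun p hp => ?_⟩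
      have hnp : ∀ b, p ≠ .pair b := by
        rintro b rfl
        simp [Gam.places] at hp
      rw [Finset.mem_insert, Finset.mem_singleton, not_or]
      exact ⟨fun e => hnp 0 (hκ (hsub p hp) hr e), fun e => hnp 1 (hκ (hsub p hp) hr e)⟩
    rw [d_mono_of_rho_one hr hκ, symm_diagClass_mul_mono hav, dGamBasis, if_pos hr, map_smul,
      map_sum]
    congr 1
    -- The diagonal class sums over all `a`, but the terms with `a ∈ S ∪ T` average to zero.
    rw [← Finset.sum_subset (Finset.subset_univ (Finset.univ \ (t.S ∪ t.T)))]
    · refine Finset.sum_congr rfl fun a ha => ?_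
      obtain ⟨hS, hT⟩ : a ∉ t.S ∧ a ∉ t.T := by simpa using ha
      have hlen : (⟨0, insert a t.S, insert a t.T, t.u, t.v⟩ : Gam g).len ≤ n := by
        refine le_trans (le_of_eq ?_) ht
        simp only [Gam.len, hr, Finset.card_insert_of_notMem hS, Finset.card_insert_of_notMem hT,
          Fin.val_one, Fin.val_zero]
        ring
      rw [map_smul, genMap_single, one_smul]
      exact (symm_xx_mul_yy_mul_mono (pair_ne hκ hr) rfl hav hS hT (filling_injOn hn hlen)).symm
    · intro a _ ha
      refine symm_xx_mul_yy_mul_mono_eq_zero (pair_ne hκ hr) hav ?_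
      by_contra h
      exact ha (by simpa using h)
  · have hr0 : t.rho = 0 := by omega
    rw [d_mono_of_rho_zero hr0, map_zero, dGamBasis, if_neg hr, map_zero]

theorem genMap_dGamAll (hn : 1 ≤ n) {f : Gam g →₀ ℚ} (hf : f ∈ QGam g n) :
    genMap g hn (dGamAll g f) = d g n (genMap g hn f) := by
  conv_rhs => rw [genMap, Finsupp.linearCombination_apply, Finsupp.sum, map_sum]
  rw [dGamAll, Finsupp.linearCombination_apply, Finsupp.sum, map_sum]
  refine Finset.sum_congr rfl fun t ht => ?_
  rw [map_smul, map_smul, genMap_dGamBasis hn (len_le_of_mem hf ht)]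

end Comparison

end TotaroSS

end

/-! ### Assembly of the isomorphism of graded complexes. -/

theorem mainTheorem4 (g n : ℕ) (hn : 1 ≤ n) :
    ∃ φ : TotaroSS.QGam g n ≃ₗ[ℚ] TotaroSS.E2Inv g n,
      (∀ (t : TotaroSS.Gam g) (ht : t.len ≤ n) (ι : TotaroSS.Slot t → Fin n),
        Function.Injective ι →
          (φ (TotaroSS.basisVec t ht) : TotaroSS.E2 g n) =
            TotaroSS.symm g n (TotaroSS.monomial t ι)) ∧
      (∀ f : TotaroSS.QGam g n,
        φ (TotaroSS.dGam g n f) = TotaroSS.dInv g n (φ f)) ∧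
      (∀ (m : TotaroSS.Deg) (f : TotaroSS.QGam g n),
        f ∈ TotaroSS.QGamPiece g n m ↔ (φ f : TotaroSS.E2 g n) ∈ TotaroSS.E2piece g n m) := by
  refine ⟨TotaroSS.compEquiv g hn, fun t ht ι hι => ?_, fun f => ?_, fun m f => ⟨fun hf => ?_,
    fun hf => ?_⟩⟩
  · rw [TotaroSS.compEquiv_apply, TotaroSS.symm_monomial_eq hn hι (TotaroSS.filling_injOn hn ht)]
    exact (TotaroSS.genMap_single hn t 1).trans (one_smul _ _)
  · exact Subtype.ext (TotaroSS.genMap_dGamAll hn f.2)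
  · rw [TotaroSS.compEquiv_apply, TotaroSS.genMap, Finsupp.linearCombination_apply]
    refine Submodule.sum_mem _ fun t ht => Submodule.smul_mem _ _ ?_
    have hdeg : t.deg = m := (Finsupp.mem_supported ℚ f.1).1 hf ht
    exact hdeg ▸ TotaroSS.symm_mem_E2piece (TotaroSS.mono_mem_E2piece t _)
  -- The functional of a tuple `t` with `t.deg ≠ m` vanishes on degree `m` but returns a positive
  -- multiple of the coefficient of `t` in `f`, so no such `t` lies in the support.
  · refine (Finsupp.mem_supported ℚ f.1).2 fun t ht => ?_
    by_contra hdeg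
    have hlen := TotaroSS.len_le_of_mem f.2 ht
    have h1 := TotaroSS.detect_genMap hn f.2 hlen
    rw [← TotaroSS.compEquiv_apply, TotaroSS.detect_eq_zero_of_deg_ne _ hdeg hf] at h1
    exact (mul_ne_zero (Finsupp.mem_support_iff.1 ht)
      (TotaroSS.detect_symm_mono_pos (TotaroSS.filling_injOn hn hlen)).ne') h1.symm
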